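/- Let $N\ge 2$ and $n\ge 1$ be integers, and let $\Omega\subset\mathbb R^N$ be a bounded domain (non-empty, open, connected) with piecewise $\mathcal C^1$ boundary: there is a closed set $S\subset\partial\Omega$ with $\mathcal H^{N-1}(S)=0$ such that near every point $x\in\partial\Omega\setminus S$ the set $\Omega$ coincides with $\{\rho<0\}$ for some $\mathcal C^1$ function $\rho$ with $\nabla\rho(x)\neq 0$. For $u\in L^1(\Omega)$ let $\int_\Omega|\nabla u|=\sup\{\int_\Omega u\,\mathrm{div}\,\varphi:\varphi\in C^1_c(\Omega,\mathbb R^N),\ |\varphi|\le 1\}$, and let $BV(\Omega)$ be the set of those $u$ for which it is finite. A set $E\subset\mathbb R^N$ is called a Caccioppoli set (in $\Omega$) if $\chi_E\in BV(\Omega)$; $P(E,\Omega)=\sup\{\int_{E\cap\Omega}\mathrm{div}\,\varphi\}$, over the same $\varphi$, is its perimeter in $\Omega$; $E\subset\subset\Omega$ means that $\overline E$ is a compact subset of $\Omega$. The integral $\int_{\partial\Omega}|u|$ is that of the trace of $u$ with respect to $\mathcal H^{N-1}$; the trace of $u$ at $x\in\partial\Omega$ is the number $c$ for which the mean of $|u-c|$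 over $\Omega\cap B(x,r)$ tends to $0$ as $r\to0^+$. For $E\subset\mathbb R^N$, $|E\cap\Omega|$ is the Lebesgue measure, and $|E\cap\partial\Omega|$ is the $\mathcal H^{N-1}$-measure of the part of $\partial\Omega$ that belongs to $E$ in the sense of traces from $\Omega$, that is, of the set of $x\in\partial\Omega$ with $$\lim_{r\to 0^+}\frac{|E\cap\Omega\cap B(x,r)|}{|\Omega\cap B(x,r)|}=1 .$$ Put $$\lambda_{0,n}=\inf_{E\subset\subset\Omega}\Big\{\int_\Omega|\nabla\chi_E|+n\Big(\int_\Omega\chi_E-1\Big)^2\Big\},\qquad \lambda_{1,n}=\inf_{u\in W^{1,1}_0(\Omega)}\Big\{\int_\Omega|\nabla u|+n\Big(\int_\Omega|u|-1\Big)^2\Big\},$$ where in the first infimum $E$ runs over Caccioppoli sets and $W^{1,1}_0(\Omega)$ is the closure of $C_c^\infty(\Omega)$ in $W^{1,1}(\Omega)$. Then $$\lambda_{0,n}=\inf_{E\subset\mathbb R^N}\Big\{\int_\Omega|\nabla\chi_E|+\int_{\partial\Omega}\chi_E+n\Big(\int_\Omega\chi_E-1\Big)^2\Big\}=\inf_{E\subset\mathbb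 R^N}\Big\{P(E,\Omega)+|E\cap\partial\Omega|+n\big(|E\cap\Omega|-1\big)^2\Big\},$$ where $E$ runs over all Caccioppoli sets. Moreover $\lambda_{0,n}\ge\lambda_{1,n}$, and likewise $$\lambda_{0,n}\ge\inf_{u\in BV(\Omega)}\Big\{\int_\Omega|\nabla u|+\int_{\partial\Omega}|u|+n\Big(\int_\Omega|u|-1\Big)^2\Big\}.$$ -/

import Mathlib

open MeasureTheory Set Filter Topology
open scoped ENNReal ContDiff

noncomputable section

namespace PenalizedOneLaplacian

/-- Euclidean space `ℝ^N`. -/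
abbrev Space (N : ℕ) : Type := EuclideanSpace ℝ (Fin N)

/-- The divergence `∑ i, ∂φ_i/∂x_i` of a vector field. -/
def divergence {N : ℕ} (φ : Space N → Space N) (x : Space N) : ℝ :=
  ∑ i, (fderiv ℝ φ x (EuclideanSpace.single i 1)) i

/-- Admissible fields for the total variation in `Ω`: the `C¹` vector fields with compact
support in `Ω` and `|φ| ≤ 1` pointwise. -/
def IsTestField {N : ℕ} (Ω : Set (Space N)) (φ : Space N → Space N) : Prop :=
  ContDiff ℝ 1 φ ∧ HasCompactSupport φ ∧ tsupport φ ⊆ Ω ∧ ∀ x, ‖φ x‖ ≤ 1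

/-- The total variation `∫_Ω |∇u| = sup { ∫_Ω u div φ : φ an admissible field }`, in `[0, ∞]`. -/
def totalVariation {N : ℕ} (Ω : Set (Space N)) (u : Space N → ℝ) : ℝ≥0∞ :=
  ⨆ (φ : Space N → Space N) (_ : IsTestField Ω φ),
    ENNReal.ofReal (∫ x in Ω, u x * divergence φ x)

/-- `u ∈ BV(Ω)`; only the values of `u` on `Ω` matter. -/
def MemBV {N : ℕ} (Ω : Set (Space N)) (u : Space N → ℝ) : Prop :=
  IntegrableOn u Ω ∧ totalVariation Ω u < ⊤

/-- The characteristic function `χ_E`. -/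
def chi {N : ℕ} (E : Set (Space N)) : Space N → ℝ := E.indicator fun _ => 1

/-- `E` is a Caccioppoli set in `Ω`: its characteristic function belongs to `BV(Ω)`. -/
def IsCaccioppoli {N : ℕ} (Ω E : Set (Space N)) : Prop := MemBV Ω (chi E)

/-- The perimeter of `E` in `Ω`:
`P(E, Ω) = sup { ∫_{E ∩ Ω} div φ : φ an admissible field }`. -/
def perimeter {N : ℕ} (E Ω : Set (Space N)) : ℝ≥0∞ :=
  ⨆ (φ : Space N → Space N) (_ : IsTestField Ω φ),
    ENNReal.ofReal (∫ x in E ∩ Ω, divergence φ x)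

/-- `E ⊂⊂ Ω`: the closure of `E` is a compact subset of `Ω`. -/
def CompactlyIncluded {N : ℕ} (E Ω : Set (Space N)) : Prop :=
  IsCompact (closure E) ∧ closure E ⊆ Ω

/-- The surface measure on `∂Ω`: the `(N-1)`-dimensional Hausdorff measure, normalised so that it
agrees with Lebesgue measure on hyperplanes, restricted to the topological boundary. -/
def surfaceMeasure {N : ℕ} (Ω : Set (Space N)) : Measure (Space N) :=
  (Measure.euclideanHausdorffMeasure (N - 1)).restrict (frontier Ω)

/-- `c` is the trace of `u|_Ω` at the boundary point `x`: the mean of `|u - c|` over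
`Ω ∩ B(x, r)` tends to `0` as `r → 0⁺`. -/
def HasTraceAt {N : ℕ} (Ω : Set (Space N)) (u : Space N → ℝ) (x : Space N) (c : ℝ) : Prop :=
  Tendsto (fun r : ℝ => ⨍ y in Ω ∩ Metric.ball x r, |u y - c|) (𝓝[>] 0) (𝓝 0)

open Classical in
/-- The boundary trace of `u|_Ω` (with value `0` at the points where there is no trace; for
`u ∈ BV(Ω)` these form a null set for the surface measure). -/
def boundaryTrace {N : ℕ} (Ω : Set (Space N)) (u : Space N → ℝ) (x : Space N) : ℝ :=
  if h : ∃ c, HasTraceAt Ω u x c then h.choose else 0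

/-- `∫_{∂Ω} |u|`, the boundary values of `u` being taken in the sense of traces. -/
def boundaryIntegral {N : ℕ} (Ω : Set (Space N)) (u : Space N → ℝ) : ℝ≥0∞ :=
  ∫⁻ x, ‖boundaryTrace Ω u x‖ₑ ∂(surfaceMeasure Ω)

/-- The points of `∂Ω` that belong to `E` in the measure-theoretic sense from inside `Ω`, that is,
at which `E` has relative density one in `Ω`. -/
def boundaryPart {N : ℕ} (E Ω : Set (Space N)) : Set (Space N) :=
  {x ∈ frontier Ω |
    Tendsto (fun r : ℝ => volume (E ∩ (Ω ∩ Metric.ball x r)) / volume (Ω ∩ Metric.ball x r))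
      (𝓝[>] 0) (𝓝 1)}

/-- Near its boundary point `x`, the set `Ω` lies on one side of a `C¹` hypersurface: it is a
strict sublevel set of a `C¹` function whose differential at `x` does not vanish. -/
def IsC1BoundaryPoint {N : ℕ} (Ω : Set (Space N)) (x : Space N) : Prop :=
  ∃ (U : Set (Space N)) (ρ : Space N → ℝ), IsOpen U ∧ x ∈ U ∧ ContDiffOn ℝ 1 ρ U ∧
    fderiv ℝ ρ x ≠ 0 ∧ Ω ∩ U = {y ∈ U | ρ y < 0}

/-- The boundary of `Ω` is piecewise `C¹`: it is `C¹`, with `Ω` on one side, off a closed singular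
set of zero surface measure (edges, corners). -/
def HasPiecewiseC1Boundary {N : ℕ} (Ω : Set (Space N)) : Prop :=
  ∃ S : Set (Space N), IsClosed S ∧ S ⊆ frontier Ω ∧ surfaceMeasure Ω S = 0 ∧
    ∀ x ∈ frontier Ω \ S, IsC1BoundaryPoint Ω x

/-- Smooth functions with compact support in `Ω`. -/
def IsTestFunction {N : ℕ} (Ω : Set (Space N)) (φ : Space N → ℝ) : Prop :=
  ContDiff ℝ ∞ φ ∧ HasCompactSupport φ ∧ tsupport φ ⊆ Ω

/-- `u ∈ W^{1,1}(Ω)`, with weak gradient `g`. -/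
def IsW11 {N : ℕ} (Ω : Set (Space N)) (u : Space N → ℝ) (g : Space N → Space N) : Prop :=
  IntegrableOn u Ω ∧ IntegrableOn g Ω ∧
    ∀ ψ, IsTestFunction Ω ψ → ∫ x in Ω, u x • gradient ψ x = -∫ x in Ω, ψ x • g x

/-- `u ∈ W^{1,1}_0(Ω)`, with weak gradient `g`: `u` lies in the closure of `C_c^∞(Ω)` in
`W^{1,1}(Ω)`. -/
def IsW110 {N : ℕ} (Ω : Set (Space N)) (u : Space N → ℝ) (g : Space N → Space N) : Prop :=
  IsW11 Ω u g ∧ ∃ φ : ℕ → Space N → ℝ, (∀ k, IsTestFunction Ω (φ k)) ∧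
    Tendsto (fun k => ∫⁻ x in Ω, ‖φ k x - u x‖ₑ) atTop (𝓝 0) ∧
    Tendsto (fun k => ∫⁻ x in Ω, ‖gradient (φ k) x - g x‖ₑ) atTop (𝓝 0)

/-- The penalization `n (m - 1)²`, as an element of `[0, ∞]`. -/
def penalty (n : ℕ) (m : ℝ) : ℝ≥0∞ := ENNReal.ofReal (n * (m - 1) ^ 2)

/-- `λ_{0,n}`: the infimum over the Caccioppoli sets `E ⊂⊂ Ω` of
`∫_Ω |∇χ_E| + n (∫_Ω χ_E - 1)²`. -/
def lambdaZero {N : ℕ} (n : ℕ) (Ω : Set (Space N)) : ℝ≥0∞ :=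
  ⨅ (E : Set (Space N)) (_ : IsCaccioppoli Ω E ∧ CompactlyIncluded E Ω),
    totalVariation Ω (chi E) + penalty n (∫ x in Ω, chi E x)

/-- `λ_{1,n}`: the infimum over `u ∈ W^{1,1}_0(Ω)` of `∫_Ω |∇u| + n (∫_Ω |u| - 1)²`. -/
def lambdaOne {N : ℕ} (n : ℕ) (Ω : Set (Space N)) : ℝ≥0∞ :=
  ⨅ (u : Space N → ℝ) (g : Space N → Space N) (_ : IsW110 Ω u g),
    (∫⁻ x in Ω, ‖g x‖ₑ) + penalty n (∫ x in Ω, |u x|)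

/-- The relaxed form of `λ_{1,n}`: the infimum over `u ∈ BV(Ω)` of
`∫_Ω |∇u| + ∫_{∂Ω} |u| + n (∫_Ω |u| - 1)²`. -/
def lambdaOneRelaxed {N : ℕ} (n : ℕ) (Ω : Set (Space N)) : ℝ≥0∞ :=
  ⨅ (u : Space N → ℝ) (_ : MemBV Ω u),
    totalVariation Ω u + boundaryIntegral Ω u + penalty n (∫ x in Ω, |u x|)

end PenalizedOneLaplacian

end

open MeasureTheory Set Filter Topology
open scoped ENNReal ContDiff

noncomputable section

namespace PenalizedOneLaplacian

/-! ### Divergence, perimeter under multiplication by a cut-off, and step functions -/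

section

variable {N : ℕ}

/-! If `E ⊂⊂ Ω`, then `E` has density zero at every point of `∂Ω`, so the boundary terms vanish
(`boundaryPart_eq_empty`) and `λ_{0,n}` dominates both infima over all Caccioppoli sets. The
substance is the reverse inequality `lambdaZero_le`: up to a small error, any Caccioppoli set `E`
can be replaced by a set `E' ⊂⊂ Ω` with `|E \ E'|` small and `P(E', Ω) ≤ P(E, Ω) + |E ∩ ∂Ω|`
(`exists_compactlyIncluded`). Continuity of the penalty then concludes.

The set `E'` is `E ∩ {η > t}` for a cut-off `η ∈ C¹_c(Ω)` whose `∫_E |∇η|` hardly exceeds `|E ∩ ∂Ω|`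
(`exists_cutoff`). The height `t` is chosen by averaging, in the manner of the coarea formula
(`exists_superlevel_perimeter_le`). The cut-off is glued with a partition of unity. A neighbourhood
of the singular set costs almost nothing, since a compact set of zero `(N-1)`-dimensional Hausdorff
measure has zero capacity (`exists_cutoff_of_null`). Near a regular point `Ω = {ρ < 0}` with `|∇ρ|`
close to `1`, and a step function of `-(k+1)ρ` costs about `k + 1` times the measure of `E` in the
layer of depth `1/(k+1)` (`FlatChart.exists_boundary_cutoff`).

It remains to bound this layer mass by the surface measure of the part of `∂Ω` belonging to `E`
(`FlatChart.limsup_lintegral_layer_le`). Finite perimeter controls the differences of `χ_E` under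
small translations. Hence on almost every line transversal to `∂Ω`, `E` is either everything or
nothing just inside `Ω` (`FlatChart.ae_exists_const_slice`). Lines of the second kind contribute
nothing in the limit. Almost every line of the first kind is a density point of such lines, and the
boundary point on it then belongs to `E` in the sense of traces
(`FlatChart.ae_pt_mem_boundaryPart`). Projection along the lines does not increase Hausdorff
measure, so Lebesgue measure on the base is bounded by surface measure.

The two formulas agree because the trace of `χ_E` is determined by the density of `E`: it is `1`
where the density tends to `1`, and elsewhere it is `0` or does not exist
(`enorm_boundaryTrace_chi`). For `λ_{0,n} ≥ λ_{1,n}`, a mollification of `χ_E` keeps the mass and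
does not increase the variation (`exists_mollification`). For the relaxed problem `χ_E` itself is a
competitor. -/

lemma divergence_smul {η : Space N → ℝ} {φ : Space N → Space N} {x : Space N}
    (hη : DifferentiableAt ℝ η x) (hφ : DifferentiableAt ℝ φ x) :
    divergence (fun y => η y • φ y) x = η x * divergence φ x + fderiv ℝ η x (φ x) := by
  have h2 : φ x = ∑ i, (φ x i) • EuclideanSpace.single i (1 : ℝ) := by
    ext j
    simp [Finset.sum_apply, Pi.single_apply]
  rw [divergence, fderiv_fun_smul hη hφ]
  conv_rhs => rw [h2]
  simp only [map_sum, map_smul, divergence, Finset.mul_sum, ← Finset.sum_add_distrib]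
  refine Finset.sum_congr rfl fun i _ => ?_
  simp [mul_comm]

lemma continuous_divergence {φ : Space N → Space N} (hφ : ContDiff ℝ 1 φ) :
    Continuous (divergence φ) := by
  have h := hφ.continuous_fderiv one_ne_zero
  unfold divergence
  fun_prop

lemma tsupport_divergence_subset (φ : Space N → Space N) :
    tsupport (divergence φ) ⊆ tsupport φ := by
  refine closure_minimal (fun x hx => ?_) isClosed_closure
  by_contra h
  apply hx
  have : fderiv ℝ φ x = 0 := by
    by_contra h'
    exact h (support_fderiv_subset ℝ h')
  simp [divergence, this]

lemma hasCompactSupport_divergence {φ : Space N → Space N} (hφ : HasCompactSupport φ) :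
    HasCompactSupport (divergence φ) :=
  hφ.of_isClosed_subset isClosed_closure (tsupport_divergence_subset φ)

lemma IsTestField.integrable_divergence {Ω : Set (Space N)} {φ : Space N → Space N}
    (hφ : IsTestField Ω φ) : Integrable (divergence φ) :=
  (continuous_divergence hφ.1).integrable_of_hasCompactSupport (hasCompactSupport_divergence hφ.2.1)

/-- A cut-off in `C¹_c(Ω; [0, 1])` turns any bounded `C¹` field into an admissible one. -/
lemma isTestField_smul {Ω : Set (Space N)} {f : Space N → ℝ} {φ : Space N → Space N}
    (hf : ContDiff ℝ 1 f) (hfc : HasCompactSupport f) (hfΩ : tsupport f ⊆ Ω)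
    (hf01 : ∀ x, 0 ≤ f x ∧ f x ≤ 1) (hφ : ContDiff ℝ 1 φ) (hφ1 : ∀ x, ‖φ x‖ ≤ 1) :
    IsTestField Ω (fun x => f x • φ x) := by
  refine ⟨hf.smul hφ, hfc.smul_right, (closure_mono ?_).trans hfΩ, fun x => ?_⟩
  · exact Function.support_smul_subset_left f φ
  · rw [norm_smul, Real.norm_of_nonneg (hf01 x).1]
    exact mul_le_one₀ (hf01 x).2 (norm_nonneg _) (hφ1 x)

lemma ofReal_integral_divergence_le_perimeter {E Ω : Set (Space N)} {φ : Space N → Space N}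
    (hφ : IsTestField Ω φ) :
    ENNReal.ofReal (∫ x in E ∩ Ω, divergence φ x) ≤ perimeter E Ω :=
  le_iSup₂_of_le φ hφ le_rfl

lemma totalVariation_chi {E Ω : Set (Space N)} (hE : NullMeasurableSet E (volume.restrict Ω)) :
    totalVariation Ω (chi E) = perimeter E Ω := by
  unfold totalVariation perimeter
  congr! 4 with φ hφ
  have : (fun x => chi E x * divergence φ x) = E.indicator (divergence φ) := by
    ext x; by_cases hx : x ∈ E <;> simp [chi, hx]
  rw [this, integral_indicator₀ hE, Measure.restrict_restrict₀ hE]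

/-- Multiplying `χ_E` by a cut-off `f` raises the variation by at most `∫_E |∇f|`. -/
lemma ofReal_integral_cutoff_le {E Ω : Set (Space N)} (hEΩ : E ⊆ Ω)
    {f : Space N → ℝ} {φ : Space N → Space N}
    (hf : ContDiff ℝ 1 f) (hfc : HasCompactSupport f) (hfΩ : tsupport f ⊆ Ω)
    (hf01 : ∀ x, 0 ≤ f x ∧ f x ≤ 1) (hφ : ContDiff ℝ 1 φ) (hφ1 : ∀ x, ‖φ x‖ ≤ 1) :
    ENNReal.ofReal (∫ x in E, f x * divergence φ x) ≤
      perimeter E Ω + ∫⁻ x in E, ‖fderiv ℝ f x‖ₑ := by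
  have ht := isTestField_smul hf hfc hfΩ hf01 hφ hφ1
  have hfd := hf.continuous_fderiv one_ne_zero
  have hi1 : Integrable fun x => fderiv ℝ f x (φ x) := by
    refine Continuous.integrable_of_hasCompactSupport (by fun_prop) ?_
    exact (hfc.fderiv (𝕜 := ℝ)).mono' (fun x hx => subset_closure fun h => hx (by simp [h]))
  have hi2 : Integrable fun x => fderiv ℝ f x :=
    hfd.integrable_of_hasCompactSupport (hfc.fderiv (𝕜 := ℝ))
  have key : ∫ x in E, f x * divergence φ x =
      (∫ x in E ∩ Ω, divergence (fun y => f y • φ y) x) - ∫ x in E, fderiv ℝ f x (φ x) := by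
    rw [inter_eq_left.2 hEΩ, ← integral_sub ht.integrable_divergence.integrableOn hi1.integrableOn]
    congr 1 with x
    rw [divergence_smul (hf.differentiable one_ne_zero x) (hφ.differentiable one_ne_zero x)]
    ring
  rw [key, sub_eq_add_neg]
  refine ENNReal.ofReal_add_le.trans (add_le_add (ofReal_integral_divergence_le_perimeter ht) ?_)
  have h3 : -∫ x in E, fderiv ℝ f x (φ x) ≤ ∫ x in E, ‖fderiv ℝ f x‖ := by
    rw [← integral_neg]
    refine integral_mono hi1.integrableOn.neg hi2.norm.integrableOn fun x => ?_
    refine (neg_le_abs _).trans ?_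
    rw [← Real.norm_eq_abs]
    refine ((fderiv ℝ f x).le_opNorm _).trans ?_
    exact mul_le_of_le_one_right (norm_nonneg _) (hφ1 x)
  refine (ENNReal.ofReal_le_ofReal h3).trans ?_
  rw [ofReal_integral_norm_eq_lintegral_enorm hi2.integrableOn]

/-- A `C¹` step function with slope at most `1 + c`. -/
lemma exists_step {c : ℝ} (hc : 0 < c) :
    ∃ f : ℝ → ℝ, ContDiff ℝ 1 f ∧ (∀ t, 0 ≤ f t ∧ f t ≤ 1) ∧ (∃ b > 0, ∀ t ≤ b, f t = 0) ∧
      (∀ t, 1 ≤ t → f t = 1) ∧ (∀ t, 0 ≤ deriv f t ∧ deriv f t ≤ 1 + c) ∧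
      ∀ t, t ∉ Ioo (0 : ℝ) 1 → deriv f t = 0 := by
  -- The derivative of the step is a trapezoid supported in `[b, 1 - b]`, equal to `1` on `[2b, 1 -
  -- 2b]`, divided by its integral `I ≥ 1 - 4b`. The choice of `b` makes `(1 + c)(1 - 4b) = 1`, so
  -- that `1 / I ≤ 1 + c`.
  obtain ⟨b, hb0, hb4, hbc⟩ : ∃ b > 0, b < 1 / 4 ∧ 1 ≤ (1 + c) * (1 - 4 * b) := by
    refine ⟨c / (4 * (1 + c)), by positivity, ?_, ?_⟩
    · rw [div_lt_iff₀ (by positivity)]; linarith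
    · apply le_of_eq
      field_simp
      ring
  set p : ℝ → ℝ := fun t => max 0 (min 1 (min ((t - b) / b) ((1 - b - t) / b))) with hp
  have hpc : Continuous p := by fun_prop
  have hp0 : ∀ t, 0 ≤ p t := fun t => le_max_left _ _
  have hp1 : ∀ t, p t ≤ 1 := fun t => max_le zero_le_one (min_le_left _ _)
  have hpl : ∀ t ≤ b, p t = 0 := fun t ht => by
    refine max_eq_left ((min_le_right _ _).trans ((min_le_left _ _).trans ?_))
    exact div_nonpos_of_nonpos_of_nonneg (by linarith) hb0.le
  have hpr : ∀ t, 1 - b ≤ t → p t = 0 := fun t ht => by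
    refine max_eq_left ((min_le_right _ _).trans ((min_le_right _ _).trans ?_))
    exact div_nonpos_of_nonpos_of_nonneg (by linarith) hb0.le
  have hpm : ∀ t ∈ Icc (2 * b) (1 - 2 * b), p t = 1 := fun t ht => by
    have h1 : 1 ≤ (t - b) / b := by rw [le_div_iff₀ hb0]; linarith [ht.1]
    have h2 : 1 ≤ (1 - b - t) / b := by rw [le_div_iff₀ hb0]; linarith [ht.2]
    simp [hp, h1, h2]
  have hint : ∀ u v, IntervalIntegrable p volume u v := fun u v => hpc.intervalIntegrable u v
  set I := ∫ t in (0 : ℝ)..1, p t with hI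
  have hIlow : 1 - 4 * b ≤ I := by
    have h1 : ∫ t in (2 * b)..(1 - 2 * b), p t = 1 - 4 * b := by
      rw [intervalIntegral.integral_congr (g := fun _ => (1 : ℝ))]
      · simp; ring
      · intro t ht
        rw [uIcc_of_le (by linarith)] at ht
        exact hpm t ht
    rw [← h1]
    exact intervalIntegral.integral_mono_interval (by linarith) (by linarith) (by linarith)
      (Eventually.of_forall hp0) (hint _ _)
  have hIpos : 0 < I := by linarith
  set F : ℝ → ℝ := fun t => (∫ s in (0 : ℝ)..t, p s) / I with hF
  have hderiv : ∀ t, HasDerivAt F (p t / I) t := fun t =>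
    (intervalIntegral.integral_hasDerivAt_right (hint _ _)
      hpc.stronglyMeasurable.stronglyMeasurableAtFilter hpc.continuousAt).div_const I
  have hFd : ∀ t, deriv F t = p t / I := fun t => (hderiv t).deriv
  have hzero : ∀ t ≤ b, F t = 0 := fun t ht => by
    have : ∫ s in (0 : ℝ)..t, p s = ∫ s in (0 : ℝ)..t, (0 : ℝ) := by
      refine intervalIntegral.integral_congr fun s hs => hpl s ?_
      exact (hs.2).trans (max_le hb0.le ht)
    simp [hF, this]
  have hone : ∀ t, 1 ≤ t → F t = 1 := fun t ht => by
    have h2 : ∫ s in (1 : ℝ)..t, p s = ∫ s in (1 : ℝ)..t, (0 : ℝ) := by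
      refine intervalIntegral.integral_congr fun s hs => hpr s ?_
      rw [uIcc_of_le ht] at hs
      linarith [hs.1]
    rw [hF]
    simp only
    rw [← intervalIntegral.integral_add_adjacent_intervals (hint 0 1) (hint 1 t), h2]
    simp [← hI, hIpos.ne']
  have hmono : Monotone F := monotone_of_deriv_nonneg (fun t => (hderiv t).differentiableAt)
    (fun t => by rw [hFd]; exact div_nonneg (hp0 t) hIpos.le)
  refine ⟨F, ?_, fun t => ⟨?_, ?_⟩, ⟨b, hb0, hzero⟩, hone, fun t => ⟨?_, ?_⟩, fun t ht => ?_⟩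
  · rw [contDiff_one_iff_deriv]
    refine ⟨fun t => (hderiv t).differentiableAt, ?_⟩
    rw [show deriv F = fun t => p t / I from funext hFd]
    fun_prop
  · rw [← hzero (min t b) (min_le_right _ _)]
    exact hmono (min_le_left _ _)
  · rw [← hone (max t 1) (le_max_right _ _)]
    exact hmono (le_max_left _ _)
  · rw [hFd]; exact div_nonneg (hp0 t) hIpos.le
  · rw [hFd, div_le_iff₀ hIpos]
    nlinarith [hp1 t]
  · rw [hFd]
    have : p t = 0 := by
      rcases le_or_gt t 0 with h | h
      · exact hpl t (by linarith)
      · exact hpr t (by by_contra h'; exact ht ⟨h, by linarith⟩)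
    simp [this]

end

/-! ### Cutting a set along a superlevel set -/

section

variable {N : ℕ}

/-- The indicator of `{η > t}` is the limit of the cut-offs `f((k+1)(η - t))`, whose gradients are
at most `(1 + c)(k + 1)|∇η|` and live where `t < η < t + 1/(k+1)`. The strip is written as a
condition on `t` for fixed `x`, ready for an integration in `t`. -/
lemma perimeter_superlevel_le {E Ω : Set (Space N)} (hEΩ : E ⊆ Ω) {η : Space N → ℝ}
    (hη : ContDiff ℝ 1 η) (hηc : HasCompactSupport η) (hηΩ : tsupport η ⊆ Ω)
    {c t : ℝ} (hc : 0 < c) (ht : 0 < t) :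
    perimeter (E ∩ {x | t < η x}) Ω ≤ perimeter E Ω + ENNReal.ofReal (1 + c) *
      liminf (fun k : ℕ => ∫⁻ x in E, ENNReal.ofReal (k + 1) * ‖fderiv ℝ η x‖ₑ *
        (Ioo (η x - 1 / ((k : ℝ) + 1)) (η x)).indicator 1 t) atTop := by
  obtain ⟨f, hf, hf01, ⟨b, hb, hfb⟩, hf1, hfd, hfd0⟩ := exists_step hc
  set F : ℕ → Space N → ℝ := fun k x => f ((k + 1) * (η x - t)) with hF
  have hk : ∀ k : ℕ, (0 : ℝ) < k + 1 := fun k => by positivity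
  have hFs : ∀ k, ContDiff ℝ 1 (F k) := fun k =>
    hf.comp (contDiff_const.mul (hη.sub contDiff_const))
  -- Positivity of `t` is what matters here: where `η` vanishes the argument of `f` is negative, so
  -- the cut-off inherits the compact support of `η`.
  have hsub : ∀ k, Function.support (F k) ⊆ Function.support η := fun k x hx h0 => by
    apply hx
    refine hfb _ (le_trans ?_ hb.le)
    rw [h0]
    nlinarith [hk k]
  have hFc : ∀ k, HasCompactSupport (F k) := fun k =>
    hηc.mono (hsub k)
  have hFΩ : ∀ k, tsupport (F k) ⊆ Ω := fun k => (closure_mono (hsub k)).trans hηΩ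
  have hFder : ∀ k x, fderiv ℝ (F k) x =
      (deriv f ((k + 1) * (η x - t)) * (k + 1)) • fderiv ℝ η x := fun k x => by
    have h1 : HasFDerivAt (fun x => ((k : ℝ) + 1) * (η x - t)) (((k : ℝ) + 1) • fderiv ℝ η x) x :=
      (((hη.differentiable one_ne_zero x).hasFDerivAt).sub_const t).const_mul _
    have h2 := (hf.differentiable one_ne_zero ((k + 1) * (η x - t))).hasDerivAt
    rw [← smul_smul]
    exact (h2.comp_hasFDerivAt x h1).fderiv
  have hbound : ∀ k, ∫⁻ x in E, ‖fderiv ℝ (F k) x‖ₑ ≤ ENNReal.ofReal (1 + c) *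
      ∫⁻ x in E, ENNReal.ofReal (k + 1) * ‖fderiv ℝ η x‖ₑ *
        (Ioo (η x - 1 / ((k : ℝ) + 1)) (η x)).indicator 1 t := fun k => by
    rw [← lintegral_const_mul' _ _ ENNReal.ofReal_ne_top]
    refine lintegral_mono fun x => ?_
    simp only [hFder, enorm_smul]
    by_cases hx : t ∈ Ioo (η x - 1 / ((k : ℝ) + 1)) (η x)
    · rw [indicator_of_mem hx, Pi.one_apply, mul_one, ← mul_assoc,
        ← ENNReal.ofReal_mul (by linarith)]
      gcongr
      rw [Real.enorm_of_nonneg (mul_nonneg (hfd _).1 (hk k).le)]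
      exact ENNReal.ofReal_le_ofReal (mul_le_mul_of_nonneg_right (hfd _).2 (hk k).le)
    · rw [hfd0]
      · simp
      · contrapose! hx
        have h1 := hx.1
        have h2 := hx.2
        refine ⟨?_, ?_⟩
        · rw [sub_lt_comm, lt_div_iff₀ (hk k)]
          linarith
        · have := pos_of_mul_pos_right h1 (hk k).le
          linarith
  refine iSup₂_le fun φ hφ => ?_
  have hcut : ∀ k, ENNReal.ofReal (∫ x in E, F k x * divergence φ x) ≤ perimeter E Ω +
      ENNReal.ofReal (1 + c) * ∫⁻ x in E, ENNReal.ofReal (k + 1) * ‖fderiv ℝ η x‖ₑ *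
        (Ioo (η x - 1 / ((k : ℝ) + 1)) (η x)).indicator 1 t := fun k =>
    (ofReal_integral_cutoff_le hEΩ (hFs k) (hFc k) (hFΩ k) (fun x => hf01 _) hφ.1 hφ.2.2.2).trans
      (by gcongr; exact hbound k)
  have hmeas : MeasurableSet {x | t < η x} :=
    (isOpen_lt continuous_const hη.continuous).measurableSet
  have hlim : Tendsto (fun k => ∫ x in E, F k x * divergence φ x) atTop
      (𝓝 (∫ x in E ∩ {x | t < η x} ∩ Ω, divergence φ x)) := by
    have h1 : E ∩ {x | t < η x} ∩ Ω = {x | t < η x} ∩ E := by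
      ext x; constructor
      · rintro ⟨⟨a, b⟩, _⟩; exact ⟨b, a⟩
      · rintro ⟨a, b⟩; exact ⟨⟨b, a⟩, hEΩ b⟩
    rw [h1, ← Measure.restrict_restrict hmeas, ← integral_indicator hmeas]
    refine tendsto_integral_of_dominated_convergence (fun x => ‖divergence φ x‖) (fun k => ?_)
      hφ.integrable_divergence.norm.integrableOn (fun k => ?_) ?_
    · exact ((hFs k).continuous.mul (continuous_divergence hφ.1)).aestronglyMeasurable
    · refine Eventually.of_forall fun x => ?_
      rw [norm_mul, Real.norm_of_nonneg (hf01 _).1]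
      exact mul_le_of_le_one_left (norm_nonneg _) (hf01 _).2
    · refine Eventually.of_forall fun x => ?_
      by_cases hx : t < η x
      · rw [indicator_of_mem (by exact hx)]
        refine tendsto_const_nhds.congr' ?_
        have h3 : 0 < η x - t := by linarith
        obtain ⟨n, hn⟩ := exists_nat_gt (1 / (η x - t))
        filter_upwards [eventually_ge_atTop n] with k hkn
        rw [hF]
        simp only
        rw [hf1, one_mul]
        rw [div_lt_iff₀ h3] at hn
        have : (n : ℝ) ≤ k := by exact_mod_cast hkn
        nlinarith
      · rw [indicator_of_notMem (by exact hx)]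
        refine tendsto_const_nhds.congr' (Eventually.of_forall fun k => ?_)
        rw [hF]
        simp only
        rw [hfb, zero_mul]
        push Not at hx
        nlinarith [hk k]
  have hlim2 := (ENNReal.continuous_ofReal.tendsto _).comp hlim
  rw [← hlim2.liminf_eq]
  calc liminf (ENNReal.ofReal ∘ fun k => ∫ x in E, F k x * divergence φ x) atTop
      ≤ liminf (fun k : ℕ => perimeter E Ω +
      ENNReal.ofReal (1 + c) * ∫⁻ x in E, ENNReal.ofReal (k + 1) * ‖fderiv ℝ η x‖ₑ *
        (Ioo (η x - 1 / ((k : ℝ) + 1)) (η x)).indicator 1 t) atTop :=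
        liminf_le_liminf (Eventually.of_forall hcut)
    _ = _ := by
      have hmon : Monotone fun y : ℝ≥0∞ => perimeter E Ω + ENNReal.ofReal (1 + c) * y :=
        fun _ _ h => by dsimp only; gcongr
      have hcont : Continuous fun y : ℝ≥0∞ => perimeter E Ω + ENNReal.ofReal (1 + c) * y :=
        continuous_const.add (ENNReal.continuous_const_mul ENNReal.ofReal_ne_top)
      rw [hmon.map_liminf_of_continuousAt _ hcont.continuousAt]
      rfl

/-- Some superlevel set of a cut-off `η` at a height in `(0, b)` cuts `E` at a cost of about
`b⁻¹ ∫_E |∇η|`. -/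
lemma exists_superlevel_perimeter_le {E Ω : Set (Space N)} (hEΩ : E ⊆ Ω) {η : Space N → ℝ}
    (hη : ContDiff ℝ 1 η) (hηc : HasCompactSupport η) (hηΩ : tsupport η ⊆ Ω)
    {c b : ℝ} (hc : 0 < c) (hb : 0 < b) :
    ∃ t ∈ Ioo 0 b, perimeter (E ∩ {x | t < η x}) Ω ≤ perimeter E Ω + ENNReal.ofReal (1 + c) *
      ((∫⁻ x in E, ‖fderiv ℝ η x‖ₑ) / ENNReal.ofReal b) := by
  set q : ℕ → ℝ → ℝ≥0∞ := fun k t => ∫⁻ x in E, ENNReal.ofReal (k + 1) * ‖fderiv ℝ η x‖ₑ *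
        (Ioo (η x - 1 / ((k : ℝ) + 1)) (η x)).indicator 1 t with hq
  have hfd := hη.continuous_fderiv one_ne_zero
  have hηm := hη.continuous.measurable
  have hmeas : ∀ k : ℕ, Measurable (Function.uncurry fun (t : ℝ) (x : Space N) =>
      ENNReal.ofReal (k + 1) * ‖fderiv ℝ η x‖ₑ *
        (Ioo (η x - 1 / ((k : ℝ) + 1)) (η x)).indicator (1 : ℝ → ℝ≥0∞) t) := fun k => by
    have h1 : MeasurableSet {p : ℝ × Space N |
        p.1 ∈ Ioo (η p.2 - 1 / ((k : ℝ) + 1)) (η p.2)} := by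
      have h3 : Measurable fun p : ℝ × Space N => η p.2 := hηm.comp measurable_snd
      exact (measurableSet_lt (h3.sub_const _) measurable_fst).inter
        (measurableSet_lt measurable_fst h3)
    have h2 : Measurable fun p : ℝ × Space N => ENNReal.ofReal (k + 1) * ‖fderiv ℝ η p.2‖ₑ :=
      ((hfd.comp continuous_snd).enorm.measurable).const_mul _
    exact h2.mul ((measurable_const (a := (1 : ℝ≥0∞))).indicator h1)
  have hqm : ∀ k, Measurable (q k) := fun k => (hmeas k).lintegral_prod_right'
  -- Integrating in `t` first, the interval has length `1/(k+1)`, which cancels the factor `k + 1`.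
  have hqint : ∀ k, ∫⁻ t, q k t = ∫⁻ x in E, ‖fderiv ℝ η x‖ₑ := fun k => by
    rw [hq]
    simp only
    rw [lintegral_lintegral_swap (hmeas k).aemeasurable]
    refine lintegral_congr fun x => ?_
    rw [lintegral_const_mul' _ _ (by finiteness), lintegral_indicator_one measurableSet_Ioo,
      Real.volume_Ioo, mul_right_comm, ← ENNReal.ofReal_mul (by positivity)]
    have : ((k : ℝ) + 1) * (η x - (η x - 1 / ((k : ℝ) + 1))) = 1 := by
      field_simp
      ring
    rw [this]
    simp
  have hfatou : ∫⁻ t in Ioo 0 b, liminf (fun k => q k t) atTop ≤ ∫⁻ x in E, ‖fderiv ℝ η x‖ₑ := by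
    refine (lintegral_liminf_le hqm).trans ?_
    refine (liminf_le_liminf (v := fun _ => ∫⁻ x in E, ‖fderiv ℝ η x‖ₑ)
      (Eventually.of_forall fun k => ?_)).trans (by simp)
    rw [← hqint k]
    exact setLIntegral_le_lintegral _ _
  -- By Fatou the liminf has integral at most `∫_E |∇η|` over `(0, b)`, so at some height it does
  -- not exceed the average.
  obtain ⟨t, ht, htl⟩ := exists_le_setLAverage (μ := volume) (s := Ioo 0 b)
    (f := fun t => liminf (fun k => q k t) atTop) (by simp [hb]) (by simp)
    (Measurable.liminf hqm).aemeasurable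
  refine ⟨t, ht, (perimeter_superlevel_le hEΩ hη hηc hηΩ hc ht.1).trans ?_⟩
  gcongr
  refine htl.trans ?_
  rw [setLAverage_eq, Real.volume_Ioo, sub_zero]
  gcongr

end

/-! ### Sets of zero Hausdorff measure have zero capacity -/

section

/-- A compact set of zero `d`-dimensional Hausdorff measure, `d ≥ 1`, is covered by finitely many
balls with small sum of the `d`-th powers of the radii. -/
lemma exists_finite_ball_cover {X : Type*} [MetricSpace X] [MeasurableSpace X] [BorelSpace X]
    [Nonempty X] {d : ℕ} (hd : d ≠ 0) {S : Set X} (hS : IsCompact S) (h0 : μH[d] S = 0)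
    {ε : ℝ} (hε : 0 < ε) :
    ∃ (T : Finset ℕ) (c : ℕ → X) (r : ℕ → ℝ), (∀ n, 0 < r n ∧ r n ≤ 2) ∧
      S ⊆ ⋃ n ∈ T, Metric.ball (c n) (r n) ∧ ∑ n ∈ T, r n ^ d ≤ ε := by
  rw [Measure.hausdorffMeasure_apply] at h0
  have h1 := (ENNReal.iSup_eq_zero.1 ((ENNReal.iSup_eq_zero.1 h0) 1)) one_pos
  have hε2 : (0 : ℝ≥0∞) < ENNReal.ofReal (ε / 2) := ENNReal.ofReal_pos.2 (by positivity)
  rw [← h1] at hε2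
  simp only [iInf_lt_iff] at hε2
  obtain ⟨t, hSt, htd, hsum⟩ := hε2
  -- The summable errors `e n` pay for enlarging a covering set of diameter `D` to an open ball of
  -- radius slightly above `D`. The covering itself uses half of `ε`, the errors the other half.
  obtain ⟨e, he0, hes⟩ := ENNReal.exists_pos_sum_of_countable
    (ENNReal.ofReal_pos.2 (half_pos hε)).ne' ℕ
  have key : ∀ n, ∃ (c : X) (r : ℝ), 0 < r ∧ r ≤ 2 ∧ t n ⊆ Metric.ball c r ∧
      ENNReal.ofReal (r ^ d) ≤ (⨆ _ : (t n).Nonempty, Metric.ediam (t n) ^ (d : ℝ)) + e n := by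
    intro n
    set D : ℝ := (Metric.ediam (t n)).toReal with hD
    have hfin : Metric.ediam (t n) ≠ ⊤ := ((htd n).trans_lt ENNReal.one_lt_top).ne
    have hD1 : D ≤ 1 := by
      rw [hD]; exact ENNReal.toReal_le_of_le_ofReal zero_le_one (by simpa using htd n)
    have hD0 : 0 ≤ D := ENNReal.toReal_nonneg
    have hev : ∀ᶠ r in 𝓝[>] D, r ^ d < D ^ d + e n := by
      have : Tendsto (fun r : ℝ => r ^ d) (𝓝[>] D) (𝓝 (D ^ d)) :=
        ((continuous_pow d).tendsto D).mono_left nhdsWithin_le_nhds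
      exact this.eventually_lt_const (by have := he0 n; simpa using this)
    obtain ⟨r, hr1, hr2, hr3⟩ := (hev.and (Ioo_mem_nhdsGT (show D < 2 by linarith))).exists
    rcases (t n).eq_empty_or_nonempty with hemp | ⟨c, hc⟩
    · refine ⟨Classical.arbitrary X, r, by linarith, hr3.le, by simp [hemp], ?_⟩
      -- An empty covering set contributes `0` to the Hausdorff sum, so its ball must be paid for by
      -- `e n` alone. This needs `0 ^ d = 0`, hence `d ≠ 0`.
      have hDz : D = 0 := by simp [hD, hemp]
      rw [hDz, zero_pow hd, zero_add] at hr1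
      refine le_trans ?_ le_add_self
      rw [← ENNReal.ofReal_coe_nnreal]
      exact ENNReal.ofReal_le_ofReal hr1.le
    · refine ⟨c, r, by linarith, hr3.le, fun y hy => ?_, ?_⟩
      · rw [Metric.mem_ball, dist_edist]
        refine lt_of_le_of_lt ?_ hr2
        exact ENNReal.toReal_mono hfin (Metric.edist_le_ediam_of_mem hy hc)
      · rw [ciSup_pos ⟨c, hc⟩, ← ENNReal.ofReal_toReal hfin, ENNReal.rpow_natCast,
          ← ENNReal.ofReal_pow hD0, ← ENNReal.ofReal_coe_nnreal,
          ← ENNReal.ofReal_add (by positivity) (by positivity)]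
        exact ENNReal.ofReal_le_ofReal hr1.le
  choose c r hr0 hr2 htr hrs using key
  obtain ⟨T, hT⟩ := hS.elim_finite_subcover (fun n => Metric.ball (c n) (r n))
    (fun n => Metric.isOpen_ball) (hSt.trans (iUnion_mono htr))
  refine ⟨T, c, r, fun n => ⟨hr0 n, hr2 n⟩, hT, ?_⟩
  have h2 : ENNReal.ofReal (∑ n ∈ T, r n ^ d) ≤ ENNReal.ofReal ε := by
    rw [ENNReal.ofReal_sum_of_nonneg (fun n _ => by have := hr0 n; positivity)]
    calc ∑ n ∈ T, ENNReal.ofReal (r n ^ d)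
        ≤ ∑ n ∈ T, ((⨆ _ : (t n).Nonempty, Metric.ediam (t n) ^ (d : ℝ)) + e n) :=
          Finset.sum_le_sum fun n _ => hrs n
      _ ≤ ∑' n, ((⨆ _ : (t n).Nonempty, Metric.ediam (t n) ^ (d : ℝ)) + e n) :=
          ENNReal.sum_le_tsum _
      _ ≤ ENNReal.ofReal (ε / 2) + ENNReal.ofReal (ε / 2) := by
          rw [ENNReal.tsum_add]
          exact add_le_add hsum.le hes.le
      _ = ENNReal.ofReal ε := by
          rw [← ENNReal.ofReal_add (by positivity) (by positivity)]; ring_nf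
  exact (ENNReal.ofReal_le_ofReal_iff hε.le).1 h2

/-- All bumps are rescalings of a single one, so that `C` depends on neither the centre nor the
radius. -/
lemma exists_scaled_bump (N : ℕ) : ∃ C : ℝ, 0 ≤ C ∧ ∀ (c : Space N) (r : ℝ), 0 < r →
    ∃ β : Space N → ℝ, ContDiff ℝ 1 β ∧ (∀ x, 0 ≤ β x) ∧ (∀ x ∈ Metric.ball c r, 1 ≤ β x) ∧
      (∀ x, x ∉ Metric.closedBall c (2 * r) → β x = 0) ∧
      ∀ x, ‖fderiv ℝ β x‖ ≤ (Metric.closedBall c (2 * r)).indicator (fun _ => C / r) x := by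
  let b : ContDiffBump (0 : Space N) := ⟨1, 2, one_pos, one_lt_two⟩
  have hb : ContDiff ℝ 1 b := b.contDiff
  have hbd := hb.continuous_fderiv one_ne_zero
  obtain ⟨C, hC⟩ := (b.hasCompactSupport.fderiv (𝕜 := ℝ)).exists_bound_of_continuous hbd
  refine ⟨C, (norm_nonneg _).trans (hC 0), fun c r hr => ?_⟩
  have hg : ∀ x, HasFDerivAt (fun x => b (r⁻¹ • (x - c))) (r⁻¹ • fderiv ℝ b (r⁻¹ • (x - c))) x := by
    intro x
    have h1 : HasFDerivAt (fun x : Space N => r⁻¹ • (x - c))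
        (r⁻¹ • ContinuousLinearMap.id ℝ (Space N)) x :=
      ((hasFDerivAt_id x).sub_const c).const_smul r⁻¹
    have h2 := ((hb.differentiable one_ne_zero (r⁻¹ • (x - c))).hasFDerivAt).comp x h1
    have h4 : (fderiv ℝ b (r⁻¹ • (x - c))).comp (r⁻¹ • ContinuousLinearMap.id ℝ (Space N)) =
        r⁻¹ • fderiv ℝ b (r⁻¹ • (x - c)) := by
      ext v
      simp
    rw [h4] at h2
    exact h2
  have hzero : ∀ x, x ∉ Metric.closedBall c (2 * r) →
      b (r⁻¹ • (x - c)) = 0 ∧ fderiv ℝ b (r⁻¹ • (x - c)) = 0 := by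
    intro x hx
    have h3 : r⁻¹ • (x - c) ∉ tsupport b := by
      rw [b.tsupport_eq, mem_closedBall_zero_iff, norm_smul, norm_inv,
        Real.norm_of_nonneg hr.le, ← div_eq_inv_mul, div_le_iff₀ hr, ← dist_eq_norm]
      simpa using hx
    exact ⟨image_eq_zero_of_notMem_tsupport h3,
      by_contra fun h => h3 (support_fderiv_subset ℝ h)⟩
  refine ⟨fun x => b (r⁻¹ • (x - c)), by fun_prop, fun x => b.nonneg, fun x hx => ?_,
    fun x hx => (hzero x hx).1, fun x => ?_⟩
  · refine (b.one_of_mem_closedBall ?_).ge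
    rw [mem_closedBall_zero_iff, norm_smul, norm_inv,
        Real.norm_of_nonneg hr.le, ← div_eq_inv_mul, div_le_iff₀ hr, ← dist_eq_norm]
    simpa [b] using (Metric.mem_ball.1 hx).le
  · rw [(hg x).fderiv]
    by_cases hx : x ∈ Metric.closedBall c (2 * r)
    · rw [indicator_of_mem hx, norm_smul, norm_inv, Real.norm_of_nonneg hr.le, div_eq_inv_mul]
      exact mul_le_mul_of_nonneg_left (hC _) (by positivity)
    · rw [indicator_of_notMem hx, (hzero x hx).2]
      simp

/-- A compact set of zero surface measure has small `C¹` capacity: it can be cut off at a small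
cost of total variation. -/
lemma exists_cutoff_of_null {m : ℕ} (hm : m ≠ 0) {S : Set (Space (m + 1))} (hS : IsCompact S)
    (h0 : μH[m] S = 0) {κ : ℝ} (hκ : 0 < κ) :
    ∃ w : Space (m + 1) → ℝ, ContDiff ℝ 1 w ∧ (∀ x, 0 ≤ w x ∧ w x ≤ 1) ∧
      (∃ O, IsOpen O ∧ S ⊆ O ∧ ∀ x ∈ O, w x = 0) ∧
      ∫⁻ x, ‖fderiv ℝ w x‖ₑ ≤ ENNReal.ofReal κ ∧
      ∫⁻ x, ENNReal.ofReal (1 - w x) ≤ ENNReal.ofReal κ := by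
  obtain ⟨C, hC0, hbump⟩ := exists_scaled_bump (m + 1)
  obtain ⟨f, hf, hf01, ⟨b, hb, hfb⟩, hf1, hfd, -⟩ := exists_step one_pos
  set V : ℝ≥0∞ := volume (Metric.ball (0 : Space (m + 1)) 1) with hV
  have hVfin : V ≠ ⊤ := measure_ball_lt_top.ne
  -- One constant serves two integrands on the balls of radius `2r`: the gradient bound `2C/r`,
  -- where `2` is the maximal slope of `f`, and the constant `1`, for which `r ≤ 2` turns `r ^ (m +
  -- 1)` into `2 r ^ m`.
  set K : ℝ := (2 * C + 2) * 2 ^ (m + 1) with hK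
  have hKpos : 0 < K := by positivity
  have hKV : 0 < K * V.toReal + 1 := by positivity
  obtain ⟨T, c, r, hr, hST, hsum⟩ := exists_finite_ball_cover hm hS h0 (div_pos hκ hKV)
  choose β hβ hβ0 hβ1 hβz hβd using fun n => hbump (c n) (r n) (hr n).1
  set s : Space (m + 1) → ℝ := fun x => ∑ n ∈ T, β n x with hs
  have hsC : ContDiff ℝ 1 s := ContDiff.sum fun n _ => hβ n
  have hnn : ∀ x, ∀ n ∈ T, 0 ≤ β n x := fun x n _ => hβ0 n x
  have hbound : ∀ (a : ℕ → ℝ) , (∀ n, 0 ≤ a n) → (∀ n, a n * (2 * r n) ^ (m + 1) ≤ K * r n ^ m) →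
      ∫⁻ x, ∑ n ∈ T, (Metric.closedBall (c n) (2 * r n)).indicator (fun _ => ENNReal.ofReal (a n)) x
        ≤ ENNReal.ofReal κ := by
    intro a ha haK
    rw [lintegral_finsetSum' _
      (fun n _ => (measurable_const.indicator measurableSet_closedBall).aemeasurable)]
    calc ∑ n ∈ T, ∫⁻ x, (Metric.closedBall (c n) (2 * r n)).indicator
          (fun _ => ENNReal.ofReal (a n)) x
        = ∑ n ∈ T, ENNReal.ofReal (a n * (2 * r n) ^ (m + 1)) * V := by
          refine Finset.sum_congr rfl fun n _ => ?_
          have := (hr n).1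
          rw [lintegral_indicator_const measurableSet_closedBall,
            Measure.addHaar_closedBall _ _ (by positivity), ← mul_assoc,
            ← ENNReal.ofReal_mul (ha n)]
          simp [hV]
      _ ≤ ∑ n ∈ T, ENNReal.ofReal (K * r n ^ m) * V := by
          refine Finset.sum_le_sum fun n _ => ?_
          gcongr ENNReal.ofReal ?_ * V
          exact haK n
      _ = ENNReal.ofReal (K * V.toReal * ∑ n ∈ T, r n ^ m) := by
          rw [← Finset.sum_mul, ← ENNReal.ofReal_sum_of_nonneg
            (fun n _ => by have := (hr n).1; positivity), ← Finset.mul_sum]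
          conv_lhs => rw [← ENNReal.ofReal_toReal hVfin]
          rw [← ENNReal.ofReal_mul (mul_nonneg hKpos.le (Finset.sum_nonneg
            (fun n _ => by have := (hr n).1; positivity)))]
          congr 1; ring
      _ ≤ ENNReal.ofReal κ := by
          apply ENNReal.ofReal_le_ofReal
          rw [le_div_iff₀ hKV] at hsum
          have : 0 ≤ ∑ n ∈ T, r n ^ m :=
            Finset.sum_nonneg (fun n _ => by have := (hr n).1; positivity)
          linarith
  -- The sum `s` of the bumps is at least `1` on the covering balls, where the cut-off therefore
  -- vanishes. It is `0` away from the doubled balls, where the cut-off is `1`.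
  refine ⟨fun x => 1 - f (s x), contDiff_const.sub (hf.comp hsC), fun x => ?_, ?_, ?_, ?_⟩
  · have := hf01 (s x)
    constructor <;> linarith
  · refine ⟨_, isOpen_biUnion fun n (_ : n ∈ T) => Metric.isOpen_ball, hST, fun x hx => ?_⟩
    simp only [mem_iUnion] at hx
    obtain ⟨n, hn, hx⟩ := hx
    have h9 : 1 ≤ s x := (hβ1 n x hx).trans (Finset.single_le_sum (hnn x) hn)
    simp [hf1 _ h9]
  · refine le_trans (lintegral_mono fun x => ?_) (hbound (fun n => 2 * C / r n)
      (fun n => div_nonneg (by positivity) (hr n).1.le) fun n => ?_)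
    · have hder : HasFDerivAt (fun x => 1 - f (s x))
          (-(deriv f (s x) • ∑ n ∈ T, fderiv ℝ (β n) x)) x := by
        refine HasFDerivAt.const_sub ?_ 1
        refine ((hf.differentiable one_ne_zero (s x)).hasDerivAt).comp_hasFDerivAt x ?_
        exact HasFDerivAt.fun_sum fun n _ => ((hβ n).differentiable one_ne_zero x).hasFDerivAt
      rw [hder.fderiv, enorm_neg, ← ofReal_norm]
      have h5 : ∀ n ∈ T, (Metric.closedBall (c n) (2 * r n)).indicator
          (fun _ => ENNReal.ofReal (2 * C / r n)) x = ENNReal.ofReal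
          (2 * (Metric.closedBall (c n) (2 * r n)).indicator (fun _ => C / r n) x) := fun n _ => by
        by_cases hx : x ∈ Metric.closedBall (c n) (2 * r n) <;> simp [hx, mul_div_assoc]
      rw [Finset.sum_congr rfl h5, ← ENNReal.ofReal_sum_of_nonneg (fun n _ =>
        mul_nonneg zero_le_two (indicator_nonneg (fun _ _ => div_nonneg hC0 (hr n).1.le) _)),
        ← Finset.mul_sum]
      apply ENNReal.ofReal_le_ofReal
      rw [norm_smul, Real.norm_of_nonneg (hfd _).1]
      have h6 : ‖∑ n ∈ T, fderiv ℝ (β n) x‖ ≤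
          ∑ n ∈ T, (Metric.closedBall (c n) (2 * r n)).indicator (fun _ => C / r n) x :=
        (norm_sum_le _ _).trans (Finset.sum_le_sum fun n _ => hβd n x)
      exact mul_le_mul ((hfd _).2.trans (by norm_num)) h6 (norm_nonneg _) zero_le_two
    · have := (hr n).1
      rw [hK]
      have h7 : 2 * C / r n * (2 * r n) ^ (m + 1) = 2 * C * 2 ^ (m + 1) * r n ^ m := by
        rw [mul_pow, pow_succ (r n)]
        field_simp
      rw [h7]
      gcongr
      linarith
  · refine le_trans (lintegral_mono fun x => ?_) (hbound (fun n => 1) (fun n => zero_le_one)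
      fun n => ?_)
    · by_cases hx : ∃ n ∈ T, x ∈ Metric.closedBall (c n) (2 * r n)
      · obtain ⟨n, hn, hx⟩ := hx
        refine le_trans ?_ (Finset.single_le_sum (fun _ _ => zero_le) hn)
        rw [indicator_of_mem hx]
        apply ENNReal.ofReal_le_ofReal
        linarith [(hf01 (s x)).2]
      · push Not at hx
        have : s x = 0 := Finset.sum_eq_zero fun n hn => hβz n x (hx n hn)
        simp [this, hfb 0 hb.le]
    · have h0 := (hr n).1
      have h2 := (hr n).2
      rw [hK, one_mul, mul_pow, pow_succ (r n)]
      have h8 : 0 ≤ (2 : ℝ) ^ (m + 1) * r n ^ m := by positivity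
      nlinarith [mul_nonneg hC0 h8]

end

/-! ### Translation differences are controlled by the perimeter -/

section

variable {N : ℕ}

lemma exists_smooth_cutoff {K O : Set (Space N)} (hK : IsCompact K) (hO : IsOpen O) (hKO : K ⊆ O) :
    ∃ ψ : Space N → ℝ, ContDiff ℝ ∞ ψ ∧ HasCompactSupport ψ ∧ tsupport ψ ⊆ O ∧
      (∀ x, 0 ≤ ψ x ∧ ψ x ≤ 1) ∧ ∀ᶠ x in 𝓝ˢ K, ψ x = 1 := by
  obtain ⟨L, hL, hKL, hLO⟩ := exists_compact_between hK hO hKO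
  obtain ⟨f, hf0, hf1, hf01⟩ := exists_contMDiffMap_zero_one_nhds_of_isClosed
    (n := ⊤) (modelWithCornersSelf ℝ (Space N)) isOpen_interior.isClosed_compl hK.isClosed
    (disjoint_compl_left_iff_subset.2 hKL)
  have hsupp : tsupport f ⊆ L := by
    refine closure_minimal (fun x hx => ?_) hL.isClosed
    by_contra h
    exact hx (hf0.self_of_nhdsSet x fun h' => h (interior_subset h'))
  exact ⟨f, f.contMDiff.contDiff, hL.of_isClosed_subset isClosed_closure hsupp,
    hsupp.trans hLO, fun x => hf01 x, hf1⟩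

lemma tsupport_comp_sub (ψ : Space N → ℝ) (a : Space N) :
    tsupport (fun x => ψ (x - a)) = (fun x => x - a) ⁻¹' tsupport ψ :=
  tsupport_comp_eq_preimage ψ (Homeomorph.subRight a)

/-- Duality form of the estimate of translation differences by the perimeter. -/
lemma ofReal_integral_translate_sub_le {E Ω W : Set (Space N)}
    (hEΩ : E ⊆ Ω) (hE : volume E ≠ ⊤) {v : Space N}
    (hWv : ∀ x ∈ W, ∀ σ ∈ Icc (0 : ℝ) 1, x + σ • v ∈ Ω)
    {ψ : Space N → ℝ} (hψ : ContDiff ℝ 1 ψ) (hψc : HasCompactSupport ψ) (hψW : tsupport ψ ⊆ W)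
    (hψ1 : ∀ x, |ψ x| ≤ 1) :
    ENNReal.ofReal (∫ x in E, (ψ (x - v) - ψ x)) ≤ ENNReal.ofReal ‖v‖ * perimeter E Ω := by
  rcases eq_or_ne v 0 with rfl | hv
  · simp
  have hv0 : 0 < ‖v‖ := norm_pos_iff.2 hv
  rcases eq_or_ne (perimeter E Ω) ⊤ with hp | hp
  · rw [hp, ENNReal.mul_top (by simpa using hv)]
    exact le_top
  have : IsFiniteMeasure (volume.restrict E) := ⟨by simpa using hE.lt_top⟩
  have hd := hψ.continuous_fderiv one_ne_zero
  obtain ⟨C, hC⟩ := (hψc.fderiv (𝕜 := ℝ)).exists_bound_of_continuous hd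
  -- The difference `ψ(x - v) - ψ(x)` is `|v|` times the average over `σ ∈ [0, 1]` of the
  -- divergences of these fields. They are admissible because `hWv` keeps the support of `ψ`,
  -- shifted by `σ v`, inside `Ω`.
  set φ : ℝ → Space N → Space N := fun σ x => ψ (x - σ • v) • (-(‖v‖⁻¹ • v)) with hφ
  have hder : ∀ (σ : ℝ) x, HasFDerivAt (fun x => ψ (x - σ • v)) (fderiv ℝ ψ (x - σ • v)) x :=
      fun σ x => by
    have h1 : HasFDerivAt (fun x : Space N => x - σ • v) (ContinuousLinearMap.id ℝ (Space N)) x :=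
      (hasFDerivAt_id x).sub_const (σ • v)
    simpa using! ((hψ.differentiable one_ne_zero (x - σ • v)).hasFDerivAt).comp x h1
  have htest : ∀ σ ∈ Icc (0 : ℝ) 1, IsTestField Ω (φ σ) := fun σ hσ => by
    refine ⟨?_, ?_, ?_, fun x => ?_⟩
    · exact (hψ.comp (contDiff_id.sub contDiff_const)).smul contDiff_const
    · refine HasCompactSupport.smul_right (f := fun x => ψ (x - σ • v)) ?_
      exact hψc.comp_homeomorph (Homeomorph.subRight (σ • v))
    · refine (closure_mono (Function.support_smul_subset_left (fun x => ψ (x - σ • v)) _)).trans ?_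
      change tsupport _ ⊆ Ω
      rw [tsupport_comp_sub]
      intro x hx
      simpa using hWv _ (hψW hx) σ hσ
    · rw [hφ]
      simp only
      rw [norm_smul, norm_neg, norm_smul, norm_inv, norm_norm, inv_mul_cancel₀ hv0.ne', mul_one]
      exact hψ1 _
  have hdiv : ∀ (σ : ℝ) x, divergence (φ σ) x = -(‖v‖⁻¹ * fderiv ℝ ψ (x - σ • v) v) := fun σ x => by
    rw [hφ]
    simp only
    rw [divergence_smul (hder σ x).differentiableAt (differentiableAt_const _), (hder σ x).fderiv]
    simp [divergence]
  have hftc : ∀ x, ψ (x - v) - ψ x = ∫ σ in (0 : ℝ)..1, ‖v‖ * divergence (φ σ) x := fun x => by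
    have h2 : ∀ σ ∈ uIcc (0 : ℝ) 1, HasDerivAt (fun σ : ℝ => ψ (x - σ • v))
        (‖v‖ * divergence (φ σ) x) σ := fun σ _ => by
      have h1 : HasDerivAt (fun σ : ℝ => x - σ • v) (-v) σ := by
        simpa using ((hasDerivAt_id σ).smul_const v).const_sub x
      have h3 := ((hψ.differentiable one_ne_zero (x - σ • v)).hasFDerivAt).comp_hasDerivAt σ h1
      have h4 : ‖v‖ * divergence (φ σ) x = fderiv ℝ ψ (x - σ • v) (-v) := by
        rw [hdiv, map_neg, mul_neg, ← mul_assoc, mul_inv_cancel₀ hv0.ne', one_mul]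
      rw [h4]
      exact h3
    rw [intervalIntegral.integral_eq_sub_of_hasDerivAt h2]
    · simp
    · apply Continuous.intervalIntegrable
      simp only [hdiv]
      fun_prop
  have hFint : Integrable (Function.uncurry fun (x : Space N) (σ : ℝ) => ‖v‖ * divergence (φ σ) x)
      ((volume.restrict E).prod (volume.restrict (Ioc 0 1))) := by
    refine Integrable.of_bound (C := C * ‖v‖) ?_ (Eventually.of_forall fun p => ?_)
    · apply Continuous.aestronglyMeasurable
      simp only [hdiv, Function.uncurry_def]
      fun_prop
    · simp only [Function.uncurry, hdiv, norm_mul, norm_neg, norm_inv, norm_norm]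
      rw [← mul_assoc, mul_inv_cancel₀ hv0.ne', one_mul]
      exact ((fderiv ℝ ψ _).le_opNorm v).trans (by gcongr; exact hC _)
  have hswap : ∫ x in E, (ψ (x - v) - ψ x) =
      ∫ σ in Ioc (0 : ℝ) 1, ∫ x in E, ‖v‖ * divergence (φ σ) x := by
    simp only [hftc, intervalIntegral.integral_of_le zero_le_one]
    exact integral_integral_swap hFint
  have hle : ∫ σ in Ioc (0 : ℝ) 1, ∫ x in E, ‖v‖ * divergence (φ σ) x ≤
      ∫ σ in Ioc (0 : ℝ) 1, ‖v‖ * (perimeter E Ω).toReal := by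
    refine setIntegral_mono_on hFint.integral_prod_right (integrableOn_const (by simp))
      measurableSet_Ioc
      fun σ hσ => ?_
    rw [integral_const_mul]
    gcongr
    rw [← ENNReal.ofReal_le_iff_le_toReal hp]
    have := ofReal_integral_divergence_le_perimeter (E := E) (htest σ ⟨hσ.1.le, hσ.2⟩)
    rwa [inter_eq_left.2 hEΩ] at this
  rw [hswap]
  refine (ENNReal.ofReal_le_ofReal hle).trans ?_
  simp [ENNReal.ofReal_mul, ENNReal.ofReal_toReal hp]

/-- The set of the points of `W` at which the indicator of `E` differs from its translate by `v`
has measure at most `2 |v| P(E, Ω)`. -/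
lemma volume_translate_diff_le {E Ω W : Set (Space N)} (hEm : MeasurableSet E)
    (hEΩ : E ⊆ Ω) (hΩ : Bornology.IsBounded Ω) (hW : IsOpen W) {v : Space N}
    (hWv : ∀ x ∈ W, ∀ σ ∈ Icc (0 : ℝ) 1, x + σ • v ∈ Ω) :
    volume {x ∈ W | ¬ (x ∈ E ↔ x + v ∈ E)} ≤ 2 * (ENNReal.ofReal ‖v‖ * perimeter E Ω) := by
  have hE : volume E ≠ ⊤ := ((hΩ.subset hEΩ).measure_lt_top).ne
  have hWΩ : W ⊆ Ω := fun x hx => by simpa using hWv x hx 0 (by simp)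
  set E' : Set (Space N) := (fun x => x + v) ⁻¹' E with hE'
  have hE'm : MeasurableSet E' := hEm.preimage (measurable_add_const v)
  have hE'v : volume E' ≠ ⊤ := by rw [hE', measure_preimage_add_right]; exact hE
  -- the two one-sided estimates
  have main : ∀ s : ℝ, (s = 1 ∨ s = -1) → ∀ P : Set (Space N), MeasurableSet P → P ⊆ W →
      (∀ x ∈ P, s * (E'.indicator 1 x - E.indicator 1 x) = 1) →
      volume P ≤ ENNReal.ofReal ‖v‖ * perimeter E Ω := by
    intro s hs P hP hPW hPs
    have hPfin : volume P ≠ ⊤ := ((hΩ.subset (hPW.trans hWΩ)).measure_lt_top).ne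
    refine ENNReal.le_of_forall_pos_le_add fun ε hε _ => ?_
    have hε' : (ε / 2 : NNReal) ≠ 0 := by positivity
    -- On `P` the difference of the indicators is the constant `s`, so it is tested with `s ψ`,
    -- where `ψ = 1` on a compact `K ⊆ P` and `ψ` is supported in an open `O ⊇ K`. The loss is at
    -- most `|O \ K| ≤ ε/2`, and replacing `P` by `K` costs another `ε/2`.
    obtain ⟨K, hKP, hK, hPK⟩ := hP.exists_isCompact_lt_add hPfin
      (ε := ((ε / 2 : NNReal) : ℝ≥0∞)) (by exact_mod_cast hε')
    obtain ⟨O', hKO', hO', hO'K⟩ := hK.exists_isOpen_lt_add (μ := volume)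
      (ε := ((ε / 2 : NNReal) : ℝ≥0∞)) (by exact_mod_cast hε')
    set O := O' ∩ W with hO_def
    have hO : IsOpen O := hO'.inter hW
    have hKO : K ⊆ O := subset_inter hKO' (hKP.trans hPW)
    have hOK : volume O ≤ volume K + ((ε / 2 : NNReal) : ℝ≥0∞) :=
      (measure_mono inter_subset_left).trans hO'K.le
    have hKfin : volume K ≠ ⊤ := hK.measure_lt_top.ne
    have hOfin : volume O ≠ ⊤ := ne_top_of_le_ne_top (by finiteness) hOK
    obtain ⟨ψ, hψ, hψc, hψO, hψ01, hψ1⟩ := exists_smooth_cutoff hK hO hKO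
    have hs1 : |s| = 1 := by rcases hs with rfl | rfl <;> simp
    have hψs : ContDiff ℝ 1 (fun x => s * ψ x) :=
      contDiff_const.mul (hψ.of_le (by exact_mod_cast le_top))
    have hsub : Function.support (fun x => s * ψ x) ⊆ Function.support ψ :=
      Function.support_mul_subset_right (fun _ => s) ψ
    have h1 := ofReal_integral_translate_sub_le hEΩ hE hWv hψs (hψc.mono hsub)
      ((closure_mono hsub).trans (hψO.trans inter_subset_right)) (fun x => by
        rw [abs_mul, hs1, one_mul, abs_of_nonneg (hψ01 x).1]; exact (hψ01 x).2)
    have hψi : Integrable ψ := hψ.continuous.integrable_of_hasCompactSupport hψc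
    have hψv : Integrable (fun x => ψ (x - v)) := hψi.comp_sub_right v
    have hEψ : Integrable (fun x => (E'.indicator (1 : Space N → ℝ) x -
        E.indicator (1 : Space N → ℝ) x) * (s * ψ x)) := by
      have : ∀ A : Set (Space N), MeasurableSet A →
          Integrable fun x => A.indicator (1 : Space N → ℝ) x * (s * ψ x) := fun A hA => by
        have h2 := (hψi.const_mul s).indicator hA
        refine h2.congr (Eventually.of_forall fun x => ?_)
        by_cases hx : x ∈ A <;> simp [hx]
      refine ((this E' hE'm).sub (this E hEm)).congr (Eventually.of_forall fun x => ?_)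
      simp only [Pi.sub_apply, sub_mul]
    have hrw : ∫ x in E, (s * ψ (x - v) - s * ψ x) = ∫ x, (E'.indicator (1 : Space N → ℝ) x -
        E.indicator (1 : Space N → ℝ) x) * (s * ψ x) := by
      have h3 : ∫ x in E, s * ψ (x - v) = ∫ x, E'.indicator (1 : Space N → ℝ) x * (s * ψ x) := by
        rw [← integral_indicator hEm, ← integral_add_right_eq_self _ v]
        congr 1 with x
        by_cases hx : x ∈ E'
        · have : x + v ∈ E := hx
          simp [hx, this]
        · have : x + v ∉ E := hx
          simp [hx, this]
      have h4 : ∫ x in E, s * ψ x = ∫ x, E.indicator (1 : Space N → ℝ) x * (s * ψ x) := by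
        rw [← integral_indicator hEm]
        congr 1 with x
        by_cases hx : x ∈ E <;> simp [hx]
      rw [integral_sub (hψv.const_mul s).integrableOn (hψi.const_mul s).integrableOn, h3, h4,
        ← integral_sub]
      · simp only [sub_mul]
      · have h2 := (hψi.const_mul s).indicator hE'm
        refine h2.congr (Eventually.of_forall fun x => ?_)
        by_cases hx : x ∈ E' <;> simp [hx]
      · have h2 := (hψi.const_mul s).indicator hEm
        refine h2.congr (Eventually.of_forall fun x => ?_)
        by_cases hx : x ∈ E <;> simp [hx]
    have hKm := hK.measurableSet
    have hlow : volume.real K - volume.real (O \ K) ≤ ∫ x in E, (s * ψ (x - v) - s * ψ x) := by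
      rw [hrw]
      have h5 : volume.real K - volume.real (O \ K) =
          ∫ x, (K.indicator (1 : Space N → ℝ) x - (O \ K).indicator (1 : Space N → ℝ) x) := by
        rw [integral_sub, integral_indicator_one hKm,
          integral_indicator_one (hO.measurableSet.diff hKm)]
        · exact (integrable_indicator_iff hKm).2 (integrableOn_const hKfin)
        · exact (integrable_indicator_iff (hO.measurableSet.diff hKm)).2
            (integrableOn_const (measure_ne_top_of_subset sdiff_subset hOfin))
      rw [h5]
      refine integral_mono ?_ hEψ fun x => ?_
      · exact ((integrable_indicator_iff hKm).2 (integrableOn_const hKfin)).sub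
          ((integrable_indicator_iff (hO.measurableSet.diff hKm)).2
            (integrableOn_const (measure_ne_top_of_subset sdiff_subset hOfin)))
      · dsimp only
        by_cases hxK : x ∈ K
        · have h6 := hPs x (hKP hxK)
          have h7 : ψ x = 1 := hψ1.self_of_nhdsSet x hxK
          simp only [hxK, indicator_of_mem, Pi.one_apply, Set.mem_sdiff,
            not_true_eq_false, and_false,
            not_false_eq_true, indicator_of_notMem, sub_zero, h7, mul_one]
          rw [mul_comm]; exact h6.ge
        · by_cases hxO : x ∈ O
          · have h8 : |(E'.indicator (1 : Space N → ℝ) x - E.indicator (1 : Space N → ℝ) x) *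
                (s * ψ x)| ≤ 1 := by
              rw [abs_mul, abs_mul, hs1, one_mul, abs_of_nonneg (hψ01 x).1]
              refine mul_le_one₀ ?_ (hψ01 x).1 (hψ01 x).2
              by_cases a : x ∈ E' <;> by_cases b : x ∈ E <;> simp [a, b]
            simpa [hxK, hxO] using (abs_le.1 h8).1
          · have : ψ x = 0 := image_eq_zero_of_notMem_tsupport fun h => hxO (hψO h)
            simp [hxK, hxO, this]
    have hOKr : volume.real (O \ K) ≤ ε / 2 := by
      rw [measureReal_sdiff hKO hKm hOfin]
      have := ENNReal.toReal_mono (by finiteness) hOK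
      rw [ENNReal.toReal_add hKfin (by finiteness)] at this
      simp only [ENNReal.coe_toReal] at this
      simp only [measureReal_def]
      push_cast at this
      linarith
    calc volume P ≤ volume K + ((ε / 2 : NNReal) : ℝ≥0∞) := hPK.le
      _ = ENNReal.ofReal (volume.real K) + ((ε / 2 : NNReal) : ℝ≥0∞) := by
        rw [ofReal_measureReal hKfin]
      _ ≤ ENNReal.ofReal ((∫ x in E, (s * ψ (x - v) - s * ψ x)) + ε / 2) +
          ((ε / 2 : NNReal) : ℝ≥0∞) := by
        gcongr
        linarith
      _ ≤ ENNReal.ofReal (∫ x in E, (s * ψ (x - v) - s * ψ x)) + ENNReal.ofReal (ε / 2) +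
          ((ε / 2 : NNReal) : ℝ≥0∞) := by
        gcongr
        exact ENNReal.ofReal_add_le
      _ ≤ ENNReal.ofReal ‖v‖ * perimeter E Ω + ε := by
        rw [add_assoc]
        refine add_le_add h1 (le_of_eq ?_)
        rw [← ENNReal.ofReal_coe_nnreal, ← ENNReal.ofReal_coe_nnreal,
          ← ENNReal.ofReal_add (by positivity) (by positivity)]
        congr 1
        push_cast
        ring
  have hsplit : {x ∈ W | ¬ (x ∈ E ↔ x + v ∈ E)} ⊆ (W ∩ (E' \ E)) ∪ (W ∩ (E \ E')) := by
    rintro x ⟨hxW, hx⟩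
    have : x + v ∈ E ↔ x ∈ E' := Iff.rfl
    rw [this] at hx
    rw [not_iff] at hx
    by_cases a : x ∈ E
    · exact Or.inr ⟨hxW, a, fun b => hx.2 b a⟩
    · exact Or.inl ⟨hxW, hx.1 a, a⟩
  refine (measure_mono hsplit).trans ((measure_union_le _ _).trans ?_)
  rw [two_mul]
  refine add_le_add (main 1 (Or.inl rfl) _ (hW.measurableSet.inter (hE'm.diff hEm))
    inter_subset_left ?_) (main (-1) (Or.inr rfl) _ (hW.measurableSet.inter (hEm.diff hE'm))
    inter_subset_left ?_)
  · rintro x ⟨-, h1, h2⟩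
    simp [h1, h2]
  · rintro x ⟨-, h1, h2⟩
    simp [h1, h2]

end

/-! ### Sets of finite variation on the line -/

section

/-- Near two Lebesgue points `a < b`, one in `A` and one not, the difference quotients of the
indicator of `A` see a jump. -/
lemma eventually_half_le_volume_jump {A : Set ℝ} (hA : MeasurableSet A) {a b : ℝ} (hab : a < b)
    (hda : HasDerivAt (fun x => ∫ s in (0 : ℝ)..x, A.indicator (1 : ℝ → ℝ) s) (A.indicator 1 a) a)
    (hdb : HasDerivAt (fun x => ∫ s in (0 : ℝ)..x, A.indicator (1 : ℝ → ℝ) s) (A.indicator 1 b) b)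
    (hdiff : ¬ (a ∈ A ↔ b ∈ A)) :
    ∀ᶠ k : ℕ in atTop, ENNReal.ofReal (1 / 2) ≤ ENNReal.ofReal (k + 1) *
      volume {s ∈ Ioo a b | ¬ (s ∈ A ↔ s + 1 / ((k : ℝ) + 1) ∈ A)} := by
  set f : ℝ → ℝ := A.indicator 1 with hf
  have hint : ∀ u v, IntervalIntegrable f volume u v := fun u v => by
    rw [intervalIntegrable_iff]
    exact (integrableOn_const (by simp)).indicator hA
  set F : ℝ → ℝ := fun x => ∫ s in (0 : ℝ)..x, f s with hF
  have hτ : Tendsto (fun k : ℕ => 1 / ((k : ℝ) + 1)) atTop (𝓝[≠] 0) := by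
    refine tendsto_nhdsWithin_iff.2 ⟨tendsto_one_div_add_atTop_nhds_zero_nat, ?_⟩
    exact Eventually.of_forall fun k => by simp only [mem_compl_iff, mem_singleton_iff]; positivity
  have hla := (hda.tendsto_slope_zero).comp hτ
  have hlb := (hdb.tendsto_slope_zero).comp hτ
  have hlim := (hlb.sub hla).abs
  have h1 : |f b - f a| = 1 := by
    rw [hf]
    by_cases ha : a ∈ A <;> by_cases hb : b ∈ A <;> simp_all
  rw [h1] at hlim
  filter_upwards [hlim.eventually_const_lt (show (1 : ℝ) / 2 < 1 by norm_num)] with k hk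
  set τ : ℝ := 1 / ((k : ℝ) + 1) with hτd
  have hk0 : (0 : ℝ) < k + 1 := by positivity
  set J := {s ∈ Ioo a b | ¬ (s ∈ A ↔ s + τ ∈ A)} with hJ
  have hJm : MeasurableSet {s : ℝ | ¬ (s ∈ A ↔ s + τ ∈ A)} := by
    have h2 : MeasurableSet {s : ℝ | s + τ ∈ A} := hA.preimage (measurable_add_const τ)
    exact (MeasurableSet.iff hA h2).compl
  have hJfin : volume J ≠ ⊤ := measure_ne_top_of_subset (fun s hs => hs.1)
    (by simp : volume (Ioo a b) ≠ ⊤)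
  -- Divided by `τ`, the two increments are means of the indicator next to `b` and next to `a`, and
  -- the difference of these means tends to `±1`. Regrouping the increments gives the integral of
  -- `f(s + τ) - f(s)` over `(a, b)`, whose integrand is `±1` on `J` and zero elsewhere.
  have hkey : |(F (b + τ) - F b) - (F (a + τ) - F a)| ≤ volume.real J := by
    have h3 : (F (b + τ) - F b) - (F (a + τ) - F a) = ∫ s in a..b, (f (s + τ) - f s) := by
      rw [intervalIntegral.integral_sub _ (hint _ _), intervalIntegral.integral_comp_add_right]
      · have e1 : F (b + τ) - F (a + τ) = ∫ s in (a + τ)..(b + τ), f s :=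
          intervalIntegral.integral_interval_sub_left (hint _ _) (hint _ _)
        have e2 : F b - F a = ∫ s in a..b, f s :=
          intervalIntegral.integral_interval_sub_left (hint _ _) (hint _ _)
        rw [← e1, ← e2]
        ring
      · simpa using (hint (a + τ) (b + τ)).comp_add_right τ
    rw [h3, ← Real.norm_eq_abs]
    refine (intervalIntegral.norm_integral_le_integral_norm hab.le).trans (le_of_eq ?_)
    rw [intervalIntegral.integral_of_le hab.le, integral_Ioc_eq_integral_Ioo]
    have h4 : ∀ s, ‖f (s + τ) - f s‖ = {s : ℝ | ¬ (s ∈ A ↔ s + τ ∈ A)}.indicator (1 : ℝ → ℝ) s := by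
      intro s
      rw [hf]
      by_cases h5 : s ∈ A <;> by_cases h6 : s + τ ∈ A <;> simp [h5, h6]
    simp only [h4]
    rw [integral_indicator_one hJm, measureReal_restrict_apply hJm]
    congr 1
    ext s
    simp [hJ, and_comm]
  simp only [Function.comp, smul_eq_mul] at hk
  have hτi : τ⁻¹ = k + 1 := by rw [hτd, one_div, inv_inv]
  rw [← mul_sub, abs_mul, ← hτd, hτi, abs_of_pos hk0] at hk
  rw [← ofReal_measureReal hJfin, ← ENNReal.ofReal_mul hk0.le]
  apply ENNReal.ofReal_le_ofReal
  exact hk.le.trans (mul_le_mul_of_nonneg_left hkey hk0.le)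

/-- A measurable set of reals whose indicator has finite variation on `(α, β)` is, up to a null
set, everything or nothing immediately to the right of `α`. -/
lemma exists_ae_const_right {A : Set ℝ} (hA : MeasurableSet A) {α β : ℝ} (hαβ : α < β)
    (h : liminf (fun k : ℕ => ENNReal.ofReal (k + 1) * volume {s ∈ Ioo α β |
      s + 1 / ((k : ℝ) + 1) < β ∧ ¬ (s ∈ A ↔ s + 1 / ((k : ℝ) + 1) ∈ A)}) atTop ≠ ⊤) :
    ∃ γ > α, (∀ᵐ s, s ∈ Ioo α γ → s ∈ A) ∨ ∀ᵐ s, s ∈ Ioo α γ → s ∉ A := by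
  -- If both alternatives fail on every right neighbourhood of `α`, each of these contains two
  -- Lebesgue points between which the indicator jumps. Repeating this closer and closer to `α`
  -- gives any number of disjoint intervals, each contributing at least `1/2`, so the liminf would
  -- be infinite.
  by_contra! hneg
  have hD : ∀ᵐ a : ℝ, HasDerivAt (fun x => ∫ s in (0 : ℝ)..x, A.indicator (1 : ℝ → ℝ) s)
      (A.indicator 1 a) a := by
    have hloc : LocallyIntegrable (A.indicator (1 : ℝ → ℝ)) volume :=
      (locallyIntegrable_const (1 : ℝ)).indicator hA
    filter_upwards [_root_.LocallyIntegrable.ae_hasDerivAt_integral hloc] with a ha using ha 0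
  have step : ∀ γ > α, ∃ a ∈ Ioo α γ, ∃ b ∈ Ioo a γ, ∀ᶠ k : ℕ in atTop,
      ENNReal.ofReal (1 / 2) ≤ ENNReal.ofReal (k + 1) *
        volume {s ∈ Ioo a b | ¬ (s ∈ A ↔ s + 1 / ((k : ℝ) + 1) ∈ A)} := by
    intro γ hγ
    obtain ⟨h1, h2⟩ := hneg γ hγ
    obtain ⟨p, hp, hpD⟩ := (h1.and_eventually hD).exists
    obtain ⟨q, hq, hqD⟩ := (h2.and_eventually hD).exists
    have hpq : p ≠ q := fun e => hp.2 (e ▸ hq.2)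
    rcases lt_or_gt_of_ne hpq with hlt | hlt
    · exact ⟨p, hp.1, q, ⟨hlt, hq.1.2⟩, eventually_half_le_volume_jump hA hlt hpD hqD
        (by simp [hp.2, hq.2])⟩
    · exact ⟨q, hq.1, p, ⟨hlt, hp.1.2⟩, eventually_half_le_volume_jump hA hlt hqD hpD
        (by simp [hp.2, hq.2])⟩
  have many : ∀ J : ℕ, ∀ γ > α, ∃ a ∈ Ioo α γ, ∀ᶠ k : ℕ in atTop,
      (J : ℝ≥0∞) * ENNReal.ofReal (1 / 2) ≤ ENNReal.ofReal (k + 1) *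
        volume {s ∈ Ioo a γ | ¬ (s ∈ A ↔ s + 1 / ((k : ℝ) + 1) ∈ A)} := by
    intro J
    induction J with
    | zero =>
      intro γ hγ
      exact ⟨(α + γ) / 2, ⟨by linarith, by linarith⟩, by simp⟩
    | succ J ih =>
      intro γ hγ
      obtain ⟨a, ha, b, hb, hk⟩ := step γ hγ
      obtain ⟨a', ha', hk'⟩ := ih a ha.1
      refine ⟨a', ⟨ha'.1, ha'.2.trans ha.2⟩, ?_⟩
      filter_upwards [hk, hk'] with k h1 h2
      push_cast
      rw [add_mul, one_mul]
      refine (add_le_add h2 h1).trans ?_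
      have hm : MeasurableSet {s ∈ Ioo a b | ¬ (s ∈ A ↔ s + 1 / ((k : ℝ) + 1) ∈ A)} := by
        have h3 : MeasurableSet {s : ℝ | s + 1 / ((k : ℝ) + 1) ∈ A} :=
          hA.preimage (measurable_add_const _)
        exact measurableSet_Ioo.inter (MeasurableSet.iff hA h3).compl
      rw [← mul_add, ← measure_union _ hm]
      · gcongr
        rintro s (⟨h4, h5⟩ | ⟨h4, h5⟩)
        · exact ⟨⟨h4.1, h4.2.trans ha.2⟩, h5⟩
        · exact ⟨⟨ha'.2.trans h4.1, h4.2.trans hb.2⟩, h5⟩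
      · refine Set.disjoint_left.2 fun s h4 h5 => ?_
        exact lt_irrefl _ (h4.1.2.trans h5.1.1)
  -- Stopping short of `β` makes the requirement that the translated point stay below `β` automatic
  -- for large `k`.
  set γ := (α + β) / 2 with hγ
  apply h
  rw [eq_top_iff]
  have hJ : ∀ J : ℕ, (J : ℝ≥0∞) * ENNReal.ofReal (1 / 2) ≤
      liminf (fun k : ℕ => ENNReal.ofReal (k + 1) * volume {s ∈ Ioo α β |
      s + 1 / ((k : ℝ) + 1) < β ∧ ¬ (s ∈ A ↔ s + 1 / ((k : ℝ) + 1) ∈ A)}) atTop := by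
    intro J
    obtain ⟨a, ha, hk⟩ := many J γ (by linarith)
    refine le_liminf_of_le (by isBoundedDefault) ?_
    have hτ := (tendsto_one_div_add_atTop_nhds_zero_nat (𝕜 := ℝ)).eventually_lt_const
      (show (0 : ℝ) < β - γ by linarith)
    filter_upwards [hk, hτ] with k h1 h2
    refine h1.trans ?_
    refine mul_le_mul_right (measure_mono ?_) _
    rintro s ⟨h3, h4⟩
    exact ⟨⟨ha.1.trans h3.1, by linarith [h3.2]⟩, by linarith [h3.2], h4⟩
  have hlim : Tendsto (fun J : ℕ => (J : ℝ≥0∞) * ENNReal.ofReal (1 / 2)) atTop (𝓝 ⊤) := by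
    have := ENNReal.Tendsto.mul_const (b := ENNReal.ofReal (1 / 2)) ENNReal.tendsto_nat_nhds_top
      (Or.inl ENNReal.top_ne_zero)
    rwa [ENNReal.top_mul (by simp)] at this
  exact le_of_tendsto' hlim hJ

end

/-! ### Orthogonal coordinates and integration along vertical lines -/

section

open scoped RealInnerProductSpace

/-- An orthonormal splitting of `ℝ^{m+1}` into a unit direction `e` and `ℝ^m`. -/
structure Frame (m : ℕ) where
  e : Space (m + 1)
  ι : Space m →ₗᵢ[ℝ] Space (m + 1)
  norm_e : ‖e‖ = 1
  inner_ι : ∀ y, ⟪e, ι y⟫ = 0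

lemma exists_frame {m : ℕ} {e : Space (m + 1)} (he : ‖e‖ = 1) : ∃ C : Frame m, C.e = e := by
  have hfact : Fact (Module.finrank ℝ (Space (m + 1)) = m + 1) := ⟨by simp⟩
  have he0 : e ≠ 0 := norm_ne_zero_iff.1 (by rw [he]; exact one_ne_zero)
  have hfin : Module.finrank ℝ (ℝ ∙ e)ᗮ = m := Submodule.finrank_orthogonal_span_singleton he0
  let b := (stdOrthonormalBasis ℝ (ℝ ∙ e)ᗮ).reindex (finCongr hfin)
  refine ⟨⟨e, (ℝ ∙ e)ᗮ.subtypeₗᵢ.comp b.repr.symm.toLinearIsometry, he, fun y => ?_⟩, rfl⟩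
  exact Submodule.mem_orthogonal_singleton_iff_inner_right.1 (b.repr.symm y).2

namespace Frame

variable {m : ℕ} (C : Frame m)

/-- The point with height `s` and horizontal coordinate `y`. -/
def pt (s : ℝ) (y : Space m) : Space (m + 1) := s • C.e + C.ι y

/-- Surjectivity follows from the equality of dimensions. Being an isometry, the map preserves
Lebesgue measure, which gives Fubini along the lines of direction `e`. -/
def iso : WithLp 2 (ℝ × Space m) ≃ₗᵢ[ℝ] Space (m + 1) :=
  LinearIsometry.toLinearIsometryEquiv
    { toFun := fun p => C.pt p.fst p.snd
      map_add' := fun p q => by simp only [pt, WithLp.add_fst, WithLp.add_snd, map_add]; module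
      map_smul' := fun a p => by
        simp only [pt, WithLp.smul_fst, WithLp.smul_snd, map_smul, RingHom.id_apply, smul_eq_mul]
        module
      norm_map' := fun p => by
        rw [← sq_eq_sq₀ (norm_nonneg _) (norm_nonneg _), WithLp.prod_norm_sq_eq_of_L2]
        simp [pt, norm_add_sq_real, norm_smul, C.norm_e, inner_smul_left, C.inner_ι] }
    (by
      rw [(WithLp.linearEquiv 2 ℝ (ℝ × Space m)).finrank_eq]
      simp [add_comm])

lemma iso_apply (p : WithLp 2 (ℝ × Space m)) : C.iso p = C.pt p.fst p.snd := rfl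

/-- The horizontal projection. -/
def proj (x : Space (m + 1)) : Space m := (C.iso.symm x).snd

def height (x : Space (m + 1)) : ℝ := (C.iso.symm x).fst

@[simp] lemma pt_height_proj (x : Space (m + 1)) : C.pt (C.height x) (C.proj x) = x := by
  rw [height, proj, ← iso_apply, C.iso.apply_symm_apply]

@[simp] lemma proj_pt (s : ℝ) (y : Space m) : C.proj (C.pt s y) = y := by
  have : C.pt s y = C.iso (WithLp.toLp 2 (s, y)) := rfl
  rw [this, proj, C.iso.symm_apply_apply]
  rfl

@[simp] lemma height_pt (s : ℝ) (y : Space m) : C.height (C.pt s y) = s := by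
  have : C.pt s y = C.iso (WithLp.toLp 2 (s, y)) := rfl
  rw [this, height, C.iso.symm_apply_apply]
  rfl

lemma continuous_pt : Continuous fun p : ℝ × Space m => C.pt p.1 p.2 := by
  unfold pt
  have := C.ι.continuous
  fun_prop

lemma norm_sq_eq (x : Space (m + 1)) : ‖x‖ ^ 2 = C.height x ^ 2 + ‖C.proj x‖ ^ 2 := by
  rw [← C.iso.symm.norm_map x, WithLp.prod_norm_sq_eq_of_L2]
  simp [height, proj]

lemma proj_sub (x y : Space (m + 1)) : C.proj (x - y) = C.proj x - C.proj y := by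
  simp [proj]

lemma height_sub (x y : Space (m + 1)) : C.height (x - y) = C.height x - C.height y := by
  simp [height]

lemma norm_proj_le (x : Space (m + 1)) : ‖C.proj x‖ ≤ ‖x‖ := by
  rw [← sq_le_sq₀ (norm_nonneg _) (norm_nonneg _), C.norm_sq_eq]
  nlinarith [sq_nonneg (C.height x)]

lemma abs_height_le (x : Space (m + 1)) : |C.height x| ≤ ‖x‖ := by
  rw [← sq_le_sq₀ (abs_nonneg _) (norm_nonneg _), C.norm_sq_eq, sq_abs]
  nlinarith [sq_nonneg ‖C.proj x‖]

lemma lipschitz_proj : LipschitzWith 1 C.proj :=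
  LipschitzWith.of_dist_le_mul fun x y => by
    rw [dist_eq_norm, dist_eq_norm, ← C.proj_sub, NNReal.coe_one, one_mul]
    exact C.norm_proj_le _

lemma pt_add (s t : ℝ) (y : Space m) : C.pt s y + t • C.e = C.pt (s + t) y := by
  simp only [pt]
  module

lemma pt_sub_pt (s t : ℝ) (y : Space m) : C.pt s y - C.pt t y = (s - t) • C.e := by
  simp only [pt]
  module

lemma inner_e (x : Space (m + 1)) : ⟪C.e, x⟫ = C.height x := by
  conv_lhs => rw [← C.pt_height_proj x]
  simp [pt, inner_add_right, inner_smul_right, C.inner_ι, C.norm_e]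

lemma dist_pt_pt (s t : ℝ) (y : Space m) : dist (C.pt s y) (C.pt t y) = |s - t| := by
  rw [dist_eq_norm, C.pt_sub_pt, norm_smul, C.norm_e, mul_one, Real.norm_eq_abs]

lemma measurePreserving_pt : MeasurePreserving (fun p : ℝ × Space m => C.pt p.1 p.2) :=
  C.iso.measurePreserving.comp (WithLp.volume_preserving_toLp ℝ (Space m))

lemma lintegral_eq {g : Space (m + 1) → ℝ≥0∞} (hg : Measurable g) :
    ∫⁻ x, g x = ∫⁻ y, ∫⁻ s, g (C.pt s y) := by
  rw [← C.measurePreserving_pt.lintegral_comp hg]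
  exact lintegral_prod_symm' _ (hg.comp C.continuous_pt.measurable)

/-- The projection does not increase the surface measure. -/
lemma volume_image_proj_le (A : Set (Space (m + 1))) :
    volume (C.proj '' A) ≤ Measure.euclideanHausdorffMeasure m A := by
  rw [← EuclideanSpace.euclideanHausdorffMeasure_eq_volume,
    Measure.euclideanHausdorffMeasure_def, Measure.euclideanHausdorffMeasure_def,
    Measure.smul_apply, Measure.smul_apply]
  gcongr
  simpa using C.lipschitz_proj.hausdorffMeasure_image_le (Nat.cast_nonneg m) A

end Frame

end

/-! ### Charts in which the boundary is nearly flat -/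

section

open scoped RealInnerProductSpace

/-- A ball about a boundary point in which `Ω` is the sublevel set of a `C¹` function whose
differential is `ε`-close to `-⟪e, ·⟫`. -/
structure FlatChart {m : ℕ} (Ω : Set (Space (m + 1))) (ε : ℝ) extends Frame m where
  center : Space (m + 1)
  radius : ℝ
  ρ : Space (m + 1) → ℝ
  radius_pos : 0 < radius
  contDiffOn : ContDiffOn ℝ 1 ρ (Metric.ball center radius)
  norm_fderiv_add_le : ∀ x ∈ Metric.ball center radius, ‖fderiv ℝ ρ x + innerSL ℝ e‖ ≤ ε
  sublevel : Ω ∩ Metric.ball center radius = {x ∈ Metric.ball center radius | ρ x < 0}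

/-- Dividing the defining function by `|∇ρ(x)|` makes its gradient at `x` the unit vector `-e`, with
`e` pointing into `Ω`. Continuity of the derivative gives the `ε`-bound on a small ball. -/
lemma IsC1BoundaryPoint.exists_flatChart {m : ℕ} {Ω : Set (Space (m + 1))} {x : Space (m + 1)}
    (hx : IsC1BoundaryPoint Ω x) {ε : ℝ} (hε : 0 < ε) : ∃ C : FlatChart Ω ε, C.center = x := by
  obtain ⟨U, ρ, hU, hxU, hρ, hd, hΩ⟩ := hx
  set g := gradient ρ x with hg
  have hgd : innerSL ℝ g = fderiv ℝ ρ x := by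
    ext v
    simp [hg, gradient, InnerProductSpace.toDual_symm_apply]
  have hg0 : g ≠ 0 := fun h => hd (by rw [← hgd, h]; simp)
  have hgn : 0 < ‖g‖ := norm_pos_iff.2 hg0
  set e := -(‖g‖⁻¹ • g) with he
  have he1 : ‖e‖ = 1 := by
    rw [he, norm_neg, norm_smul, norm_inv, norm_norm, inv_mul_cancel₀ hgn.ne']
  obtain ⟨F, hF⟩ := exists_frame he1
  have hcont : ContinuousAt (fun y => ‖‖g‖⁻¹ • fderiv ℝ ρ y + innerSL ℝ e‖) x := by
    have h1 : ContinuousAt (fderiv ℝ ρ) x :=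
      (hρ.continuousOn_fderiv_of_isOpen hU le_rfl).continuousAt (hU.mem_nhds hxU)
    have h2 : Continuous fun L : Space (m + 1) →L[ℝ] ℝ => ‖‖g‖⁻¹ • L + innerSL ℝ e‖ := by fun_prop
    exact ContinuousAt.comp (g := fun L : Space (m + 1) →L[ℝ] ℝ => ‖‖g‖⁻¹ • L + innerSL ℝ e‖)
      h2.continuousAt h1
  have hval : ‖‖g‖⁻¹ • fderiv ℝ ρ x + innerSL ℝ e‖ < ε := by
    have h0 : ‖g‖⁻¹ • innerSL ℝ g + innerSL ℝ e = 0 := by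
      ext v
      simp only [he, add_apply, smul_apply,
        innerSL_apply_apply, inner_neg_left, inner_smul_left, smul_eq_mul,
        zero_apply, RCLike.conj_to_real]
      ring
    rw [← hgd, h0, norm_zero]
    exact hε
  obtain ⟨r, hr, hball⟩ := Metric.mem_nhds_iff.1
    ((hcont.eventually_lt_const hval).and (hU.mem_nhds hxU))
  have hrU : Metric.ball x r ⊆ U := fun y hy => (hball hy).2
  have h3 : ∀ y ∈ Metric.ball x r,
      ‖fderiv ℝ (fun y => ‖g‖⁻¹ * ρ y) y + innerSL ℝ F.e‖ ≤ ε := fun y hy => by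
    have hdy : DifferentiableAt ℝ ρ y :=
      ((hρ.differentiableOn one_ne_zero) y (hrU hy)).differentiableAt (hU.mem_nhds (hrU hy))
    rw [fderiv_const_mul hdy, hF]
    exact (hball hy).1.le
  have h4 : Ω ∩ Metric.ball x r = {y ∈ Metric.ball x r | ‖g‖⁻¹ * ρ y < 0} := by
    ext y
    have h1 : y ∈ Ω ∩ U ↔ y ∈ U ∧ ρ y < 0 := by rw [hΩ]; rfl
    have h2 : ‖g‖⁻¹ * ρ y < 0 ↔ ρ y < 0 := by
      rw [mul_neg_iff]
      have : 0 < ‖g‖⁻¹ := inv_pos.2 hgn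
      constructor
      · rintro (⟨-, h⟩ | ⟨h, -⟩)
        · exact h
        · linarith
      · exact fun h => Or.inl ⟨this, h⟩
    simp only [mem_inter_iff, Set.mem_ofPred_eq, h2] at h1 ⊢
    constructor
    · rintro ⟨a, b⟩; exact ⟨b, (h1.1 ⟨a, hrU b⟩).2⟩
    · rintro ⟨a, b⟩; exact ⟨(h1.2 ⟨hrU a, b⟩).1, a⟩
  exact ⟨{ toFrame := F, center := x, radius := r, ρ := fun y => ‖g‖⁻¹ * ρ y, radius_pos := hr,
           contDiffOn := contDiffOn_const.mul (hρ.mono hrU), norm_fderiv_add_le := h3,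
           sublevel := h4 }, rfl⟩

namespace FlatChart

variable {m : ℕ} {Ω : Set (Space (m + 1))} {ε : ℝ} (C : FlatChart Ω ε)

/-- The chart neighbourhood. -/
def nbhd : Set (Space (m + 1)) := Metric.ball C.center C.radius

lemma isOpen_nbhd : IsOpen C.nbhd := Metric.isOpen_ball

lemma center_mem_nbhd : C.center ∈ C.nbhd := Metric.mem_ball_self C.radius_pos

lemma mem_iff {x : Space (m + 1)} (hx : x ∈ C.nbhd) : x ∈ Ω ↔ C.ρ x < 0 := by
  have h := Set.ext_iff.1 C.sublevel x
  simp only [mem_inter_iff, Set.mem_ofPred_eq] at h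
  exact ⟨fun a => (h.1 ⟨a, hx⟩).2, fun a => (h.2 ⟨hx, a⟩).1⟩

lemma differentiableAt {x : Space (m + 1)} (hx : x ∈ C.nbhd) : DifferentiableAt ℝ C.ρ x :=
  ((C.contDiffOn.differentiableOn one_ne_zero) x hx).differentiableAt (C.isOpen_nbhd.mem_nhds hx)

lemma continuousOn : ContinuousOn C.ρ C.nbhd := C.contDiffOn.continuousOn

lemma norm_fderiv_le {x : Space (m + 1)} (hx : x ∈ C.nbhd) : ‖fderiv ℝ C.ρ x‖ ≤ 1 + ε := by
  have h1 : fderiv ℝ C.ρ x = (fderiv ℝ C.ρ x + innerSL ℝ C.e) - innerSL ℝ C.e := by abel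
  rw [h1]
  refine (norm_sub_le _ _).trans ?_
  rw [innerSL_apply_norm, C.norm_e]
  linarith [C.norm_fderiv_add_le x hx]

/-- This is the mean value inequality on the convex chart ball for `ρ` plus the height, whose
differential has norm at most `ε`. -/
lemma abs_sub_add_height_le {x y : Space (m + 1)} (hx : x ∈ C.nbhd) (hy : y ∈ C.nbhd) :
    |C.ρ y - C.ρ x + C.height (y - x)| ≤ ε * ‖y - x‖ := by
  have h := (convex_ball C.center C.radius).norm_image_sub_le_of_norm_hasFDerivWithin_le'
    (f := C.ρ) (f' := fderiv ℝ C.ρ) (φ := -innerSL ℝ C.e) (C := ε)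
    (fun z hz => (C.differentiableAt hz).hasFDerivAt.hasFDerivWithinAt)
    (fun z hz => by rw [sub_neg_eq_add]; exact C.norm_fderiv_add_le z hz) hx hy
  simpa [C.inner_e] using h

lemma abs_sub_le {x y : Space (m + 1)} (hx : x ∈ C.nbhd) (hy : y ∈ C.nbhd) :
    |C.ρ y - C.ρ x| ≤ (1 + ε) * ‖y - x‖ := by
  have h1 := abs_le.1 (C.abs_sub_add_height_le hx hy)
  have h2 := abs_le.1 (C.abs_height_le (y - x))
  rw [abs_le]
  constructor <;> nlinarith [h1.1, h1.2, h2.1, h2.2]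

/-- On a vertical line the displacement is the difference of heights, so `ρ` falls with slope
between `1 - ε` and `1 + ε`. Depth `-ρ` and height above `∂Ω` are thus interchangeable up to these
factors. -/
lemma slice_bounds {s t : ℝ} {y : Space m} (hst : s ≤ t) (hs : C.pt s y ∈ C.nbhd)
    (ht : C.pt t y ∈ C.nbhd) :
    (1 - ε) * (t - s) ≤ C.ρ (C.pt s y) - C.ρ (C.pt t y) ∧
      C.ρ (C.pt s y) - C.ρ (C.pt t y) ≤ (1 + ε) * (t - s) := by
  have h := C.abs_sub_add_height_le hs ht
  rw [C.height_sub, C.height_pt, C.height_pt, ← dist_eq_norm, C.dist_pt_pt,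
    abs_of_nonneg (sub_nonneg.2 hst), abs_le] at h
  constructor <;> linarith [h.1, h.2]

lemma pt_mem_of_mem {s t u : ℝ} {y : Space m} (hs : C.pt s y ∈ C.nbhd) (ht : C.pt t y ∈ C.nbhd)
    (hu : u ∈ Icc s t) : C.pt u y ∈ C.nbhd := by
  refine (convex_ball C.center C.radius).segment_subset hs ht ?_
  rw [segment_eq_image']
  rcases eq_or_lt_of_le (hu.1.trans hu.2) with h | h
  · refine ⟨0, by simp, ?_⟩
    have : u = s := le_antisymm (h ▸ hu.2) hu.1
    simp [this]
  · refine ⟨(u - s) / (t - s), ⟨div_nonneg (by linarith [hu.1]) (by linarith), ?_⟩, ?_⟩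
    · rw [div_le_one (by linarith)]; linarith [hu.2]
    · simp only
      rw [C.pt_sub_pt, smul_smul, div_mul_cancel₀ _ (by linarith : t - s ≠ 0), C.pt_add]
      congr 1
      ring

lemma eventually_pt_mem {s : ℝ} {y : Space m} (hs : C.pt s y ∈ C.nbhd) :
    ∀ᶠ t in 𝓝 s, C.pt t y ∈ C.nbhd := by
  have : Continuous fun t => C.pt t y := C.continuous_pt.comp (by fun_prop : Continuous fun t : ℝ => (t, y))
  exact this.continuousAt.eventually (C.isOpen_nbhd.mem_nhds hs)

lemma mem_frontier (hε : ε < 1) {x : Space (m + 1)} (hx : x ∈ C.nbhd) (h0 : C.ρ x = 0) :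
    x ∈ frontier Ω := by
  rw [← C.pt_height_proj x] at hx h0 ⊢
  set s := C.height x
  set y := C.proj x
  refine ⟨?_, fun h => ?_⟩
  · have hc : Tendsto (fun t => C.pt t y) (𝓝[>] s) (𝓝 (C.pt s y)) :=
      ((C.continuous_pt.comp (by fun_prop : Continuous fun t : ℝ => (t, y))).tendsto s).mono_left
        nhdsWithin_le_nhds
    refine mem_closure_of_tendsto hc ?_
    filter_upwards [(C.eventually_pt_mem hx).filter_mono nhdsWithin_le_nhds,
      self_mem_nhdsWithin] with t ht hst
    rw [C.mem_iff ht]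
    have := (C.slice_bounds (le_of_lt hst) hx ht).1
    have h2 : 0 < (1 - ε) * (t - s) := mul_pos (by linarith) (by simpa using hst)
    linarith
  · have := (C.mem_iff hx).1 (interior_subset h)
    linarith

end FlatChart

end

/-! ### Behaviour of a set of finite perimeter on lines near the boundary -/

section

open scoped RealInnerProductSpace

namespace Frame

variable {m : ℕ} (C : Frame m)

lemma measurableSet_prod_preimage {T : Set (Space (m + 1))} (hT : MeasurableSet T) :
    MeasurableSet {p : ℝ × Space m | C.pt p.1 p.2 ∈ T} :=
  hT.preimage C.continuous_pt.measurable

lemma measurable_pt_left (y : Space m) : Measurable fun s => C.pt s y :=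
  C.continuous_pt.measurable.comp measurable_prodMk_right

lemma measurable_volume_slice {T : Set (Space (m + 1))} (hT : MeasurableSet T) :
    Measurable fun y => volume {s | C.pt s y ∈ T} :=
  measurable_measure_prodMk_right (C.measurableSet_prod_preimage hT)

lemma volume_eq_lintegral_slice {T : Set (Space (m + 1))} (hT : MeasurableSet T) :
    volume T = ∫⁻ y, volume {s | C.pt s y ∈ T} := by
  rw [← lintegral_indicator_one hT, C.lintegral_eq (measurable_one.indicator hT)]
  refine lintegral_congr fun y => ?_
  exact lintegral_indicator_one (hT.preimage (C.measurable_pt_left y))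

end Frame

namespace FlatChart

variable {m : ℕ} {Ω : Set (Space (m + 1))} {ε : ℝ} (C : FlatChart Ω ε) {E : Set (Space (m + 1))}

/-- On almost every vertical line, `E` is everything or nothing immediately above `∂Ω`. -/
lemma ae_exists_const_slice (hε : ε < 1) (hΩ : IsOpen Ω) (hΩb : Bornology.IsBounded Ω)
    (hE : MeasurableSet E) (hEΩ : E ⊆ Ω) (hP : perimeter E Ω ≠ ⊤) :
    ∀ᵐ y, ∀ s₀, C.pt s₀ y ∈ C.nbhd → C.ρ (C.pt s₀ y) = 0 → ∃ γ > s₀,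
      (∀ᵐ s, s ∈ Ioo s₀ γ → C.pt s y ∈ E) ∨ ∀ᵐ s, s ∈ Ioo s₀ γ → C.pt s y ∉ E := by
  set τ : ℕ → ℝ := fun k => 1 / ((k : ℝ) + 1) with hτ
  have hτ0 : ∀ k, 0 < τ k := fun k => by positivity
  -- If a point of `Ω` and its translate by `τ k • e` both lie in the chart, the segment between
  -- them stays in `Ω`, since `ρ` decreases upwards. The translation estimate therefore applies on
  -- `W k`.
  set W : ℕ → Set (Space (m + 1)) := fun k =>
    Ω ∩ C.nbhd ∩ (fun x => x + τ k • C.e) ⁻¹' C.nbhd with hW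
  have hWo : ∀ k, IsOpen (W k) := fun k =>
    (hΩ.inter C.isOpen_nbhd).inter (C.isOpen_nbhd.preimage (by fun_prop))
  have hWv : ∀ k, ∀ x ∈ W k, ∀ σ ∈ Icc (0 : ℝ) 1, x + σ • (τ k • C.e) ∈ Ω := by
    rintro k x ⟨⟨hxΩ, hx⟩, hxτ⟩ σ hσ
    simp only [mem_preimage] at hxτ
    rw [← C.pt_height_proj x] at hxΩ hx hxτ ⊢
    rw [C.pt_add] at hxτ
    rw [smul_smul, C.pt_add]
    have h0 : 0 ≤ σ * τ k := mul_nonneg hσ.1 (hτ0 k).le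
    have h1 := C.pt_mem_of_mem hx hxτ (u := C.height x + σ * τ k)
      ⟨by linarith, by nlinarith [hσ.2, hτ0 k]⟩
    rw [C.mem_iff h1]
    have h2 := (C.slice_bounds (by linarith) hx h1).1
    have h3 := (C.mem_iff hx).1 hxΩ
    have h4 : 0 ≤ (1 - ε) * (C.height x + σ * τ k - C.height x) :=
      mul_nonneg (by linarith) (by linarith)
    linarith
  set T : ℕ → Set (Space (m + 1)) := fun k =>
    {x ∈ W k | ¬ (x ∈ E ↔ x + τ k • C.e ∈ E)} with hT
  have hTm : ∀ k, MeasurableSet (T k) := fun k =>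
    (hWo k).measurableSet.inter
      (MeasurableSet.iff hE (hE.preimage (measurable_add_const _))).compl
  set V : ℕ → Space m → ℝ≥0∞ := fun k y =>
    ENNReal.ofReal (k + 1) * volume {s | C.pt s y ∈ T k} with hV
  have hVm : ∀ k, Measurable (V k) := fun k => (C.measurable_volume_slice (hTm k)).const_mul _
  -- The translation estimate bounds `|T k|` by `2 τ k P(E, Ω)`, and `k + 1` is the inverse of `τ
  -- k`. With this uniform bound, Fatou makes the liminf finite on almost every line, which is what
  -- `exists_ae_const_right` asks for.
  have hVint : ∀ k, ∫⁻ y, V k y ≤ 2 * perimeter E Ω := fun k => by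
    rw [hV]
    simp only
    rw [lintegral_const_mul _ (C.measurable_volume_slice (hTm k)),
      ← C.volume_eq_lintegral_slice (hTm k)]
    calc ENNReal.ofReal (k + 1) * volume (T k)
        ≤ ENNReal.ofReal (k + 1) * (2 * (ENNReal.ofReal ‖τ k • C.e‖ * perimeter E Ω)) := by
          gcongr
          exact volume_translate_diff_le hE hEΩ hΩb (hWo k) (hWv k)
      _ = (ENNReal.ofReal (k + 1) * ENNReal.ofReal (τ k)) * (2 * perimeter E Ω) := by
          rw [norm_smul, C.norm_e, mul_one, Real.norm_of_nonneg (hτ0 k).le]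
          ring
      _ = 2 * perimeter E Ω := by
          rw [← ENNReal.ofReal_mul (by positivity), hτ, mul_one_div_cancel (by positivity),
            ENNReal.ofReal_one, one_mul]
  have hfin : ∫⁻ y, liminf (fun k => V k y) atTop ≠ ⊤ := by
    refine ne_top_of_le_ne_top (ENNReal.mul_ne_top ENNReal.ofNat_ne_top hP)
      (b := 2 * perimeter E Ω) ?_
    refine (lintegral_liminf_le hVm).trans ?_
    exact (liminf_le_liminf (v := fun _ => 2 * perimeter E Ω)
      (Eventually.of_forall hVint)).trans (by simp)
  filter_upwards [ae_lt_top (Measurable.liminf hVm) hfin] with y hy s₀ hs₀ h0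
  obtain ⟨δ, hδ, hball⟩ := Metric.eventually_nhds_iff.1 (C.eventually_pt_mem hs₀)
  have hmem : ∀ s ∈ Ico s₀ (s₀ + δ), C.pt s y ∈ C.nbhd := fun s hs => hball (by
    rw [Real.dist_eq, abs_of_nonneg (by linarith [hs.1])]
    linarith [hs.2])
  refine exists_ae_const_right (A := {s | C.pt s y ∈ E}) (hE.preimage (C.measurable_pt_left y))
    (show s₀ < s₀ + δ by linarith) (ne_top_of_le_ne_top hy.ne ?_)
  refine liminf_le_liminf (Eventually.of_forall fun k => ?_)
  refine mul_le_mul_right (measure_mono ?_) _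
  rintro s ⟨hs, hsτ, hdiff⟩
  have hsn := hmem s ⟨hs.1.le, hs.2⟩
  refine ⟨⟨⟨?_, hsn⟩, ?_⟩, ?_⟩
  · rw [C.mem_iff hsn]
    have h2 := (C.slice_bounds hs.1.le hs₀ hsn).1
    have h4 : 0 < (1 - ε) * (s - s₀) := mul_pos (by linarith) (by linarith [hs.1])
    linarith
  · simp only [mem_preimage]
    rw [C.pt_add]
    exact hmem _ ⟨by linarith [hs.1, hτ0 k], hsτ⟩
  · rw [C.pt_add]
    exact hdiff

/-- The part of the chart at "depth" less than `h` below the boundary. -/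
def layer (h : ℝ) : Set (Space (m + 1)) := C.nbhd ∩ C.ρ ⁻¹' Ioo (-h) 0

lemma measurableSet_layer (h : ℝ) : MeasurableSet (C.layer h) :=
  (C.continuousOn.isOpen_inter_preimage C.isOpen_nbhd isOpen_Ioo).measurableSet

/-- The vertical lines on which `E` fills the layer of depth `h`. -/
def fullLines (E : Set (Space (m + 1))) (h : ℝ) : Set (Space m) :=
  {y | volume {s | C.pt s y ∈ C.layer h \ E} = 0}

/-- The vertical lines on which `E` misses the layer of depth `h`. -/
def emptyLines (E : Set (Space (m + 1))) (h : ℝ) : Set (Space m) :=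
  {y | volume {s | C.pt s y ∈ C.layer h ∩ E} = 0}

lemma measurableSet_fullLines (hE : MeasurableSet E) (h : ℝ) :
    MeasurableSet (C.fullLines E h) :=
  C.measurable_volume_slice ((C.measurableSet_layer h).diff hE) (measurableSet_singleton 0)

lemma mem_layer_bounds (hε : ε < 1) {s₀ s h : ℝ} {y : Space m} (hs₀ : C.pt s₀ y ∈ C.nbhd)
    (h0 : C.ρ (C.pt s₀ y) = 0) (hs : C.pt s y ∈ C.layer h) :
    s₀ < s ∧ (1 - ε) * (s - s₀) < h := by
  obtain ⟨hsn, hsl, hsr⟩ := hs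
  have hlt : s₀ < s := by
    by_contra! hle
    have := (C.slice_bounds hle hsn hs₀).1
    have h4 : 0 ≤ (1 - ε) * (s₀ - s) := mul_nonneg (by linarith) (by linarith)
    linarith
  refine ⟨hlt, ?_⟩
  have := (C.slice_bounds hlt.le hs₀ hsn).1
  linarith

/-- A point of depth less than `(1 - ε)(γ - s₀)` lies below height `γ`, so the one-sided alternative
holds on a whole layer. Restricting to the countably many depths `1/(n+1)` lets the density theorem
be applied to each set of lines. -/
lemma ae_mem_fullLines_or_emptyLines (hε : ε < 1) (hΩ : IsOpen Ω) (hΩb : Bornology.IsBounded Ω)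
    (hE : MeasurableSet E) (hEΩ : E ⊆ Ω) (hP : perimeter E Ω ≠ ⊤) :
    ∀ᵐ y, ∀ s₀, C.pt s₀ y ∈ C.nbhd → C.ρ (C.pt s₀ y) = 0 → ∃ n : ℕ,
      y ∈ C.fullLines E (1 / ((n : ℝ) + 1)) ∨ y ∈ C.emptyLines E (1 / ((n : ℝ) + 1)) := by
  filter_upwards [C.ae_exists_const_slice hε hΩ hΩb hE hEΩ hP] with y hy s₀ hs₀ h0
  obtain ⟨γ, hγ, h⟩ := hy s₀ hs₀ h0
  obtain ⟨n, hn⟩ := exists_nat_one_div_lt (show 0 < (1 - ε) * (γ - s₀) from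
    mul_pos (by linarith) (by linarith))
  have hsub : ∀ s, C.pt s y ∈ C.layer (1 / ((n : ℝ) + 1)) → s ∈ Ioo s₀ γ := fun s hs => by
    obtain ⟨h1, h2⟩ := C.mem_layer_bounds hε hs₀ h0 hs
    refine ⟨h1, ?_⟩
    have := lt_of_mul_lt_mul_left (h2.trans hn) (by linarith)
    linarith
  refine ⟨n, h.imp (fun h => ?_) fun h => ?_⟩
  · refine measure_mono_null (fun s hs => ?_) (ae_iff.1 h)
    exact fun h' => hs.2 (h' (hsub s hs.1))
  · refine measure_mono_null (fun s hs => ?_) (ae_iff.1 h)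
    exact fun h' => h' (hsub s hs.1) hs.2

end FlatChart

end

/-! ### From filled lines to boundary points of relative density one -/

section

open scoped RealInnerProductSpace

namespace FlatChart

variable {m : ℕ} {Ω : Set (Space (m + 1))} {ε : ℝ} (C : FlatChart Ω ε) {E : Set (Space (m + 1))}

/-- Near a boundary point of the chart, `Ω` fills a fixed proportion of small balls. -/
lemma le_volume_inter_ball (hε : ε ≤ 1 / 4) {p : Space (m + 1)} (h0 : C.ρ p = 0) {r : ℝ}
    (hr : 0 < r) (hball : Metric.ball p r ⊆ C.nbhd) :
    ENNReal.ofReal ((r / 8) ^ (m + 1)) * volume (Metric.ball (0 : Space (m + 1)) 1) ≤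
      volume (Ω ∩ Metric.ball p r) := by
  -- The ball of radius `r/8` about `p + (r/2) e` lies in `Ω ∩ B(p, r)`: its points are more than
  -- `3r/8` above `p`, and the deviation of `ρ` from minus the height is at most `5r/32`.
  have h1 := Measure.addHaar_ball_of_pos (volume : Measure (Space (m + 1)))
    (p + (r / 2) • C.e) (show 0 < r / 8 by positivity)
  simp only [finrank_euclideanSpace, Fintype.card_fin] at h1
  rw [← h1]
  refine measure_mono fun x hx => ?_
  rw [Metric.mem_ball, dist_eq_norm] at hx
  have hsplit : x - p = (x - (p + (r / 2) • C.e)) + (r / 2) • C.e := by abel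
  have hnr : ‖(r / 2) • C.e‖ = r / 2 := by
    rw [norm_smul, C.norm_e, mul_one, Real.norm_of_nonneg (by positivity)]
  have hn : ‖x - p‖ < 5 / 8 * r := by
    rw [hsplit]
    refine (norm_add_le _ _).trans_lt ?_
    rw [hnr]
    linarith
  have hheight : 3 / 8 * r < C.height (x - p) := by
    rw [← C.inner_e, hsplit, inner_add_right, inner_smul_right, real_inner_self_eq_norm_sq,
      C.norm_e, C.inner_e]
    have := abs_le.1 (C.abs_height_le (x - (p + (r / 2) • C.e)))
    linarith [this.1]
  have hxb : x ∈ Metric.ball p r := by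
    rw [Metric.mem_ball, dist_eq_norm]; linarith
  refine ⟨?_, hxb⟩
  rw [C.mem_iff (hball hxb)]
  have h2 := (abs_le.1 (C.abs_sub_add_height_le (hball (Metric.mem_ball_self hr)) (hball hxb))).2
  have h3 : ε * ‖x - p‖ ≤ 1 / 4 * (5 / 8 * r) :=
    mul_le_mul hε hn.le (norm_nonneg _) (by norm_num)
  linarith

/-- The points of a small ball that `E` misses lie over lines that `E` does not fill. -/
lemma volume_inter_ball_diff_le (hε : ε ≤ 1) (hΩ : IsOpen Ω) (hE : MeasurableSet E) {h s₀ : ℝ}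
    {y : Space m} (h0 : C.ρ (C.pt s₀ y) = 0) {r : ℝ} (hr : 0 < r) (hrh : 2 * r ≤ h)
    (hball : Metric.ball (C.pt s₀ y) r ⊆ C.nbhd) :
    volume ((Ω ∩ Metric.ball (C.pt s₀ y) r) \ E) ≤
      ENNReal.ofReal (2 * r) * volume ((C.fullLines E h)ᶜ ∩ Metric.closedBall y r) := by
  have hGm := C.measurableSet_fullLines hE h
  rw [C.volume_eq_lintegral_slice ((hΩ.measurableSet.inter measurableSet_ball).diff hE),
    ← setLIntegral_const, ← lintegral_indicator (hGm.compl.inter measurableSet_closedBall)]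
  refine lintegral_mono fun z => ?_
  have hloc : ∀ s, C.pt s z ∈ Metric.ball (C.pt s₀ y) r → s ∈ Ioo (s₀ - r) (s₀ + r) ∧
      z ∈ Metric.closedBall y r := fun s hs => by
    rw [Metric.mem_ball, dist_eq_norm] at hs
    have h1 := C.abs_height_le (C.pt s z - C.pt s₀ y)
    have h2 := C.norm_proj_le (C.pt s z - C.pt s₀ y)
    rw [C.height_sub, C.height_pt, C.height_pt] at h1
    rw [C.proj_sub, C.proj_pt, C.proj_pt] at h2
    have h3 := abs_le.1 h1
    refine ⟨⟨?_, ?_⟩, ?_⟩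
    · have := abs_lt.1 (h1.trans_lt hs); linarith [this.1]
    · have := abs_lt.1 (h1.trans_lt hs); linarith [this.2]
    · rw [Metric.mem_closedBall, dist_eq_norm]; linarith
  -- In the ball `|ρ| < 2r ≤ h`, so its part in `Ω` lies in the layer and is filled by `E`, up to a
  -- null set, on a full line. On any other line the ball has length at most `2r`.
  by_cases hz : z ∈ Metric.closedBall y r
  · by_cases hzG : z ∈ C.fullLines E h
    · refine le_trans (le_of_eq ?_) zero_le
      refine measure_mono_null (fun s hs => ?_) hzG
      obtain ⟨⟨hsΩ, hsb⟩, hsE⟩ := hs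
      have hsn := hball hsb
      refine ⟨⟨hsn, ?_, (C.mem_iff hsn).1 hsΩ⟩, hsE⟩
      have h4 := (abs_le.1 (C.abs_sub_le (hball (Metric.mem_ball_self hr)) hsn)).1
      rw [Metric.mem_ball, dist_eq_norm] at hsb
      have h5 : (1 + ε) * ‖C.pt s z - C.pt s₀ y‖ < h := by
        calc (1 + ε) * ‖C.pt s z - C.pt s₀ y‖ ≤ 2 * ‖C.pt s z - C.pt s₀ y‖ := by
              gcongr; linarith
          _ < h := by linarith
      linarith
    · rw [indicator_of_mem (by exact ⟨hzG, hz⟩)]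
      refine (measure_mono (t := Ioo (s₀ - r) (s₀ + r)) fun s hs => (hloc s hs.1.2).1).trans ?_
      rw [Real.volume_Ioo]
      apply ENNReal.ofReal_le_ofReal
      linarith
  · have : {s | C.pt s z ∈ (Ω ∩ Metric.ball (C.pt s₀ y) r) \ E} = ∅ := by
      ext s
      simp only [mem_empty_iff_false, iff_false]
      exact fun hs => hz (hloc s hs.1.2).2
    rw [this]
    simp

/-- A boundary point over a density point of the lines filled by `E` belongs to the part of `∂Ω`
that belongs to `E` in the sense of traces. -/
lemma pt_mem_boundaryPart (hε : ε ≤ 1 / 4) (hΩ : IsOpen Ω) (hE : MeasurableSet E) {h s₀ : ℝ}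
    (hh : 0 < h) {y : Space m} (hs₀ : C.pt s₀ y ∈ C.nbhd) (h0 : C.ρ (C.pt s₀ y) = 0)
    (hdens : Tendsto (fun r => volume ((C.fullLines E h)ᶜ ∩ Metric.closedBall y r) /
      volume (Metric.closedBall y r)) (𝓝[>] 0) (𝓝 0)) :
    C.pt s₀ y ∈ boundaryPart E Ω := by
  refine ⟨C.mem_frontier (by linarith) hs₀ h0, ?_⟩
  set p := C.pt s₀ y with hp
  set V0 := volume.real (Metric.ball (0 : Space m) 1) with hV0
  set V1 := volume.real (Metric.ball (0 : Space (m + 1)) 1) with hV1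
  have hV0pos : 0 < V0 := ENNReal.toReal_pos (Metric.measure_ball_pos _ _ one_pos).ne'
    measure_ball_lt_top.ne
  have hV1pos : 0 < V1 := ENNReal.toReal_pos (Metric.measure_ball_pos _ _ one_pos).ne'
    measure_ball_lt_top.ne
  -- This is the ratio of `2r · r^m V0`, the volume over all lines near `y`, to `(r/8)^(m+1) V1`,
  -- the lower bound for `|Ω ∩ B(p, r)|`. The missed fraction of `Ω ∩ B(p, r)` is at most `K` times
  -- the density of the lines that are not full.
  set K : ℝ := 2 * 8 ^ (m + 1) * V0 / V1 with hK
  obtain ⟨R, hR, hRball⟩ := Metric.isOpen_iff.1 C.isOpen_nbhd p hs₀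
  have hev : ∀ᶠ r in 𝓝[>] (0 : ℝ), 0 < r ∧ 2 * r ≤ h ∧ Metric.ball p r ⊆ C.nbhd := by
    filter_upwards [self_mem_nhdsWithin,
      (eventually_lt_nhds (show (0 : ℝ) < h / 2 by positivity)).filter_mono nhdsWithin_le_nhds,
      (eventually_lt_nhds hR).filter_mono nhdsWithin_le_nhds] with r hr hrh hrR
    exact ⟨hr, by linarith, (Metric.ball_subset_ball hrR.le).trans hRball⟩
  have hDpos : ∀ r, 0 < r → Metric.ball p r ⊆ C.nbhd → volume (Ω ∩ Metric.ball p r) ≠ 0 := by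
    intro r hr hrb
    refine (lt_of_lt_of_le ?_ (C.le_volume_inter_ball hε h0 hr hrb)).ne'
    exact ENNReal.mul_pos (by simp; positivity) (Metric.measure_ball_pos _ _ one_pos).ne'
  have hDfin : ∀ r, volume (Ω ∩ Metric.ball p r) ≠ ⊤ := fun r =>
    measure_ne_top_of_subset inter_subset_right measure_ball_lt_top.ne
  have hq : Tendsto (fun r => volume ((Ω ∩ Metric.ball p r) \ E) / volume (Ω ∩ Metric.ball p r))
      (𝓝[>] 0) (𝓝 0) := by
    have hlim : Tendsto (fun r => ENNReal.ofReal K *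
        (volume ((C.fullLines E h)ᶜ ∩ Metric.closedBall y r) / volume (Metric.closedBall y r)))
        (𝓝[>] 0) (𝓝 0) := by
      have := ENNReal.Tendsto.const_mul hdens (Or.inr (ENNReal.ofReal_ne_top (r := K)))
      simpa using this
    refine tendsto_of_tendsto_of_tendsto_of_le_of_le' tendsto_const_nhds hlim
      (Eventually.of_forall fun r => zero_le) ?_
    filter_upwards [hev] with r hr
    obtain ⟨hr0, hrh, hrb⟩ := hr
    set b := volume ((C.fullLines E h)ᶜ ∩ Metric.closedBall y r) with hb
    have hbfin : b ≠ ⊤ := measure_ne_top_of_subset inter_subset_right measure_closedBall_lt_top.ne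
    have hcb : volume (Metric.closedBall y r) = ENNReal.ofReal (r ^ m * V0) := by
      rw [Measure.addHaar_closedBall _ _ hr0.le, ENNReal.ofReal_mul (by positivity), hV0,
        ofReal_measureReal measure_ball_lt_top.ne]
      simp
    refine ENNReal.div_le_of_le_mul ?_
    calc volume ((Ω ∩ Metric.ball p r) \ E) ≤ ENNReal.ofReal (2 * r) * b :=
          C.volume_inter_ball_diff_le (by linarith) hΩ hE h0 hr0 hrh hrb
      _ = ENNReal.ofReal K * (b / volume (Metric.closedBall y r)) *
            (ENNReal.ofReal ((r / 8) ^ (m + 1)) * volume (Metric.ball (0 : Space (m + 1)) 1)) := by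
          rw [hcb, ← ENNReal.ofReal_toReal hbfin,
            show volume (Metric.ball (0 : Space (m + 1)) 1) = ENNReal.ofReal V1 from
              (ofReal_measureReal measure_ball_lt_top.ne).symm,
            ← ENNReal.ofReal_div_of_pos (by positivity), ← ENNReal.ofReal_mul (by positivity),
            ← ENNReal.ofReal_mul (by positivity), ← ENNReal.ofReal_mul (by positivity),
            ← ENNReal.ofReal_mul (by positivity)]
          congr 1
          rw [hK, div_pow, pow_succ r]
          field_simp
      _ ≤ _ := by
          gcongr
          exact C.le_volume_inter_ball hε h0 hr0 hrb
  have h1 : Tendsto (fun r => 1 -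
      volume ((Ω ∩ Metric.ball p r) \ E) / volume (Ω ∩ Metric.ball p r)) (𝓝[>] 0) (𝓝 1) := by
    simpa using ENNReal.Tendsto.sub (tendsto_const_nhds (x := (1 : ℝ≥0∞))) hq
      (Or.inl ENNReal.one_ne_top)
  refine h1.congr' ?_
  filter_upwards [hev] with r hr
  have hD0 := hDpos r hr.1 hr.2.2
  have hsum := measure_inter_add_sdiff (μ := volume) (Ω ∩ Metric.ball p r) hE
  rw [inter_comm E]
  refine ENNReal.sub_eq_of_eq_add ?_ ?_
  · exact (ENNReal.div_lt_top (measure_ne_top_of_subset sdiff_subset (hDfin r)) hD0).ne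
  · rw [← ENNReal.add_div, hsum, ENNReal.div_self hD0 (hDfin r)]

/-- For each of the countably many depths, almost every point of the measurable set of full lines is
a point of zero density for its complement. -/
lemma ae_pt_mem_boundaryPart (hε : ε ≤ 1 / 4) (hΩ : IsOpen Ω) (hE : MeasurableSet E) :
    ∀ᵐ y, ∀ n : ℕ, y ∈ C.fullLines E (1 / ((n : ℝ) + 1)) → ∀ s₀, C.pt s₀ y ∈ C.nbhd →
      C.ρ (C.pt s₀ y) = 0 → C.pt s₀ y ∈ boundaryPart E Ω := by
  rw [ae_all_iff]
  intro n
  have hm := C.measurableSet_fullLines hE (1 / ((n : ℝ) + 1))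
  filter_upwards [Besicovitch.ae_tendsto_measure_inter_div_of_measurableSet volume hm.compl]
    with y hy hyG s₀ hs₀ h0
  refine C.pt_mem_boundaryPart (h := 1 / ((n : ℝ) + 1)) hε hΩ hE (by positivity) hs₀ h0 ?_
  rwa [indicator_of_notMem (by simpa using hyG)] at hy

end FlatChart

end

/-! ### Mass in thin boundary layers against the surface integral -/

section

namespace FlatChart

variable {m : ℕ} {Ω : Set (Space (m + 1))} {ε : ℝ} (C : FlatChart Ω ε) {E : Set (Space (m + 1))}

/-- The piece of `∂Ω` inside the chart. -/
def boundary : Set (Space (m + 1)) := C.nbhd ∩ C.ρ ⁻¹' {0}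

lemma measurableSet_boundary : MeasurableSet C.boundary := by
  have h : C.boundary = C.nbhd \ (C.nbhd ∩ C.ρ ⁻¹' {0}ᶜ) := by
    ext x
    by_cases hx : x ∈ C.nbhd <;> simp [boundary, hx]
  rw [h]
  exact C.isOpen_nbhd.measurableSet.diff (C.continuousOn.isOpen_inter_preimage C.isOpen_nbhd
    isOpen_compl_singleton).measurableSet

lemma boundary_subset_frontier (hε : ε < 1) : C.boundary ⊆ frontier Ω :=
  fun _ hx => C.mem_frontier hε hx.1 hx.2

lemma injOn_proj_boundary (hε : ε < 1) : InjOn C.proj C.boundary := by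
  have key : ∀ {s t : ℝ} {y : Space m}, C.pt s y ∈ C.boundary → C.pt t y ∈ C.boundary →
      s ≤ t → s = t := by
    intro s t y hs ht hst
    have h1 := (C.slice_bounds hst hs.1 ht.1).1
    have hs0 : C.ρ (C.pt s y) = 0 := hs.2
    have ht0 : C.ρ (C.pt t y) = 0 := ht.2
    rw [hs0, ht0] at h1
    nlinarith
  intro x hx x' hx' h
  rw [← C.pt_height_proj x] at hx ⊢
  rw [← C.pt_height_proj x'] at hx' ⊢
  rw [← h] at hx' ⊢
  rcases le_total (C.height x) (C.height x') with hle | hle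
  · rw [key hx hx' hle]
  · rw [key hx' hx hle]

/-- The projection is `1`-Lipschitz, hence does not increase Hausdorff measure. Only this inequality
is used, so the tilt of `∂Ω` over the base is never computed. -/
lemma volume_restrict_le_map (hε : ε < 1) : volume.restrict (C.proj '' C.boundary) ≤
    ((surfaceMeasure Ω).restrict C.boundary).map C.proj := by
  refine Measure.le_iff.2 fun B hB => ?_
  have hp : Measurable C.proj := C.lipschitz_proj.continuous.measurable
  rw [Measure.restrict_apply hB, Measure.map_apply hp hB, Measure.restrict_apply (hp hB),
    surfaceMeasure, Measure.restrict_apply' isClosed_frontier.measurableSet]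
  refine le_trans (measure_mono ?_) (C.volume_image_proj_le _)
  rintro _ ⟨hB', x, hx, rfl⟩
  exact ⟨x, ⟨⟨hB', hx⟩, C.boundary_subset_frontier hε hx⟩, rfl⟩

/-- Integrals over the base of the chart of functions read off at the boundary are bounded by
surface integrals. -/
lemma lintegral_iSup_boundary_le (hε : ε < 1) (g : Space (m + 1) → ℝ≥0∞) :
    ∫⁻ y, ⨆ x ∈ C.boundary ∩ C.proj ⁻¹' {y}, g x ≤ ∫⁻ x, g x ∂(surfaceMeasure Ω) := by
  set H : Space m → ℝ≥0∞ := fun y => ⨆ x ∈ C.boundary ∩ C.proj ⁻¹' {y}, g x with hH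
  have hind : H = (C.proj '' C.boundary).indicator H := by
    ext y
    by_cases hy : y ∈ C.proj '' C.boundary
    · rw [indicator_of_mem hy]
    · rw [indicator_of_notMem hy, hH]
      simp only [mem_inter_iff, mem_preimage, mem_singleton_iff, ENNReal.iSup_eq_zero, and_imp]
      exact fun x hx hxy => absurd ⟨x, hx, hxy⟩ hy
  -- No measurability of `g` is assumed, so the links are inequalities valid for arbitrary
  -- functions. The supremum is over at most one point, by injectivity of the projection on the
  -- boundary piece, and is `0` off the base.
  calc ∫⁻ y, H y = ∫⁻ y, (C.proj '' C.boundary).indicator H y := by rw [← hind]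
    _ ≤ ∫⁻ y in C.proj '' C.boundary, H y := lintegral_indicator_le _ _
    _ ≤ ∫⁻ y, H y ∂(((surfaceMeasure Ω).restrict C.boundary).map C.proj) :=
        lintegral_mono' (C.volume_restrict_le_map hε) le_rfl
    _ ≤ ∫⁻ x in C.boundary, H (C.proj x) ∂(surfaceMeasure Ω) := lintegral_map_le _ _
    _ ≤ ∫⁻ x in C.boundary, g x ∂(surfaceMeasure Ω) := by
        refine setLIntegral_mono' C.measurableSet_boundary fun x hx => ?_
        refine iSup₂_le fun x' hx' => ?_
        rw [C.injOn_proj_boundary hε hx'.1 hx hx'.2]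
    _ ≤ ∫⁻ x, g x ∂(surfaceMeasure Ω) := setLIntegral_le_lintegral _ _

lemma volume_slice_layer_le (hε : ε < 1) (h : ℝ) (y : Space m) :
    volume {s | C.pt s y ∈ C.layer h} ≤ ENNReal.ofReal (h / (1 - ε)) := by
  refine (Real.volume_le_diam _).trans (Metric.ediam_le fun s hs t ht => ?_)
  rw [edist_dist]
  apply ENNReal.ofReal_le_ofReal
  rw [le_div_iff₀ (by linarith), mul_comm]
  have key : ∀ {s t : ℝ}, C.pt s y ∈ C.layer h → C.pt t y ∈ C.layer h → s ≤ t →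
      (1 - ε) * dist s t ≤ h := by
    intro s t hs ht hst
    have h1 := (C.slice_bounds hst hs.1 ht.1).1
    rw [Real.dist_eq, abs_sub_comm, abs_of_nonneg (by linarith)]
    linarith [hs.2.2, ht.2.1]
  rcases le_total s t with hst | hst
  · exact key hs ht hst
  · rw [dist_comm]; exact key ht hs hst

lemma layer_mono {h h' : ℝ} (hh : h ≤ h') : C.layer h ⊆ C.layer h' :=
  fun _ hx => ⟨hx.1, by linarith [hx.2.1], hx.2.2⟩

/-- The mass that `θ` puts on a vertical line in `E` within depth `1 / (k + 1)`, per depth. -/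
def lineMass (E : Set (Space (m + 1))) (θ : Space (m + 1) → ℝ) (k : ℕ) (y : Space m) : ℝ≥0∞ :=
  ENNReal.ofReal (k + 1) * ∫⁻ s, (E ∩ C.layer (1 / ((k : ℝ) + 1))).indicator
    (fun x => ENNReal.ofReal (θ x)) (C.pt s y)

variable {θ : Space (m + 1) → ℝ}

/-- The layer meets the line in length at most `1/((k+1)(1-ε))`, which the factor `k + 1`
compensates. -/
lemma lineMass_le (hε : ε < 1) {k : ℕ} {y : Space m} {M : ℝ}
    (hM : ∀ s, C.pt s y ∈ E ∩ C.layer (1 / ((k : ℝ) + 1)) → θ (C.pt s y) ≤ M) :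
    C.lineMass E θ k y ≤ ENNReal.ofReal (1 / (1 - ε)) * ENNReal.ofReal M := by
  have h1 : ∫⁻ s, (E ∩ C.layer (1 / ((k : ℝ) + 1))).indicator
      (fun x => ENNReal.ofReal (θ x)) (C.pt s y) ≤
      ∫⁻ s, {s | C.pt s y ∈ C.layer (1 / ((k : ℝ) + 1))}.indicator
        (fun _ => ENNReal.ofReal M) s := by
    refine lintegral_mono fun s => ?_
    by_cases hs : C.pt s y ∈ E ∩ C.layer (1 / ((k : ℝ) + 1))
    · rw [indicator_of_mem hs, indicator_of_mem (by exact hs.2)]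
      exact ENNReal.ofReal_le_ofReal (hM s hs)
    · rw [indicator_of_notMem hs]
      exact zero_le
  have hS : MeasurableSet {s | C.pt s y ∈ C.layer (1 / ((k : ℝ) + 1))} :=
    (C.measurableSet_layer _).preimage (C.measurable_pt_left y)
  rw [lintegral_indicator_const hS] at h1
  calc C.lineMass E θ k y ≤ ENNReal.ofReal (k + 1) * (ENNReal.ofReal M *
        ENNReal.ofReal (1 / ((k : ℝ) + 1) / (1 - ε))) := by
        refine mul_le_mul_right (h1.trans ?_) _
        gcongr
        exact C.volume_slice_layer_le hε _ y
    _ = ENNReal.ofReal ((k + 1) * (1 / ((k : ℝ) + 1) / (1 - ε))) * ENNReal.ofReal M := by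
        rw [ENNReal.ofReal_mul (by positivity)]
        ring
    _ = ENNReal.ofReal (1 / (1 - ε)) * ENNReal.ofReal M := by
        congr 2
        field_simp

/-- If the line meets `∂Ω` in the chart and is full, its boundary point counts in `boundaryPart`,
and continuity of `θ` there bounds the mass. If it is empty, the mass is eventually zero. If it
misses `∂Ω` in the chart, `|ρ|` is bounded below on the part of the line in the support of `θ`,
which thin layers therefore avoid. -/
lemma limsup_lineMass_le (hε : ε ≤ 1 / 4) (hθ : Continuous θ)
    (hθc : HasCompactSupport θ) (hθU : tsupport θ ⊆ C.nbhd) {y : Space m}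
    (hline : ∀ s₀, C.pt s₀ y ∈ C.nbhd → C.ρ (C.pt s₀ y) = 0 → ∃ n : ℕ,
      y ∈ C.fullLines E (1 / ((n : ℝ) + 1)) ∨ y ∈ C.emptyLines E (1 / ((n : ℝ) + 1)))
    (hfull : ∀ n : ℕ, y ∈ C.fullLines E (1 / ((n : ℝ) + 1)) → ∀ s₀, C.pt s₀ y ∈ C.nbhd →
      C.ρ (C.pt s₀ y) = 0 → C.pt s₀ y ∈ boundaryPart E Ω) :
    limsup (fun k => C.lineMass E θ k y) atTop ≤ ENNReal.ofReal (1 / (1 - ε)) *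
      ⨆ x ∈ C.boundary ∩ C.proj ⁻¹' {y},
        (boundaryPart E Ω).indicator (fun x => ENNReal.ofReal (θ x)) x := by
  have hcont : Continuous fun s => C.pt s y :=
    C.continuous_pt.comp (by fun_prop : Continuous fun t : ℝ => (t, y))
  by_cases hs : ∃ s₀, C.pt s₀ y ∈ C.nbhd ∧ C.ρ (C.pt s₀ y) = 0
  · obtain ⟨s₀, hs₀, h0⟩ := hs
    obtain ⟨n, hn | hn⟩ := hline s₀ hs₀ h0
    · have hmem := hfull n hn s₀ hs₀ h0
      have hsup : ENNReal.ofReal (θ (C.pt s₀ y)) ≤ ⨆ x ∈ C.boundary ∩ C.proj ⁻¹' {y},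
          (boundaryPart E Ω).indicator (fun x => ENNReal.ofReal (θ x)) x := by
        refine le_iSup₂_of_le (C.pt s₀ y) ⟨⟨hs₀, h0⟩, by simp⟩ ?_
        rw [indicator_of_mem hmem]
      refine le_trans ?_ (mul_le_mul_right hsup _)
      have hη : ∀ η > 0, limsup (fun k => C.lineMass E θ k y) atTop ≤
          ENNReal.ofReal (1 / (1 - ε)) * ENNReal.ofReal (θ (C.pt s₀ y) + η) := by
        intro η hη
        obtain ⟨d, hd, hball⟩ := Metric.eventually_nhds_iff.1
          (((hθ.comp hcont).tendsto s₀).eventually_lt_const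
            (show θ (C.pt s₀ y) < θ (C.pt s₀ y) + η by linarith))
        refine limsup_le_of_le (by isBoundedDefault) ?_
        have hτ := (tendsto_one_div_add_atTop_nhds_zero_nat (𝕜 := ℝ)).eventually_lt_const
          (show (0 : ℝ) < (1 - ε) * d from mul_pos (by linarith) hd)
        filter_upwards [hτ] with k hk
        refine C.lineMass_le (by linarith) fun s hs => ?_
        obtain ⟨h1, h2⟩ := C.mem_layer_bounds (by linarith) hs₀ h0 hs.2
        refine (hball ?_).le
        rw [Real.dist_eq, abs_of_pos (by linarith)]
        exact lt_of_mul_lt_mul_left (h2.trans hk) (by linarith)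
      have hlim : Tendsto (fun η => ENNReal.ofReal (1 / (1 - ε)) *
          ENNReal.ofReal (θ (C.pt s₀ y) + η)) (𝓝[>] 0)
          (𝓝 (ENNReal.ofReal (1 / (1 - ε)) * ENNReal.ofReal (θ (C.pt s₀ y) + 0))) := by
        refine Tendsto.mono_left ?_ nhdsWithin_le_nhds
        refine ENNReal.Tendsto.const_mul ?_ (Or.inr ENNReal.ofReal_ne_top)
        exact (ENNReal.continuous_ofReal.comp (continuous_const.add continuous_id)).tendsto 0
      rw [add_zero] at hlim
      refine ge_of_tendsto hlim ?_
      filter_upwards [self_mem_nhdsWithin] with η h using hη η h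
    · refine (limsup_le_of_le (by isBoundedDefault) ?_).trans zero_le
      filter_upwards [eventually_ge_atTop n] with k hk
      have hkn : 1 / ((k : ℝ) + 1) ≤ 1 / ((n : ℝ) + 1) := by
        gcongr
      rw [lineMass]
      refine (mul_eq_zero_of_right _ (lintegral_eq_zero_of_ae_eq_zero ?_)).le
      have hnull : volume {s | C.pt s y ∈ C.layer (1 / ((n : ℝ) + 1)) ∩ E} = 0 := hn
      filter_upwards [measure_eq_zero_iff_ae_notMem.1 hnull] with s hs
      refine indicator_of_notMem (fun h => hs ⟨C.layer_mono hkn h.2, h.1⟩) _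
  · push Not at hs
    refine (limsup_le_of_le (by isBoundedDefault) ?_).trans zero_le
    have hcpt : IsCompact (C.proj ⁻¹' {y} ∩ tsupport θ) :=
      hθc.inter_left ((isClosed_singleton).preimage C.lipschitz_proj.continuous)
    obtain ⟨c, hc, hcle⟩ : ∃ c > 0, ∀ x ∈ C.proj ⁻¹' {y} ∩ tsupport θ, c ≤ |C.ρ x| := by
      rcases (C.proj ⁻¹' {y} ∩ tsupport θ).eq_empty_or_nonempty with he | hne
      · exact ⟨1, one_pos, by simp [he]⟩
      · obtain ⟨x, hx, hmin⟩ := hcpt.exists_isMinOn hne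
          ((C.continuousOn.mono (inter_subset_right.trans hθU)).abs)
        refine ⟨|C.ρ x|, abs_pos.2 ?_, fun z hz => hmin hz⟩
        have h1 : C.pt (C.height x) y = x := by
          have : C.proj x = y := hx.1
          rw [← this, C.pt_height_proj]
        have := hs (C.height x)
        rw [h1] at this
        exact this (hθU hx.2)
    filter_upwards [(tendsto_one_div_add_atTop_nhds_zero_nat (𝕜 := ℝ)).eventually_lt_const hc]
      with k hk
    rw [lineMass]
    refine (mul_eq_zero_of_right _ ?_).le
    refine (lintegral_congr fun s => ?_).trans lintegral_zero
    by_cases h : C.pt s y ∈ E ∩ C.layer (1 / ((k : ℝ) + 1))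
    · rw [indicator_of_mem h]
      have hnot : C.pt s y ∉ tsupport θ := fun ht => by
        have h1 := hcle _ ⟨by simp, ht⟩
        have h2 := h.2.2
        rw [abs_of_neg h2.2] at h1
        linarith [h2.1]
      simp [image_eq_zero_of_notMem_tsupport hnot]
    · rw [indicator_of_notMem h]

/-- Reverse Fatou over the base, with a constant on the compact projection of the support of `θ` as
dominating function, reduces the claim to single lines. The result takes the place of a trace
theorem for `χ_E`. -/
lemma limsup_lintegral_layer_le (hε : ε ≤ 1 / 4) (hΩ : IsOpen Ω) (hΩb : Bornology.IsBounded Ω)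
    (hE : MeasurableSet E) (hEΩ : E ⊆ Ω) (hP : perimeter E Ω ≠ ⊤)
    (hθ : Continuous θ)
    (hθc : HasCompactSupport θ) (hθU : tsupport θ ⊆ C.nbhd) :
    limsup (fun k : ℕ => ENNReal.ofReal (k + 1) *
      ∫⁻ x, (E ∩ C.layer (1 / ((k : ℝ) + 1))).indicator (fun x => ENNReal.ofReal (θ x)) x) atTop ≤
      ENNReal.ofReal (1 / (1 - ε)) * ∫⁻ x, (boundaryPart E Ω).indicator
        (fun x => ENNReal.ofReal (θ x)) x ∂(surfaceMeasure Ω) := by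
  have hm : ∀ k : ℕ, Measurable ((E ∩ C.layer (1 / ((k : ℝ) + 1))).indicator
      (fun x => ENNReal.ofReal (θ x))) := fun k =>
    hθ.measurable.ennreal_ofReal.indicator (hE.inter (C.measurableSet_layer _))
  have hmass : ∀ k, Measurable (C.lineMass E θ k) := fun k =>
    (Measurable.lintegral_prod_left' ((hm k).comp C.continuous_pt.measurable)).const_mul _
  have heq : ∀ k : ℕ, ENNReal.ofReal (k + 1) * ∫⁻ x, (E ∩ C.layer (1 / ((k : ℝ) + 1))).indicator
      (fun x => ENNReal.ofReal (θ x)) x = ∫⁻ y, C.lineMass E θ k y := fun k => by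
    rw [C.lintegral_eq (hm k), ← lintegral_const_mul' _ _ ENNReal.ofReal_ne_top]
    rfl
  simp only [heq]
  obtain ⟨M, hM⟩ := hθc.exists_bound_of_continuous hθ
  have hMθ : ∀ x, θ x ≤ M := fun x => (le_abs_self _).trans (hM x)
  have hcpt : IsCompact (C.proj '' tsupport θ) := hθc.isCompact.image C.lipschitz_proj.continuous
  refine (limsup_lintegral_le ((C.proj '' tsupport θ).indicator fun _ =>
    ENNReal.ofReal (1 / (1 - ε)) * ENNReal.ofReal M) hmass (fun k => ?_) ?_).trans ?_
  · refine Eventually.of_forall fun y => ?_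
    by_cases hy : y ∈ C.proj '' tsupport θ
    · simp only [indicator_of_mem hy]
      exact C.lineMass_le (by linarith) fun s _ => hMθ _
    · simp only [indicator_of_notMem hy]
      rw [lineMass]
      refine (mul_eq_zero_of_right _ ?_).le
      refine (lintegral_congr fun s => ?_).trans lintegral_zero
      have : θ (C.pt s y) = 0 := image_eq_zero_of_notMem_tsupport fun h => hy ⟨_, h, by simp⟩
      simp [indicator, this]
  · rw [lintegral_indicator_const hcpt.measurableSet]
    have := hcpt.measure_lt_top (μ := volume)
    finiteness
  · refine le_trans (lintegral_mono_ae ?_)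
      ((lintegral_const_mul' _ _ ENNReal.ofReal_ne_top).le.trans
      (mul_le_mul_right (C.lintegral_iSup_boundary_le (by linarith) _) _))
    filter_upwards [C.ae_mem_fullLines_or_emptyLines (by linarith) hΩ hΩb hE hEΩ hP,
      C.ae_pt_mem_boundaryPart hε hΩ hE] with y h1 h2
    exact C.limsup_lineMass_le hε hθ hθc hθU h1 h2

end FlatChart

end

/-! ### The cut-off inside one chart -/

section

namespace FlatChart

variable {m : ℕ} {Ω : Set (Space (m + 1))} {ε : ℝ} (C : FlatChart Ω ε) {E : Set (Space (m + 1))}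
  {θ : Space (m + 1) → ℝ}

/-- A function `θ` supported in the chart is cut off near `∂Ω` at a cost of total variation, on
`E`, of about the integral of `θ` over the part of `∂Ω` that belongs to `E`. -/
lemma exists_boundary_cutoff (hε0 : 0 < ε) (hε : ε ≤ 1 / 4) (hΩ : IsOpen Ω)
    (hΩb : Bornology.IsBounded Ω)
    (hE : MeasurableSet E) (hEΩ : E ⊆ Ω) (hP : perimeter E Ω ≠ ⊤)
    (hθ : ContDiff ℝ 1 θ) (hθ0 : ∀ x, 0 ≤ θ x)
    (hθc : HasCompactSupport θ) (hθU : tsupport θ ⊆ C.nbhd)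
    (hB : ∫⁻ x, (boundaryPart E Ω).indicator
        (fun x => ENNReal.ofReal (θ x)) x ∂(surfaceMeasure Ω) ≠ ⊤) {κ : ℝ} (hκ : 0 < κ) :
    ∃ ψ : Space (m + 1) → ℝ, ContDiff ℝ 1 ψ ∧ HasCompactSupport ψ ∧ tsupport ψ ⊆ Ω ∧
      (∀ x, 0 ≤ ψ x ∧ ψ x ≤ θ x) ∧
      ∫⁻ x in E, ENNReal.ofReal (θ x - ψ x) ≤ ENNReal.ofReal κ ∧
      ∫⁻ x in E, ‖fderiv ℝ θ x - fderiv ℝ ψ x‖ₑ ≤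
        ENNReal.ofReal ((1 + ε) ^ 2 / (1 - ε)) * (∫⁻ x, (boundaryPart E Ω).indicator
          (fun x => ENNReal.ofReal (θ x)) x ∂(surfaceMeasure Ω)) + ENNReal.ofReal κ := by
  obtain ⟨f, hf, hf01, ⟨b, hb, hfb⟩, hf1, hfd, hfd0⟩ := exists_step hε0
  have hk0 : ∀ k : ℕ, (0 : ℝ) < k + 1 := fun k => by positivity
  -- Inside the chart, `η k` vanishes up to depth `b/(k+1)`, which gives compact support in `Ω`
  -- after multiplication by `θ`. It is `1` from depth `1/(k+1)` on, so its gradient lives in the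
  -- layer.
  set η : ℕ → Space (m + 1) → ℝ := fun k x => f ((k + 1) * -C.ρ x) with hη
  have hη01 : ∀ k x, 0 ≤ η k x ∧ η k x ≤ 1 := fun k x => hf01 _
  set ψ : ℕ → Space (m + 1) → ℝ := fun k x => θ x * η k x with hψ
  have hηat : ∀ k, ∀ x ∈ C.nbhd, ContDiffAt ℝ 1 (η k) x := fun k x hx =>
    hf.contDiffAt.comp x (contDiffAt_const.mul
      (C.contDiffOn.contDiffAt (C.isOpen_nbhd.mem_nhds hx)).neg)
  have hψs : ∀ k, Function.support (ψ k) ⊆ Function.support θ := fun k =>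
    Function.support_mul_subset_left θ (η k)
  have hψC : ∀ k, ContDiff ℝ 1 (ψ k) := fun k => by
    rw [contDiff_iff_contDiffAt]
    intro x
    by_cases hx : x ∈ C.nbhd
    · exact hθ.contDiffAt.mul (hηat k x hx)
    · have hx' : x ∉ tsupport (ψ k) := fun h => hx (hθU (closure_mono (hψs k) h))
      exact contDiffAt_const.congr_of_eventuallyEq (notMem_tsupport_iff_eventuallyEq.1 hx')
  have hψΩ : ∀ k, tsupport (ψ k) ⊆ Ω := fun k => by
    have hcl : IsClosed (tsupport θ ∩ C.ρ ⁻¹' Iic (-(b / (k + 1)))) :=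
      (C.continuousOn.mono hθU).preimage_isClosed_of_isClosed isClosed_closure isClosed_Iic
    have hsub : tsupport (ψ k) ⊆ tsupport θ ∩ C.ρ ⁻¹' Iic (-(b / (k + 1))) := by
      refine closure_minimal (fun x hx => ⟨subset_closure (hψs k hx), ?_⟩) hcl
      by_contra h
      apply hx
      simp only [mem_preimage, mem_Iic, not_le] at h
      rw [hψ]
      simp only [hη]
      rw [hfb, mul_zero]
      have h2 : -C.ρ x ≤ b / (k + 1) := by linarith
      rw [le_div_iff₀ (hk0 k)] at h2
      linarith
    intro x hx
    obtain ⟨h1, h2⟩ := hsub hx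
    rw [C.mem_iff (hθU h1)]
    have h3 : C.ρ x ≤ -(b / (k + 1)) := h2
    have : 0 < b / (k + 1) := div_pos hb (hk0 k)
    linarith
  set θ' := fderiv ℝ θ with hθ'
  have hθ'c : Continuous θ' := hθ.continuous_fderiv one_ne_zero
  -- Nothing is known of `ρ` outside the chart, so `1 - η k` is only used after restriction to it.
  -- There is no loss, as `θ` vanishes elsewhere.
  have hηmeas : ∀ k, Measurable fun x => C.nbhd.indicator (fun x => 1 - η k x) x := fun k => by
    refine measurable_of_isOpen fun s hs => ?_
    have hc : ContinuousOn (fun x => 1 - η k x) C.nbhd := fun x hx =>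
      (continuousAt_const.sub (hηat k x hx).continuousAt).continuousWithinAt
    by_cases h0 : (0 : ℝ) ∈ s
    · have : (fun x => C.nbhd.indicator (fun x => 1 - η k x) x) ⁻¹' s =
          (C.nbhd ∩ (fun x => 1 - η k x) ⁻¹' s) ∪ C.nbhdᶜ := by
        ext x
        by_cases hx : x ∈ C.nbhd <;> simp [hx, h0]
      rw [this]
      exact (hc.isOpen_inter_preimage C.isOpen_nbhd hs).measurableSet.union
        C.isOpen_nbhd.measurableSet.compl
    · have : (fun x => C.nbhd.indicator (fun x => 1 - η k x) x) ⁻¹' s =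
          (C.nbhd ∩ (fun x => 1 - η k x) ⁻¹' s) := by
        ext x
        by_cases hx : x ∈ C.nbhd <;> simp [hx, h0]
      rw [this]
      exact (hc.isOpen_inter_preimage C.isOpen_nbhd hs).measurableSet
  -- the cut-offs tend to one inside `Ω`
  have hηlim : ∀ x ∈ E, ∀ᶠ k in atTop, C.nbhd.indicator (fun x => 1 - η k x) x = 0 := by
    intro x hxE
    by_cases hx : x ∈ C.nbhd
    · have hρ : C.ρ x < 0 := (C.mem_iff hx).1 (hEΩ hxE)
      obtain ⟨n, hn⟩ := exists_nat_gt (1 / -C.ρ x)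
      filter_upwards [eventually_ge_atTop n] with k hkn
      rw [indicator_of_mem hx]
      simp only [hη]
      rw [hf1, sub_self]
      rw [div_lt_iff₀ (by linarith)] at hn
      have : (n : ℝ) ≤ k := by exact_mod_cast hkn
      nlinarith
    · exact Eventually.of_forall fun k => indicator_of_notMem hx _
  have hI01 : ∀ k x, 0 ≤ C.nbhd.indicator (fun x => 1 - η k x) x ∧
      C.nbhd.indicator (fun x => 1 - η k x) x ≤ 1 := fun k x => by
    by_cases hx : x ∈ C.nbhd
    · simp only [indicator_of_mem hx]
      have := hη01 k x
      constructor <;> linarith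
    · simp [indicator_of_notMem hx]
  have hdiff : ∀ k x, θ x - ψ k x = C.nbhd.indicator (fun x => 1 - η k x) x * θ x := fun k x => by
    by_cases hx : x ∈ C.nbhd
    · rw [indicator_of_mem hx]
      simp only [hψ]
      ring
    · have : θ x = 0 := image_eq_zero_of_notMem_tsupport fun h => hx (hθU h)
      simp [hψ, this]
  -- pointwise bound of the gradient
  have hgrad : ∀ k x, x ∈ E → ‖θ' x - fderiv ℝ (ψ k) x‖ₑ ≤
      ‖C.nbhd.indicator (fun x => 1 - η k x) x • θ' x‖ₑ + ENNReal.ofReal ((1 + ε) ^ 2) *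
        (ENNReal.ofReal (k + 1) * (E ∩ C.layer (1 / ((k : ℝ) + 1))).indicator
          (fun x => ENNReal.ofReal (θ x)) x) := by
    intro k x hxE
    by_cases hx : x ∈ C.nbhd
    · have hηd : HasFDerivAt (η k)
          (deriv f ((k + 1) * -C.ρ x) • (((k : ℝ) + 1) • -fderiv ℝ C.ρ x)) x :=
        ((hf.differentiable one_ne_zero _).hasDerivAt).comp_hasFDerivAt x
          (((C.differentiableAt hx).hasFDerivAt.neg).const_mul _)
      have hψd := ((hθ.differentiable one_ne_zero x).hasFDerivAt).mul hηd
      have e1 : θ' x - fderiv ℝ (ψ k) x = C.nbhd.indicator (fun x => 1 - η k x) x • θ' x -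
          θ x • (deriv f ((k + 1) * -C.ρ x) • (((k : ℝ) + 1) • -fderiv ℝ C.ρ x)) := by
        have h2 : fderiv ℝ (ψ k) x = _ := hψd.fderiv
        rw [h2, indicator_of_mem hx]
        module
      rw [e1]
      refine enorm_sub_le.trans (add_le_add le_rfl ?_)
      by_cases hl : x ∈ C.layer (1 / ((k : ℝ) + 1))
      · rw [indicator_of_mem (show x ∈ E ∩ C.layer (1 / ((k : ℝ) + 1)) from ⟨hxE, hl⟩),
          ← ENNReal.ofReal_mul (hk0 k).le,
          ← ENNReal.ofReal_mul (by positivity), ← ofReal_norm]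
        apply ENNReal.ofReal_le_ofReal
        rw [norm_smul, norm_smul, norm_smul, norm_neg, Real.norm_of_nonneg (hθ0 x),
          Real.norm_of_nonneg (hfd _).1, Real.norm_of_nonneg (hk0 k).le]
        calc θ x * (deriv f ((k + 1) * -C.ρ x) * (((k : ℝ) + 1) * ‖fderiv ℝ C.ρ x‖))
            ≤ θ x * ((1 + ε) * (((k : ℝ) + 1) * (1 + ε))) := by
              have h3 := (hfd ((k + 1) * -C.ρ x)).2
              have h4 := C.norm_fderiv_le hx
              have h5 := hθ0 x
              gcongr
          _ = (1 + ε) ^ 2 * ((k + 1) * θ x) := by ring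
      · rw [hfd0]
        · rw [zero_smul, smul_zero, ← ofReal_norm, norm_zero, ENNReal.ofReal_zero]
          exact zero_le
        · contrapose! hl
          refine ⟨hx, ?_, ?_⟩
          · have h3 : C.ρ x * -(k + 1) < 1 := by linarith [hl.2]
            have h4 : -C.ρ x < 1 / (k + 1) := by
              rw [lt_div_iff₀ (hk0 k)]; linarith
            linarith
          · have := pos_of_mul_pos_right hl.1 (hk0 k).le
            linarith
    · have h1 : x ∉ tsupport θ := fun h => hx (hθU h)
      have h2 : x ∉ tsupport (ψ k) := fun h => h1 (closure_mono (hψs k) h)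
      have e1 : θ' x = 0 := by_contra fun h => h1 (support_fderiv_subset ℝ h)
      have e2 : fderiv ℝ (ψ k) x = 0 := by_contra fun h => h2 (support_fderiv_subset ℝ h)
      simp [e1, e2]
  have hθi : Integrable θ := hθ.continuous.integrable_of_hasCompactSupport hθc
  have hθ'i : Integrable θ' := hθ'c.integrable_of_hasCompactSupport (hθc.fderiv (𝕜 := ℝ))
  have hlim1 : Tendsto (fun k => ∫⁻ x in E, ENNReal.ofReal (θ x - ψ k x)) atTop (𝓝 0) := by
    have := tendsto_lintegral_of_dominated_convergence (μ := volume.restrict E)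
      (F := fun k x => ENNReal.ofReal (θ x - ψ k x)) (f := fun _ => 0) (fun x => ‖θ x‖ₑ)
      (fun k => (hθ.continuous.sub (hψC k).continuous).measurable.ennreal_ofReal)
      (fun k => Eventually.of_forall fun x => ?_)
      (hθi.integrableOn.2.ne) ?_
    · simpa using this
    · beta_reduce
      rw [← ofReal_norm]
      refine ENNReal.ofReal_le_ofReal (le_trans ?_ (le_abs_self _))
      simp only [hψ]
      have := mul_nonneg (hθ0 x) (hη01 k x).1
      linarith
    · filter_upwards [ae_restrict_mem hE] with x hx
      refine tendsto_const_nhds.congr' ?_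
      filter_upwards [hηlim x hx] with k hk
      rw [hdiff, hk]
      simp
  have hlim2 : Tendsto (fun k => ∫⁻ x in E, ‖C.nbhd.indicator (fun x => 1 - η k x) x • θ' x‖ₑ)
      atTop (𝓝 0) := by
    have := tendsto_lintegral_of_dominated_convergence (μ := volume.restrict E)
      (F := fun k x => ‖C.nbhd.indicator (fun x => 1 - η k x) x • θ' x‖ₑ) (f := fun _ => 0)
      (fun x => ‖θ' x‖ₑ)
      (fun k => ((hηmeas k).smul hθ'c.measurable).enorm)
      (fun k => Eventually.of_forall fun x => ?_)
      (hθ'i.integrableOn.2.ne) ?_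
    · simpa using this
    · beta_reduce
      rw [enorm_smul]
      refine mul_le_of_le_one_left' ?_
      rw [Real.enorm_of_nonneg (hI01 k x).1]
      simpa using (hI01 k x).2
    · filter_upwards [ae_restrict_mem hE] with x hx
      refine tendsto_const_nhds.congr' ?_
      filter_upwards [hηlim x hx] with k hk
      rw [hk, zero_smul, ← ofReal_norm, norm_zero, ENNReal.ofReal_zero]
  set B := ∫⁻ x, (boundaryPart E Ω).indicator
        (fun x => ENNReal.ofReal (θ x)) x ∂(surfaceMeasure Ω) with hBdef
  have hlim3 := C.limsup_lintegral_layer_le hε hΩ hΩb hE hEΩ hP hθ.continuous hθc hθU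
  rw [← hBdef] at hlim3
  -- One factor `1 + ε` comes from the slope of `f` and one from `|∇ρ|`. They multiply the error in
  -- the limsup bound, which is shrunk in advance. The other `κ/2` is for the term with `∇θ`.
  set κ' : ℝ := κ / 2 / (1 + ε) ^ 2 with hκ'
  have hκ'0 : 0 < κ' := by positivity
  have hlt : ENNReal.ofReal (1 / (1 - ε)) * B < ENNReal.ofReal (1 / (1 - ε)) * B +
      ENNReal.ofReal κ' :=
    ENNReal.lt_add_right (ENNReal.mul_ne_top ENNReal.ofReal_ne_top hB)
      (ENNReal.ofReal_pos.2 hκ'0).ne'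
  have hev3 := eventually_lt_of_limsup_lt (hlim3.trans_lt hlt)
  have hev1 := hlim1.eventually_lt_const (ENNReal.ofReal_pos.2 hκ)
  have hev2 := hlim2.eventually_lt_const (ENNReal.ofReal_pos.2 (half_pos hκ))
  obtain ⟨k, h1, h2, h3⟩ := (hev1.and (hev2.and hev3)).exists
  refine ⟨ψ k, hψC k, hθc.mono (hψs k), hψΩ k, fun x => ⟨mul_nonneg (hθ0 x) (hη01 k x).1,
    mul_le_of_le_one_right (hθ0 x) (hη01 k x).2⟩, h1.le, ?_⟩
  have hmi : Measurable ((E ∩ C.layer (1 / ((k : ℝ) + 1))).indicator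
      (fun x => ENNReal.ofReal (θ x))) :=
    hθ.continuous.measurable.ennreal_ofReal.indicator (hE.inter (C.measurableSet_layer _))
  have hm1 : Measurable fun x => ‖C.nbhd.indicator (fun x => 1 - η k x) x • θ' x‖ₑ :=
    ((hηmeas k).smul hθ'c.measurable).enorm
  calc ∫⁻ x in E, ‖θ' x - fderiv ℝ (ψ k) x‖ₑ
      ≤ ∫⁻ x in E, (‖C.nbhd.indicator (fun x => 1 - η k x) x • θ' x‖ₑ +
        ENNReal.ofReal ((1 + ε) ^ 2) *
        (ENNReal.ofReal (k + 1) * (E ∩ C.layer (1 / ((k : ℝ) + 1))).indicator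
          (fun x => ENNReal.ofReal (θ x)) x)) := setLIntegral_mono' hE fun x hx => hgrad k x hx
    _ = (∫⁻ x in E, ‖C.nbhd.indicator (fun x => 1 - η k x) x • θ' x‖ₑ) +
        ENNReal.ofReal ((1 + ε) ^ 2) * (ENNReal.ofReal (k + 1) *
          ∫⁻ x in E, (E ∩ C.layer (1 / ((k : ℝ) + 1))).indicator
          (fun x => ENNReal.ofReal (θ x)) x) := by
        rw [lintegral_add_left hm1,
          lintegral_const_mul' _ _ ENNReal.ofReal_ne_top,
          lintegral_const_mul' _ _ ENNReal.ofReal_ne_top]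
    _ ≤ ENNReal.ofReal (κ / 2) + ENNReal.ofReal ((1 + ε) ^ 2) *
        (ENNReal.ofReal (1 / (1 - ε)) * B + ENNReal.ofReal κ') := by
        refine add_le_add h2.le (mul_le_mul_right (le_trans ?_ h3.le) _)
        exact mul_le_mul_right (setLIntegral_le_lintegral _ _) _
    _ = ENNReal.ofReal ((1 + ε) ^ 2 / (1 - ε)) * B + ENNReal.ofReal κ := by
        rw [mul_add, ← mul_assoc, ← ENNReal.ofReal_mul (by positivity),
          ← ENNReal.ofReal_mul (by positivity), hκ', mul_div_cancel₀ _ (by positivity),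
          mul_one_div, add_left_comm, ← ENNReal.ofReal_add (by positivity) (by positivity),
          add_halves]

end FlatChart

end

/-! ### The global cut-off -/

section

open scoped Manifold

variable {m : ℕ} {Ω E : Set (Space (m + 1))}

/-- The lower integral is superadditive without measurability, which is not established for
indicators of `boundaryPart`. -/
lemma sum_lintegral_le_lintegral_sum {α ι : Type*} [MeasurableSpace α] (μ : Measure α)
    (s : Finset ι) (f : ι → α → ℝ≥0∞) :
    ∑ i ∈ s, ∫⁻ x, f i x ∂μ ≤ ∫⁻ x, ∑ i ∈ s, f i x ∂μ := by
  classical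
  induction s using Finset.induction_on with
  | empty => simp
  | insert a s ha ih =>
    simp only [Finset.sum_insert ha]
    exact (add_le_add le_rfl ih).trans (le_lintegral_add _ _)

lemma exists_ofReal_mul_le {B : ℝ≥0∞} (hB : B ≠ ⊤) {κ : ℝ} (hκ : 0 < κ) :
    ∃ ε : ℝ, 0 < ε ∧ ε ≤ 1 / 4 ∧
      ENNReal.ofReal ((1 + ε) ^ 2 / (1 - ε)) * B ≤ B + ENNReal.ofReal κ := by
  have hb : 0 < 6 * (B.toReal + 1) := by positivity
  -- For `ε ≤ 1/4` the factor is at most `1 + 6ε`, and the second bound makes `6ε B ≤ κ`.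
  set ε := min (1 / 4) (κ / (6 * (B.toReal + 1))) with hε
  have h0 : 0 < ε := lt_min (by norm_num) (div_pos hκ hb)
  have h4 : ε ≤ 1 / 4 := min_le_left _ _
  have h1 : ε * (6 * (B.toReal + 1)) ≤ κ := (le_div_iff₀ hb).1 (min_le_right _ _)
  refine ⟨ε, h0, h4, ?_⟩
  have h2 : (1 + ε) ^ 2 / (1 - ε) ≤ 1 + 6 * ε := by
    rw [div_le_iff₀ (by linarith)]
    nlinarith
  nth_rewrite 1 2 [← ENNReal.ofReal_toReal hB]
  rw [← ENNReal.ofReal_mul (by apply div_nonneg <;> [positivity; linarith]),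
    ← ENNReal.ofReal_add ENNReal.toReal_nonneg hκ.le]
  apply ENNReal.ofReal_le_ofReal
  have h3 : 0 ≤ B.toReal := ENNReal.toReal_nonneg
  calc (1 + ε) ^ 2 / (1 - ε) * B.toReal ≤ (1 + 6 * ε) * B.toReal := by gcongr
    _ ≤ B.toReal + κ := by nlinarith

lemma HasPiecewiseC1Boundary.exists_compact_null (h : HasPiecewiseC1Boundary Ω)
    (hΩb : Bornology.IsBounded Ω) :
    ∃ S, IsCompact S ∧ μH[m] S = 0 ∧ ∀ x ∈ frontier Ω \ S, IsC1BoundaryPoint Ω x := by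
  obtain ⟨S, hSc, hSf, hS0, hS⟩ := h
  refine ⟨S, Metric.isCompact_of_isClosed_isBounded hSc
    (hΩb.closure.subset (hSf.trans frontier_subset_closure)), ?_, hS⟩
  rw [surfaceMeasure, Measure.restrict_eq_self _ hSf, Nat.add_sub_cancel,
    Measure.euclideanHausdorffMeasure_def] at hS0
  have h1 := Measure.addHaarScalarFactor_volume_hausdorffMeasure_ne_zero m
  rw [Measure.smul_apply, ENNReal.smul_def, smul_eq_mul, mul_eq_zero] at hS0
  exact hS0.resolve_left fun h => h1 (by exact_mod_cast h)

/-- `1` is, on `Ω`, a sum of a function supported away from the regular part of the boundary and of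
functions supported in flat charts. -/
lemma exists_chart_partition (hΩb : Bornology.IsBounded Ω) (hΩ : IsOpen Ω)
    {S : Set (Space (m + 1))}
    (hS : ∀ x ∈ frontier Ω \ S, IsC1BoundaryPoint Ω x) {O : Set (Space (m + 1))} (hO : IsOpen O)
    (hSO : S ⊆ O) {ε : ℝ} (hε : 0 < ε) :
    ∃ (ι : Type) (_ : Fintype ι) (C : ι → FlatChart Ω ε) (θ₀ : Space (m + 1) → ℝ)
      (θ : ι → Space (m + 1) → ℝ), ContDiff ℝ 1 θ₀ ∧ tsupport θ₀ ⊆ Ω ∪ O ∧ (∀ x, 0 ≤ θ₀ x) ∧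
      (∀ i, ContDiff ℝ 1 (θ i) ∧ (∀ x, 0 ≤ θ i x) ∧ HasCompactSupport (θ i) ∧
        tsupport (θ i) ⊆ (C i).nbhd) ∧ (∀ x, ∑ i, θ i x ≤ 1) ∧
      ∀ x ∈ Ω, θ₀ x + ∑ i, θ i x = 1 := by
  have hFc : IsCompact (frontier Ω) := Metric.isCompact_of_isClosed_isBounded isClosed_frontier
    (hΩb.closure.subset frontier_subset_closure)
  have hK : IsCompact (frontier Ω \ O) := hFc.inter_right hO.isClosed_compl
  have hex : ∀ x ∈ frontier Ω \ O, ∃ C : FlatChart Ω ε, C.center = x := fun x hx =>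
    (hS x ⟨hx.1, fun h => hx.2 (hSO h)⟩).exists_flatChart hε
  choose C hC using hex
  obtain ⟨t, ht⟩ := hK.elim_nhds_subcover' (fun x hx => (C x hx).nbhd) fun x hx => by
    have := (C x hx).isOpen_nbhd.mem_nhds (C x hx).center_mem_nbhd
    rwa [hC] at this
  -- The index `none` stands for the interior together with the neighbourhood `O` of the singular
  -- set. What remains of the closure of `Ω` is the compact set `frontier Ω \ O`, covered by
  -- finitely many charts.
  set U : Option t → Set (Space (m + 1)) :=
    fun i => i.elim (Ω ∪ O) fun i => (C i.1 i.1.2).nbhd with hU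
  obtain ⟨f, hf⟩ := SmoothPartitionOfUnity.exists_isSubordinate 𝓘(ℝ, Space (m + 1))
    (isClosed_closure (s := Ω)) U
    (fun i => by
      cases i with
      | none => exact hΩ.union hO
      | some i => exact (C i.1 i.1.2).isOpen_nbhd)
    (fun x hx => by
      rw [mem_iUnion]
      by_cases hxO : x ∈ Ω ∪ O
      · exact ⟨none, hxO⟩
      · rw [mem_union, not_or] at hxO
        have hx' : x ∈ frontier Ω \ O := ⟨⟨hx, by rw [hΩ.interior_eq]; exact hxO.1⟩, hxO.2⟩
        obtain ⟨i, hi, hxi⟩ := mem_iUnion₂.1 (ht hx')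
        exact ⟨some ⟨i, hi⟩, hxi⟩)
  have hsmooth : ∀ i, ContDiff ℝ 1 (f i) := fun i =>
    (f i).contMDiff.contDiff.of_le (by exact_mod_cast le_top)
  have hsum : ∀ x, ∑ᶠ i, f i x = f none x + ∑ i, f (some i) x := fun x => by
    rw [finsum_eq_sum_of_fintype, Fintype.sum_option]
  refine ⟨t, inferInstance, fun i => C i.1 i.1.2, f none, fun i => f (some i), hsmooth _,
    hf none, f.nonneg none, fun i => ⟨hsmooth _, f.nonneg _, ?_, hf (some i)⟩, fun x => ?_,
    fun x hx => ?_⟩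
  · exact Metric.isCompact_of_isClosed_isBounded (isClosed_tsupport _)
      (Metric.isBounded_ball.subset (hf (some i)))
  · have := f.sum_le_one x
    rw [hsum] at this
    linarith [f.nonneg none x]
  · rw [← hsum]
    exact f.sum_eq_one (subset_closure hx)

/-- The part of `E` near the boundary is cut off at a cost of about the measure of the part of
`∂Ω` that belongs to `E`. -/
lemma exists_cutoff (hm : m ≠ 0) (hΩ : IsOpen Ω) (hΩb : Bornology.IsBounded Ω)
    (hb : HasPiecewiseC1Boundary Ω) (hE : MeasurableSet E) (hEΩ : E ⊆ Ω) (hP : perimeter E Ω ≠ ⊤)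
    (hB : ∫⁻ x, (boundaryPart E Ω).indicator 1 x ∂(surfaceMeasure Ω) ≠ ⊤) {κ : ℝ} (hκ : 0 < κ) :
    ∃ η : Space (m + 1) → ℝ, ContDiff ℝ 1 η ∧ HasCompactSupport η ∧ tsupport η ⊆ Ω ∧
      (∀ x, 0 ≤ η x ∧ η x ≤ 1) ∧
      ∫⁻ x in E, ENNReal.ofReal (1 - η x) ≤ ENNReal.ofReal κ ∧
      ∫⁻ x in E, ‖fderiv ℝ η x‖ₑ ≤
        (∫⁻ x, (boundaryPart E Ω).indicator 1 x ∂(surfaceMeasure Ω)) + ENNReal.ofReal κ := by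
  obtain ⟨S, hSc, hS0, hS⟩ := hb.exists_compact_null hΩb
  obtain ⟨w, hw, hw01, ⟨O, hO, hSO, hwO⟩, hwd, hw1⟩ :=
    exists_cutoff_of_null hm hSc hS0 (show 0 < κ / 4 by positivity)
  obtain ⟨ε, hε0, hε, hεB⟩ := exists_ofReal_mul_le hB (half_pos hκ)
  set B := ∫⁻ x, (boundaryPart E Ω).indicator 1 x ∂(surfaceMeasure Ω) with hBdef
  obtain ⟨ι, _, C, θ₀, θ, hθ₀, hθ₀s, hθ₀0, hθ, hθ1, hsum⟩ :=
    exists_chart_partition hΩb hΩ hS hO hSO hε0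
  set b : ι → ℝ≥0∞ := fun i => ∫⁻ x, (boundaryPart E Ω).indicator
    (fun x => ENNReal.ofReal (θ i x)) x ∂(surfaceMeasure Ω) with hbdef
  have hbsum : ∑ i, b i ≤ B := by
    refine (sum_lintegral_le_lintegral_sum _ _ _).trans (lintegral_mono fun x => ?_)
    by_cases hx : x ∈ boundaryPart E Ω
    · simp only [indicator_of_mem hx, Pi.one_apply]
      rw [← ENNReal.ofReal_sum_of_nonneg fun i _ => (hθ i).2.1 x, ← ENNReal.ofReal_one]
      exact ENNReal.ofReal_le_ofReal (hθ1 x)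
    · simp [indicator_of_notMem hx]
  have hbi : ∀ i, b i ≠ ⊤ := fun i =>
    ((Finset.single_le_sum (fun _ _ => zero_le) (Finset.mem_univ i)).trans hbsum).trans_lt
      hB.lt_top |>.ne
  -- The budget is `κ/4` for `w`, `κ/4` shared by the charts, and `κ/2` for the factor `(1 + ε)²/(1
  -- - ε)`.
  set κ' : ℝ := κ / 4 / (Fintype.card ι + 1) with hκ'
  have hc0 : (0 : ℝ) < Fintype.card ι + 1 := by positivity
  have hκ'0 : 0 < κ' := by positivity
  have hκsum : (Fintype.card ι : ℝ) * κ' ≤ κ / 4 := by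
    rw [hκ', mul_div_assoc', div_le_iff₀ hc0]
    nlinarith
  choose ψ hψ hψc hψs hψ0 hψ1 hψd using fun i =>
    (C i).exists_boundary_cutoff hε0 hε hΩ hΩb hE hEΩ hP (hθ i).1 (hθ i).2.1 (hθ i).2.2.1
      (hθ i).2.2.2 (hbi i) hκ'0
  -- On `Ω` this equals `w (1 - ∑ (θ i - ψ i))`, so the gradients of the partition enter only
  -- through the small differences estimated chart by chart. The factor `w` vanishes on `O`, where
  -- the support of `θ₀` may leave `Ω`.
  set η : Space (m + 1) → ℝ := fun x => w x * (θ₀ x + ∑ i, ψ i x) with hη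
  have hηC : ContDiff ℝ 1 η := hw.mul (hθ₀.add (ContDiff.sum fun i _ => hψ i))
  have hηeq : ∀ x ∈ Ω, η x = w x * (1 - ∑ i, (θ i x - ψ i x)) := fun x hx => by
    rw [← hsum x hx, Finset.sum_sub_distrib]
    simp only [hη]
    ring
  have hδ0 : ∀ x, 0 ≤ ∑ i, (θ i x - ψ i x) := fun x =>
    Finset.sum_nonneg fun i _ => sub_nonneg.2 (hψ0 i x).2
  have hδ1 : ∀ x, ∑ i, (θ i x - ψ i x) ≤ 1 := fun x =>
    (Finset.sum_le_sum fun i _ => sub_le_self _ (hψ0 i x).1).trans (hθ1 x)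
  -- the support
  set Z : Set (Space (m + 1)) := (tsupport θ₀ ∩ Oᶜ) ∪ ⋃ i, tsupport (ψ i) with hZ
  have hZc : IsClosed Z := ((isClosed_tsupport _).inter hO.isClosed_compl).union
    (isClosed_iUnion_of_finite fun i => isClosed_tsupport _)
  have hZΩ : Z ⊆ Ω := by
    rintro x (⟨hx, hxO⟩ | hx)
    · exact (hθ₀s hx).resolve_right hxO
    · obtain ⟨i, hi⟩ := mem_iUnion.1 hx
      exact hψs i hi
  have hηZ : Function.support η ⊆ Z := fun x hx => by
    by_contra hxZ
    simp only [hZ, mem_union, mem_inter_iff, mem_compl_iff, mem_iUnion, not_or, not_and, not_not,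
      not_exists] at hxZ
    apply hx
    have h1 : ∀ i, ψ i x = 0 := fun i => image_eq_zero_of_notMem_tsupport (hxZ.2 i)
    by_cases h2 : x ∈ tsupport θ₀
    · simp [hη, hwO x (hxZ.1 h2)]
    · simp [hη, h1, image_eq_zero_of_notMem_tsupport h2]
  have hηs : tsupport η ⊆ Z := closure_minimal hηZ hZc
  have hη01 : ∀ x, 0 ≤ η x ∧ η x ≤ 1 := fun x => by
    by_cases hx : x ∈ Ω
    · rw [hηeq x hx]
      have h1 := hw01 x
      have h2 := hδ0 x
      have h3 := hδ1 x
      exact ⟨mul_nonneg h1.1 (by linarith), mul_le_one₀ h1.2 (by linarith) (by linarith)⟩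
    · have : η x = 0 := by_contra fun h => hx (hZΩ (hηZ h))
      simp [this]
  refine ⟨η, hηC, Metric.isCompact_of_isClosed_isBounded (isClosed_tsupport _)
    (hΩb.subset (hηs.trans hZΩ)), hηs.trans hZΩ, hη01, ?_, ?_⟩
  · calc ∫⁻ x in E, ENNReal.ofReal (1 - η x)
        ≤ ∫⁻ x in E, (ENNReal.ofReal (1 - w x) + ∑ i, ENNReal.ofReal (θ i x - ψ i x)) := by
          refine setLIntegral_mono' hE fun x hx => ?_
          rw [← ENNReal.ofReal_sum_of_nonneg fun i _ => sub_nonneg.2 (hψ0 i x).2,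
            ← ENNReal.ofReal_add (sub_nonneg.2 (hw01 x).2) (hδ0 x), hηeq x (hEΩ hx)]
          apply ENNReal.ofReal_le_ofReal
          nlinarith [hw01 x, hδ0 x, hδ1 x]
      _ = (∫⁻ x in E, ENNReal.ofReal (1 - w x)) +
          ∑ i, ∫⁻ x in E, ENNReal.ofReal (θ i x - ψ i x) := by
          have h1 : ∀ i, Measurable fun x => ENNReal.ofReal (θ i x - ψ i x) := fun i =>
            ((hθ i).1.continuous.sub (hψ i).continuous).measurable.ennreal_ofReal
          have h0 : Measurable fun x => ENNReal.ofReal (1 - w x) :=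
            (measurable_const.sub hw.continuous.measurable).ennreal_ofReal
          rw [lintegral_add_left h0,
            lintegral_finsetSum _ fun i _ => h1 i]
      _ ≤ ENNReal.ofReal (κ / 4) + ∑ i : ι, ENNReal.ofReal κ' := by
          gcongr with i
          · exact (setLIntegral_le_lintegral _ _).trans hw1
          · exact hψ1 i
      _ ≤ ENNReal.ofReal κ := by
          rw [← ENNReal.ofReal_sum_of_nonneg fun i _ => hκ'0.le, Finset.sum_const, Finset.card_univ,
            nsmul_eq_mul, ← ENNReal.ofReal_add (by positivity) (by positivity)]
          exact ENNReal.ofReal_le_ofReal (by linarith)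
  · have hfd : ∀ x ∈ E, ‖fderiv ℝ η x‖ₑ ≤
        ‖fderiv ℝ w x‖ₑ + ∑ i, ‖fderiv ℝ (θ i) x - fderiv ℝ (ψ i) x‖ₑ := fun x hx => by
      have hev : η =ᶠ[𝓝 x] fun x => w x * (1 - ∑ i, (θ i x - ψ i x)) := by
        filter_upwards [hΩ.mem_nhds (hEΩ hx)] with y hy using hηeq y hy
      have hd := ((hw.differentiable one_ne_zero x).hasFDerivAt).mul
        ((HasFDerivAt.fun_sum (u := Finset.univ) fun i _ =>
          (((hθ i).1.differentiable one_ne_zero x).hasFDerivAt.sub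
          ((hψ i).differentiable one_ne_zero x).hasFDerivAt)).const_sub 1)
      have h2 : fderiv ℝ η x = _ := hev.fderiv_eq.trans hd.fderiv
      have h3 : fderiv ℝ η x = (1 - ∑ i, (θ i x - ψ i x)) • fderiv ℝ w x +
          w x • -∑ i, (fderiv ℝ (θ i) x - fderiv ℝ (ψ i) x) := h2.trans (add_comm _ _)
      rw [smul_neg, ← sub_eq_add_neg] at h3
      rw [h3]
      refine enorm_sub_le.trans (add_le_add ?_ ?_)
      · rw [enorm_smul]
        refine mul_le_of_le_one_left' ?_
        rw [Real.enorm_of_nonneg (sub_nonneg.2 (hδ1 x))]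
        exact ENNReal.ofReal_le_one.2 (by linarith [hδ0 x])
      · rw [enorm_smul]
        refine (mul_le_of_le_one_left' ?_).trans ?_
        · rw [Real.enorm_of_nonneg (hw01 x).1]
          exact ENNReal.ofReal_le_one.2 (hw01 x).2
        · have h4 := norm_sum_le (Finset.univ : Finset ι)
            fun i => fderiv ℝ (θ i) x - fderiv ℝ (ψ i) x
          simp only [← ofReal_norm]
          rw [← ENNReal.ofReal_sum_of_nonneg fun i _ => norm_nonneg _]
          exact ENNReal.ofReal_le_ofReal h4
    calc ∫⁻ x in E, ‖fderiv ℝ η x‖ₑ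
        ≤ ∫⁻ x in E, (‖fderiv ℝ w x‖ₑ + ∑ i, ‖fderiv ℝ (θ i) x - fderiv ℝ (ψ i) x‖ₑ) :=
          setLIntegral_mono' hE hfd
      _ = (∫⁻ x in E, ‖fderiv ℝ w x‖ₑ) +
          ∑ i, ∫⁻ x in E, ‖fderiv ℝ (θ i) x - fderiv ℝ (ψ i) x‖ₑ := by
          have h1 : ∀ i, Measurable fun x => ‖fderiv ℝ (θ i) x - fderiv ℝ (ψ i) x‖ₑ := fun i =>
            (((hθ i).1.continuous_fderiv one_ne_zero).sub
              ((hψ i).continuous_fderiv one_ne_zero)).enorm.measurable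
          have h0 : Measurable fun x => ‖fderiv ℝ w x‖ₑ :=
            (hw.continuous_fderiv one_ne_zero).enorm.measurable
          rw [lintegral_add_left h0, lintegral_finsetSum _ fun i _ => h1 i]
      _ ≤ ENNReal.ofReal (κ / 4) + ∑ i : ι,
          (ENNReal.ofReal ((1 + ε) ^ 2 / (1 - ε)) * b i + ENNReal.ofReal κ') := by
          refine add_le_add ((setLIntegral_le_lintegral _ _).trans hwd)
            (Finset.sum_le_sum fun i _ => hψd i)
      _ ≤ ENNReal.ofReal (κ / 4) + (ENNReal.ofReal ((1 + ε) ^ 2 / (1 - ε)) * B +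
          ENNReal.ofReal (κ / 4)) := by
          rw [Finset.sum_add_distrib, ← Finset.mul_sum,
            ← ENNReal.ofReal_sum_of_nonneg fun i _ => hκ'0.le, Finset.sum_const, Finset.card_univ,
            nsmul_eq_mul]
          refine add_le_add le_rfl (add_le_add (mul_le_mul_right hbsum _)
            (ENNReal.ofReal_le_ofReal hκsum))
      _ ≤ ENNReal.ofReal (κ / 4) + ((B + ENNReal.ofReal (κ / 2)) + ENNReal.ofReal (κ / 4)) := by
          gcongr
      _ = B + ENNReal.ofReal κ := by
          rw [add_assoc B, ← ENNReal.ofReal_add (by positivity) (by positivity), add_left_comm,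
            ← ENNReal.ofReal_add (by positivity) (by positivity)]
          congr 2
          ring

end

/-! ### Approximation by compactly included sets -/

section

/-- A height in `(0, 1 - ε)` costs only a factor close to `1` in the perimeter. On the removed part
`1 - η ≥ ε`, so Chebyshev bounds its measure by `ε⁻¹ ∫_E (1 - η)`. This is why the cut-off is taken
with error `min (κ/2) (κ ε)`. -/
lemma exists_compactlyIncluded {m : ℕ} {Ω E : Set (Space (m + 1))} (hm : m ≠ 0) (hΩ : IsOpen Ω)
    (hΩb : Bornology.IsBounded Ω) (hb : HasPiecewiseC1Boundary Ω) (hE : MeasurableSet E)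
    (hEΩ : E ⊆ Ω) (hP : perimeter E Ω ≠ ⊤)
    (hB : ∫⁻ x, (boundaryPart E Ω).indicator 1 x ∂(surfaceMeasure Ω) ≠ ⊤) {κ : ℝ} (hκ : 0 < κ) :
    ∃ E' ⊆ E, MeasurableSet E' ∧ CompactlyIncluded E' Ω ∧
      perimeter E' Ω ≤ perimeter E Ω +
        (∫⁻ x, (boundaryPart E Ω).indicator 1 x ∂(surfaceMeasure Ω)) + ENNReal.ofReal κ ∧
      volume (E \ E') ≤ ENNReal.ofReal κ := by
  set B := ∫⁻ x, (boundaryPart E Ω).indicator 1 x ∂(surfaceMeasure Ω) with hBdef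
  have hB' : B + ENNReal.ofReal (κ / 2) ≠ ⊤ := ENNReal.add_ne_top.2 ⟨hB, ENNReal.ofReal_ne_top⟩
  obtain ⟨ε, hε0, hε, hεB⟩ := exists_ofReal_mul_le hB' (half_pos hκ)
  obtain ⟨η, hη, hηc, hηΩ, hη01, hη1, hηd⟩ := exists_cutoff hm hΩ hΩb hb hE hEΩ hP hB
    (show 0 < min (κ / 2) (κ * ε) by positivity)
  have hb0 : 0 < 1 - ε := by linarith
  obtain ⟨t, ht, hPt⟩ := exists_superlevel_perimeter_le hEΩ hη hηc hηΩ hε0 hb0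
  have hsub : closure (E ∩ {x | t < η x}) ⊆ tsupport η := closure_mono fun x hx =>
    (ht.1.trans hx.2).ne'
  refine ⟨E ∩ {x | t < η x}, inter_subset_left,
    hE.inter (measurableSet_lt measurable_const hη.continuous.measurable),
    ⟨hηc.isCompact.of_isClosed_subset isClosed_closure hsub, hsub.trans hηΩ⟩, ?_, ?_⟩
  · refine hPt.trans ?_
    rw [add_assoc]
    refine add_le_add le_rfl ?_
    calc ENNReal.ofReal (1 + ε) * ((∫⁻ x in E, ‖fderiv ℝ η x‖ₑ) / ENNReal.ofReal (1 - ε))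
        ≤ ENNReal.ofReal ((1 + ε) ^ 2) *
          ((B + ENNReal.ofReal (κ / 2)) / ENNReal.ofReal (1 - ε)) := by
          refine mul_le_mul' (ENNReal.ofReal_le_ofReal (by nlinarith))
            (ENNReal.div_le_div_right (hηd.trans ?_) _)
          exact add_le_add le_rfl (ENNReal.ofReal_le_ofReal (min_le_left _ _))
      _ = ENNReal.ofReal ((1 + ε) ^ 2 / (1 - ε)) * (B + ENNReal.ofReal (κ / 2)) := by
          rw [ENNReal.ofReal_div_of_pos hb0]
          simp only [ENNReal.div_eq_inv_mul]
          ring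
      _ ≤ B + ENNReal.ofReal (κ / 2) + ENNReal.ofReal (κ / 2) := hεB
      _ = B + ENNReal.ofReal κ := by
          rw [add_assoc, ← ENNReal.ofReal_add (by positivity) (by positivity), add_halves]
  · have hd : E \ (E ∩ {x | t < η x}) ⊆ E ∩ {x | ENNReal.ofReal ε ≤ ENNReal.ofReal (1 - η x)} := by
      rintro x ⟨hx, hx'⟩
      refine ⟨hx, ENNReal.ofReal_le_ofReal ?_⟩
      have : η x ≤ t := not_lt.1 fun h => hx' ⟨hx, h⟩
      linarith [ht.2]
    have hms : MeasurableSet {x | ENNReal.ofReal ε ≤ ENNReal.ofReal (1 - η x)} :=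
      measurableSet_le measurable_const
        (measurable_const.sub hη.continuous.measurable).ennreal_ofReal
    have hmk := meas_ge_le_lintegral_div (μ := volume.restrict E)
      (f := fun x => ENNReal.ofReal (1 - η x))
      (measurable_const.sub hη.continuous.measurable).ennreal_ofReal.aemeasurable
      (ENNReal.ofReal_pos.2 hε0).ne' ENNReal.ofReal_ne_top
    rw [Measure.restrict_apply hms, inter_comm] at hmk
    refine (measure_mono hd).trans (hmk.trans ?_)
    rw [ENNReal.div_le_iff (ENNReal.ofReal_pos.2 hε0).ne' ENNReal.ofReal_ne_top,
      ← ENNReal.ofReal_mul hκ.le]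
    exact hη1.trans (ENNReal.ofReal_le_ofReal (min_le_right _ _))

end

/-! ### Traces of characteristic functions -/

section

variable {N : ℕ} {Ω E : Set (Space N)}

lemma nullMeasurableSet_of_integrableOn_chi (h : IntegrableOn (chi E) Ω) :
    NullMeasurableSet E (volume.restrict Ω) :=
  (aemeasurable_indicator_const_iff (1 : ℝ)).1 h.aestronglyMeasurable.aemeasurable

lemma integrableOn_chi (hΩ : volume Ω ≠ ⊤) (hE : NullMeasurableSet E (volume.restrict Ω)) :
    IntegrableOn (chi E) Ω := by
  have : IsFiniteMeasure (volume.restrict Ω) := ⟨by simpa using hΩ.lt_top⟩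
  exact (integrable_const (1 : ℝ)).indicator₀ hE

lemma setIntegral_chi (hE : NullMeasurableSet E (volume.restrict Ω)) :
    ∫ x in Ω, chi E x = (volume.restrict Ω).real E := by
  simp [chi, integral_indicator₀ hE]

lemma volume_inter_ball_pos (hΩ : IsOpen Ω) {x : Space N} (hx : x ∈ frontier Ω) {r : ℝ}
    (hr : 0 < r) : 0 < volume (Ω ∩ Metric.ball x r) := by
  refine (hΩ.inter Metric.isOpen_ball).measure_pos volume ?_
  obtain ⟨y, hy, hyx⟩ := Metric.mem_closure_iff.1 (frontier_subset_closure hx) r hr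
  exact ⟨y, hy, by rwa [Metric.mem_ball, dist_comm]⟩

/-- The relative density of `E` in `Ω ∩ B(x, r)`. -/
def density (Ω E : Set (Space N)) (x : Space N) (r : ℝ) : ℝ :=
  (volume (E ∩ (Ω ∩ Metric.ball x r)) / volume (Ω ∩ Metric.ball x r)).toReal

lemma mem_boundaryPart_iff {x : Space N} (hx : x ∈ frontier Ω) :
    x ∈ boundaryPart E Ω ↔ Tendsto (density Ω E x) (𝓝[>] 0) (𝓝 1) := by
  have h1 : ∀ r : ℝ, volume (E ∩ (Ω ∩ Metric.ball x r)) / volume (Ω ∩ Metric.ball x r) ≠ ⊤ :=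
    fun r => by
      refine (ENNReal.div_le_of_le_mul ?_ |>.trans_lt ENNReal.one_lt_top).ne
      rw [one_mul]
      exact measure_mono inter_subset_right
  rw [show (1 : ℝ) = (1 : ℝ≥0∞).toReal by simp]
  unfold density
  rw [ENNReal.tendsto_toReal_iff h1 ENNReal.one_ne_top]
  exact ⟨fun h => h.2, fun h => ⟨hx, h⟩⟩

/-- The integrand is `|1 - c|` on `E` and `|c|` elsewhere, so the existence of a trace is a
condition on the density alone. -/
lemma average_abs_chi_sub (hΩ : IsOpen Ω) (hE : NullMeasurableSet E (volume.restrict Ω))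
    {x : Space N} (hx : x ∈ frontier Ω) (c : ℝ) {r : ℝ} (hr : 0 < r) :
    ⨍ y in Ω ∩ Metric.ball x r, |chi E y - c| = |c| + (|1 - c| - |c|) * density Ω E x r := by
  set W := Ω ∩ Metric.ball x r with hW
  have hV0 : 0 < volume W := volume_inter_ball_pos hΩ hx hr
  have hVt : volume W ≠ ⊤ :=
    ((measure_mono inter_subset_right).trans_lt measure_ball_lt_top).ne
  have hEW : NullMeasurableSet E (volume.restrict W) :=
    hE.mono_ac (Measure.restrict_mono inter_subset_left le_rfl).absolutelyContinuous
  have h1 : ∀ y, |chi E y - c| = |c| + (|1 - c| - |c|) * chi E y := fun y => by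
    by_cases hy : y ∈ E <;> simp [chi, hy]
  have hVr : 0 < volume.real W := ENNReal.toReal_pos hV0.ne' hVt
  have hint := integrableOn_chi hVt hEW
  have hfin : IsFiniteMeasure (volume.restrict W) := ⟨by simpa using hVt.lt_top⟩
  rw [setAverage_eq]
  simp only [h1]
  rw [integral_add (integrable_const _) (hint.const_mul _), integral_const_mul,
    setIntegral_chi hEW, setIntegral_const, measureReal_def (volume.restrict W),
    Measure.restrict_apply₀ hEW, density, ENNReal.toReal_div, ← measureReal_def, ← measureReal_def]
  simp only [smul_eq_mul, ← hW]
  field_simp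

lemma hasTraceAt_chi_iff (hΩ : IsOpen Ω) (hE : NullMeasurableSet E (volume.restrict Ω))
    {x : Space N} (hx : x ∈ frontier Ω) (c : ℝ) :
    HasTraceAt Ω (chi E) x c ↔
      Tendsto (fun r => |c| + (|1 - c| - |c|) * density Ω E x r) (𝓝[>] 0) (𝓝 0) := by
  refine tendsto_congr' ?_
  filter_upwards [self_mem_nhdsWithin] with r hr using average_abs_chi_sub hΩ hE hx c hr

lemma density_nonneg (x : Space N) (r : ℝ) : 0 ≤ density Ω E x r := ENNReal.toReal_nonneg

lemma density_le_one (x : Space N) (r : ℝ) : density Ω E x r ≤ 1 := by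
  refine ENNReal.toReal_le_of_le_ofReal zero_le_one ?_
  rw [ENNReal.ofReal_one]
  refine ENNReal.div_le_of_le_mul ?_
  rw [one_mul]
  exact measure_mono inter_subset_right

/-- If the density `d` tends to `1`, the mean tends to `|1 - c|`, which forces `c = 1`. Conversely,
if `|c|(1 - d) + |1 - c| d` tends to `0` with `c ≠ 0`, then `d` tends to `1`. Off `boundaryPart` the
only possible trace is thus `0`, which is also the default value where no trace exists. -/
lemma enorm_boundaryTrace_chi (hΩ : IsOpen Ω) (hE : NullMeasurableSet E (volume.restrict Ω))
    {x : Space N} (hx : x ∈ frontier Ω) :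
    ‖boundaryTrace Ω (chi E) x‖ₑ = (boundaryPart E Ω).indicator 1 x := by
  by_cases hxE : x ∈ boundaryPart E Ω
  · have hd := (mem_boundaryPart_iff hx).1 hxE
    have hlim : ∀ c : ℝ, Tendsto (fun r => |c| + (|1 - c| - |c|) * density Ω E x r) (𝓝[>] 0)
        (𝓝 |1 - c|) := fun c => by
      have := (hd.const_mul (|1 - c| - |c|)).const_add |c|
      simpa using this
    have hex : ∃ c, HasTraceAt Ω (chi E) x c :=
      ⟨1, (hasTraceAt_chi_iff hΩ hE hx 1).2 (by simpa using hlim 1)⟩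
    have h1 := tendsto_nhds_unique (hlim hex.choose)
      ((hasTraceAt_chi_iff hΩ hE hx _).1 hex.choose_spec)
    have h2 : hex.choose = 1 := by linarith [abs_eq_zero.1 h1]
    rw [boundaryTrace, dif_pos hex, h2, indicator_of_mem hxE]
    simp
  · rw [indicator_of_notMem hxE, boundaryTrace]
    split_ifs with hex
    · suffices h : hex.choose = 0 by rw [h]; simp
      by_contra hc
      set c := hex.choose with hcdef
      have h1 := (hasTraceAt_chi_iff hΩ hE hx _).1 hex.choose_spec
      rw [← hcdef] at h1
      apply hxE
      rw [mem_boundaryPart_iff hx]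
      have hc' : 0 < |c| := abs_pos.2 hc
      have h2 : Tendsto (fun r => 1 - (|c| + (|1 - c| - |c|) * density Ω E x r) / |c|) (𝓝[>] 0)
          (𝓝 1) := by
        simpa using (h1.div_const |c|).const_sub 1
      refine tendsto_of_tendsto_of_tendsto_of_le_of_le h2 tendsto_const_nhds (fun r => ?_)
        (fun r => density_le_one x r)
      have h3 : 0 ≤ |1 - c| * density Ω E x r := mul_nonneg (abs_nonneg _) (density_nonneg x r)
      have h4 : 1 - density Ω E x r ≤ (|c| + (|1 - c| - |c|) * density Ω E x r) / |c| := by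
        rw [le_div_iff₀ hc']
        linarith
      linarith
    · simp

lemma boundaryIntegral_chi (hΩ : IsOpen Ω) (hE : NullMeasurableSet E (volume.restrict Ω)) :
    boundaryIntegral Ω (chi E) = ∫⁻ x, (boundaryPart E Ω).indicator 1 x ∂(surfaceMeasure Ω) :=
  setLIntegral_congr_fun isClosed_frontier.measurableSet fun _ hx =>
    enorm_boundaryTrace_chi hΩ hE hx

lemma boundaryPart_eq_empty (hΩ : IsOpen Ω) (hE : CompactlyIncluded E Ω) :
    boundaryPart E Ω = ∅ := by
  rw [eq_empty_iff_forall_notMem]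
  rintro x ⟨hx, hlim⟩
  have hxE : x ∉ closure E := fun h => by
    rw [hΩ.frontier_eq] at hx
    exact hx.2 (hE.2 h)
  obtain ⟨r, hr, hball⟩ := Metric.isOpen_iff.1 isClosed_closure.isOpen_compl x hxE
  have h0 : Tendsto (fun r : ℝ => volume (E ∩ (Ω ∩ Metric.ball x r)) /
      volume (Ω ∩ Metric.ball x r)) (𝓝[>] 0) (𝓝 0) := by
    refine tendsto_const_nhds.congr' ?_
    filter_upwards [Ioo_mem_nhdsGT hr] with s hs
    have : E ∩ (Ω ∩ Metric.ball x s) = ∅ := by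
      rw [eq_empty_iff_forall_notMem]
      rintro y ⟨hy, -, hys⟩
      exact hball (Metric.ball_subset_ball hs.2.le hys) (subset_closure hy)
    simp [this]
  exact zero_ne_one (tendsto_nhds_unique h0 hlim)

end

/-! ### The two formulas for `λ_{0,n}` and the relaxed inequality -/

section

section congruence

variable {N : ℕ} {Ω E F : Set (Space N)}

lemma perimeter_congr (h : (E ∩ Ω : Set (Space N)) =ᵐ[volume] (F ∩ Ω : Set (Space N))) :
    perimeter E Ω = perimeter F Ω := by
  unfold perimeter
  simp only [setIntegral_congr_set h]

lemma boundaryPart_congr (h : (E ∩ Ω : Set (Space N)) =ᵐ[volume] (F ∩ Ω : Set (Space N))) :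
    boundaryPart E Ω = boundaryPart F Ω := by
  unfold boundaryPart
  have : ∀ x r, volume (E ∩ (Ω ∩ Metric.ball x r)) = volume (F ∩ (Ω ∩ Metric.ball x r)) :=
    fun x r => by
      rw [← inter_assoc, ← inter_assoc]
      exact measure_congr (h.inter (ae_eq_refl _))
  simp only [this]

/-- A Caccioppoli set is only null measurable in `Ω` and may extend outside it, whereas the
constructions above need a measurable subset of `Ω`. Perimeter, boundary part and volume in `Ω` do
not see the change. -/
lemma exists_measurable_subset_ae_eq (hΩ : IsOpen Ω)
    (hE : NullMeasurableSet E (volume.restrict Ω)) :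
    ∃ F ⊆ Ω, MeasurableSet F ∧ (F ∩ Ω : Set (Space N)) =ᵐ[volume] (E ∩ Ω : Set (Space N)) := by
  obtain ⟨F, hF, hFm, hFe⟩ := ((nullMeasurableSet_restrict
    hΩ.measurableSet.nullMeasurableSet).1 hE).exists_measurable_subset_ae_eq
  refine ⟨F, hF.trans inter_subset_right, hFm, ?_⟩
  rwa [inter_eq_self_of_subset_left (hF.trans inter_subset_right)]

lemma setIntegral_chi_eq (hE : NullMeasurableSet E (volume.restrict Ω)) :
    ∫ x in Ω, chi E x = volume.real (E ∩ Ω) := by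
  rw [setIntegral_chi hE, measureReal_def, Measure.restrict_apply₀ hE, measureReal_def]

lemma continuous_penalty (n : ℕ) : Continuous (penalty n) := by
  unfold penalty
  exact ENNReal.continuous_ofReal.comp (by fun_prop)

end congruence

/-- The approximations with error `1/(k+1)` are competitors for `λ_{0,n}`. Their volumes converge,
so their penalties do. If the boundary term is infinite there is nothing to prove. -/
lemma lambdaZero_le {m n : ℕ} {Ω E : Set (Space (m + 1))} (hm : m ≠ 0) (hΩ : IsOpen Ω)
    (hΩb : Bornology.IsBounded Ω) (hb : HasPiecewiseC1Boundary Ω) (hE : IsCaccioppoli Ω E) :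
    lambdaZero n Ω ≤ perimeter E Ω +
      (∫⁻ x, (boundaryPart E Ω).indicator 1 x ∂(surfaceMeasure Ω)) +
      penalty n (volume.real (E ∩ Ω)) := by
  have hE0 := nullMeasurableSet_of_integrableOn_chi hE.1
  have hP : perimeter E Ω ≠ ⊤ := by
    rw [← totalVariation_chi hE0]
    exact hE.2.ne
  obtain ⟨F, hFΩ, hFm, hFE⟩ := exists_measurable_subset_ae_eq hΩ hE0
  rw [← perimeter_congr hFE, ← boundaryPart_congr hFE, ← measureReal_congr hFE,
    inter_eq_self_of_subset_left hFΩ]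
  rw [← perimeter_congr hFE] at hP
  clear hE0 hFE hE
  have hvΩ : volume Ω ≠ ⊤ := hΩb.measure_lt_top.ne
  have hvF : volume F ≠ ⊤ := (measure_mono hFΩ).trans_lt hvΩ.lt_top |>.ne
  set B := ∫⁻ x, (boundaryPart F Ω).indicator 1 x ∂(surfaceMeasure Ω) with hBdef
  by_cases hB : B = ⊤
  · simp [hB]
  choose G hGF hGm hGΩ hGP hGv using fun k : ℕ =>
    exists_compactlyIncluded hm hΩ hΩb hb hFm hFΩ hP hB (Nat.one_div_pos_of_nat (α := ℝ) (n := k))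
  have hκ : Tendsto (fun k : ℕ => 1 / ((k : ℝ) + 1)) atTop (𝓝 0) :=
    tendsto_one_div_add_atTop_nhds_zero_nat
  have hle : ∀ k : ℕ, lambdaZero n Ω ≤ perimeter F Ω + B + ENNReal.ofReal (1 / ((k : ℝ) + 1)) +
      penalty n (volume.real (G k)) := fun k => by
    have hGk : NullMeasurableSet (G k) (volume.restrict Ω) := (hGm k).nullMeasurableSet
    have hGΩ' : G k ⊆ Ω := (hGF k).trans hFΩ
    have hPk : perimeter (G k) Ω < ⊤ := (hGP k).trans_lt (ENNReal.add_lt_top.2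
      ⟨ENNReal.add_lt_top.2 ⟨hP.lt_top, lt_top_iff_ne_top.2 hB⟩, ENNReal.ofReal_lt_top⟩)
    refine (iInf₂_le (G k) ⟨⟨integrableOn_chi hvΩ hGk, by rwa [totalVariation_chi hGk]⟩,
      hGΩ k⟩).trans ?_
    rw [totalVariation_chi hGk, setIntegral_chi_eq hGk, inter_eq_self_of_subset_left hGΩ']
    exact add_le_add (hGP k) le_rfl
  have hvol : Tendsto (fun k => volume.real (G k)) atTop (𝓝 (volume.real F)) := by
    refine tendsto_of_tendsto_of_tendsto_of_le_of_le
      (g := fun k : ℕ => volume.real F - 1 / ((k : ℝ) + 1)) (h := fun _ => volume.real F)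
      (by simpa using hκ.const_sub (volume.real F)) tendsto_const_nhds (fun k => ?_)
      (fun k => measureReal_mono (hGF k) hvF)
    have h1 : volume.real (F \ G k) ≤ 1 / ((k : ℝ) + 1) :=
      ENNReal.toReal_le_of_le_ofReal (by positivity) (hGv k)
    have h2 : volume.real (F \ G k) = volume.real F - volume.real (G k) :=
      measureReal_sdiff (hGF k) (hGm k) hvF
    show volume.real F - 1 / ((k : ℝ) + 1) ≤ volume.real (G k)
    linarith
  have hlim := ((ENNReal.tendsto_ofReal hκ).const_add (perimeter F Ω + B)).add
    (((continuous_penalty n).tendsto _).comp hvol)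
  rw [ENNReal.ofReal_zero, add_zero] at hlim
  exact ge_of_tendsto' hlim hle

section formulas

variable {m n : ℕ} {Ω : Set (Space (m + 1))}

lemma lambdaZero_eq_perimeter (hm : m ≠ 0) (hΩ : IsOpen Ω) (hΩb : Bornology.IsBounded Ω)
    (hb : HasPiecewiseC1Boundary Ω) :
    lambdaZero n Ω = ⨅ (E : Set (Space (m + 1))) (_ : IsCaccioppoli Ω E),
      perimeter E Ω + surfaceMeasure Ω (boundaryPart E Ω) + penalty n (volume.real (E ∩ Ω)) := by
  refine le_antisymm (le_iInf₂ fun E hE => ?_) (le_iInf₂ fun E hE => ?_)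
  · refine (lambdaZero_le hm hΩ hΩb hb hE).trans ?_
    gcongr
    -- Without measurability of `boundaryPart` the lower integral of its indicator is at most its
    -- measure, and this is the direction needed.
    exact lintegral_indicator_one_le _
  · refine (iInf₂_le E hE.1).trans ?_
    have hE0 := nullMeasurableSet_of_integrableOn_chi hE.1.1
    rw [boundaryPart_eq_empty hΩ hE.2, measure_empty, add_zero, totalVariation_chi hE0,
      setIntegral_chi_eq hE0]

lemma boundaryIntegral_chi_eq_zero {E : Set (Space (m + 1))} (hΩ : IsOpen Ω)
    (hE : IsCaccioppoli Ω E) (hc : CompactlyIncluded E Ω) : boundaryIntegral Ω (chi E) = 0 := by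
  rw [boundaryIntegral_chi hΩ (nullMeasurableSet_of_integrableOn_chi hE.1),
    boundaryPart_eq_empty hΩ hc]
  simp

lemma lambdaZero_eq_boundaryIntegral (hm : m ≠ 0) (hΩ : IsOpen Ω) (hΩb : Bornology.IsBounded Ω)
    (hb : HasPiecewiseC1Boundary Ω) :
    lambdaZero n Ω = ⨅ (E : Set (Space (m + 1))) (_ : IsCaccioppoli Ω E),
      totalVariation Ω (chi E) + boundaryIntegral Ω (chi E) + penalty n (∫ x in Ω, chi E x) := by
  refine le_antisymm (le_iInf₂ fun E hE => ?_) (le_iInf₂ fun E hE => ?_)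
  · have hE0 := nullMeasurableSet_of_integrableOn_chi hE.1
    rw [totalVariation_chi hE0, setIntegral_chi_eq hE0, boundaryIntegral_chi hΩ hE0]
    exact lambdaZero_le hm hΩ hΩb hb hE
  · refine (iInf₂_le E hE.1).trans ?_
    rw [boundaryIntegral_chi_eq_zero hΩ hE.1 hE.2, add_zero]

lemma lambdaOneRelaxed_le_lambdaZero (hΩ : IsOpen Ω) : lambdaOneRelaxed n Ω ≤ lambdaZero n Ω := by
  refine le_iInf₂ fun E hE => (iInf₂_le (chi E) hE.1).trans ?_
  rw [boundaryIntegral_chi_eq_zero hΩ hE.1 hE.2, add_zero]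
  have : ∀ x, |chi E x| = chi E x := fun x =>
    abs_of_nonneg (indicator_nonneg (fun _ _ => zero_le_one) x)
  simp only [this]
  exact le_rfl

end formulas

end

/-! ### Total variation of smooth functions, and test functions in `W^{1,1}_0` -/

section

open scoped RealInnerProductSpace

variable {N : ℕ} {u : Space N → ℝ}

lemma gradient_apply (u : Space N → ℝ) (x : Space N) (i : Fin N) :
    gradient u x i = fderiv ℝ u x (EuclideanSpace.single i 1) := by
  rw [← inner_gradient_left, EuclideanSpace.inner_single_right]
  simp

lemma contDiff_gradient (hu : ContDiff ℝ 2 u) : ContDiff ℝ 1 (gradient u) := by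
  refine contDiff_euclidean.2 fun i => ?_
  simp only [gradient_apply]
  exact (hu.fderiv_right (m := 1) (by norm_num)).clm_apply contDiff_const

lemma tsupport_gradient_subset (u : Space N → ℝ) : tsupport (gradient u) ⊆ tsupport u := by
  refine closure_minimal (fun x hx => ?_) isClosed_closure
  by_contra h
  apply hx
  have : fderiv ℝ u x = 0 := by
    by_contra h'
    exact h (support_fderiv_subset ℝ h')
  simp [gradient, this]

lemma integral_mul_fderiv_apply {f g : Space N → ℝ} (hf : ContDiff ℝ 1 f)
    (hfc : HasCompactSupport f) (hg : ContDiff ℝ 1 g) (v : Space N) :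
    ∫ x, f x * fderiv ℝ g x v = -∫ x, fderiv ℝ f x v * g x := by
  have hf' := (hf.continuous_fderiv one_ne_zero).clm_apply (continuous_const (y := v))
  have hg' := (hg.continuous_fderiv one_ne_zero).clm_apply (continuous_const (y := v))
  refine integral_mul_fderiv_eq_neg_fderiv_mul_of_integrable ?_ ?_ ?_
    (fun x _ => hf.differentiable one_ne_zero x) fun x _ => hg.differentiable one_ne_zero x
  · exact (hf'.mul hg.continuous).integrable_of_hasCompactSupport
      (HasCompactSupport.mul_right (hfc.fderiv_apply (𝕜 := ℝ) v))
  · exact (hf.continuous.mul hg').integrable_of_hasCompactSupport (HasCompactSupport.mul_right hfc)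
  · exact (hf.continuous.mul hg.continuous).integrable_of_hasCompactSupport
      (HasCompactSupport.mul_right hfc)

lemma integral_mul_divergence (hu : ContDiff ℝ 1 u) (huc : HasCompactSupport u)
    {φ : Space N → Space N} (hφ : ContDiff ℝ 1 φ) :
    ∫ x, u x * divergence φ x = -∫ x, ⟪gradient u x, φ x⟫ := by
  have hφi : ∀ i, ContDiff ℝ 1 fun x => φ x i := fun i => contDiff_euclidean.1 hφ i
  have hdiv : ∀ x, u x * divergence φ x =
      ∑ i, u x * fderiv ℝ (fun y => φ y i) x (EuclideanSpace.single i 1) := fun x => by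
    rw [divergence, Finset.mul_sum]
    refine Finset.sum_congr rfl fun i _ => ?_
    have h : HasFDerivAt (fun y => φ y i)
        ((EuclideanSpace.proj i : Space N →L[ℝ] ℝ).comp (fderiv ℝ φ x)) x :=
      (EuclideanSpace.proj i : Space N →L[ℝ] ℝ).hasFDerivAt.comp x
        (hφ.differentiable one_ne_zero x).hasFDerivAt
    rw [h.fderiv]
    rfl
  have hinner : ∀ x, ⟪gradient u x, φ x⟫ =
      ∑ i, fderiv ℝ u x (EuclideanSpace.single i 1) * φ x i := fun x => by
    rw [PiLp.inner_apply]
    refine Finset.sum_congr rfl fun i _ => ?_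
    rw [gradient_apply]
    simp [mul_comm]
  simp only [hdiv, hinner]
  have hd : ∀ {f : Space N → ℝ}, ContDiff ℝ 1 f → ∀ v : Space N,
      Continuous fun x => fderiv ℝ f x v := fun hf v =>
    (hf.continuous_fderiv one_ne_zero).clm_apply continuous_const
  rw [integral_finsetSum, integral_finsetSum, ← Finset.sum_neg_distrib]
  · exact Finset.sum_congr rfl fun i _ => integral_mul_fderiv_apply hu huc (hφi i) _
  · exact fun i _ => ((hd hu _).mul (hφi i).continuous).integrable_of_hasCompactSupport
      (HasCompactSupport.mul_right (huc.fderiv_apply (𝕜 := ℝ) _))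
  · exact fun i _ => (hu.continuous.mul (hd (hφi i) _)).integrable_of_hasCompactSupport
      (HasCompactSupport.mul_right huc)

/-- The dual description of the total variation of a smooth function. -/
lemma lintegral_enorm_gradient_le (hu : ContDiff ℝ 2 u) (huc : HasCompactSupport u) {T : ℝ≥0∞}
    (hT : ∀ φ : Space N → Space N, ContDiff ℝ 1 φ → tsupport φ ⊆ tsupport u → (∀ x, ‖φ x‖ ≤ 1) →
      ENNReal.ofReal (∫ x, u x * divergence φ x) ≤ T) :
    ∫⁻ x, ‖gradient u x‖ₑ ≤ T := by
  have hG := contDiff_gradient hu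
  have hGs : ∀ x ∉ tsupport u, gradient u x = 0 := fun x hx =>
    image_eq_zero_of_notMem_tsupport fun h => hx (tsupport_gradient_subset u h)
  have hvol : volume (tsupport u) ≠ ⊤ := huc.isCompact.measure_lt_top.ne
  have key : ∀ δ : ℝ, 0 < δ →
      ∫⁻ x, ‖gradient u x‖ₑ ≤ T + ENNReal.ofReal δ * volume (tsupport u) := by
    intro δ hδ
    -- The optimal field `-∇u/|∇u|` need not be `C¹` where `∇u = 0`. Replacing `|∇u|` by `s` makes
    -- it `C¹` and loses at most `δ` at each point of the support, since `|∇u|²/s = s - δ²/s ≥ |∇u|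
    -- - δ`.
    set s : Space N → ℝ := fun x => √(δ ^ 2 + ‖gradient u x‖ ^ 2) with hs
    have hpos : ∀ x, 0 < δ ^ 2 + ‖gradient u x‖ ^ 2 := fun x => by positivity
    have hs0 : ∀ x, 0 < s x := fun x => Real.sqrt_pos.2 (hpos x)
    have hsq : ∀ x, s x ^ 2 = δ ^ 2 + ‖gradient u x‖ ^ 2 := fun x => Real.sq_sqrt (hpos x).le
    have hsG : ∀ x, ‖gradient u x‖ ≤ s x := fun x =>
      Real.le_sqrt_of_sq_le (by linarith [sq_nonneg δ])
    have hsδ : ∀ x, δ ≤ s x := fun x =>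
      Real.le_sqrt_of_sq_le (by linarith [sq_nonneg ‖gradient u x‖])
    have hsC : ContDiff ℝ 1 s := (contDiff_const.add (hG.norm_sq ℝ)).sqrt fun x => (hpos x).ne'
    set φ : Space N → Space N := fun x => -((s x)⁻¹ • gradient u x) with hφ
    have hφC : ContDiff ℝ 1 φ := ((hsC.inv fun x => (hs0 x).ne').smul hG).neg
    have hφs : tsupport φ ⊆ tsupport u := by
      refine (closure_mono fun x hx => ?_).trans (tsupport_gradient_subset u)
      contrapose! hx
      simp [hφ, Function.notMem_support.1 hx]
    have hφ1 : ∀ x, ‖φ x‖ ≤ 1 := fun x => by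
      rw [hφ]
      simp only
      rw [norm_neg, norm_smul, norm_inv, Real.norm_of_nonneg (hs0 x).le, inv_mul_le_iff₀ (hs0 x),
        mul_one]
      exact hsG x
    have hint := integral_mul_divergence (hu.of_le one_le_two) huc hφC
    have hval : ∀ x, ⟪gradient u x, φ x⟫ = -((s x)⁻¹ * ‖gradient u x‖ ^ 2) := fun x => by
      simp only [hφ, inner_neg_right, inner_smul_right, real_inner_self_eq_norm_sq]
    simp only [hval, integral_neg, neg_neg] at hint
    have hq : Continuous fun x => (s x)⁻¹ * ‖gradient u x‖ ^ 2 :=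
      (hsC.continuous.inv₀ fun x => (hs0 x).ne').mul (hG.continuous.norm.pow 2)
    have hq0 : ∀ x, 0 ≤ (s x)⁻¹ * ‖gradient u x‖ ^ 2 := fun x =>
      mul_nonneg (inv_nonneg.2 (hs0 x).le) (sq_nonneg _)
    have hqc : HasCompactSupport fun x => (s x)⁻¹ * ‖gradient u x‖ ^ 2 :=
      HasCompactSupport.intro huc.isCompact fun x hx => by simp [hGs x hx]
    have hle : ∀ x, ‖gradient u x‖ₑ ≤ ENNReal.ofReal ((s x)⁻¹ * ‖gradient u x‖ ^ 2) +
        (tsupport u).indicator (fun _ => ENNReal.ofReal δ) x := fun x => by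
      by_cases hx : x ∈ tsupport u
      · rw [indicator_of_mem hx, ← ENNReal.ofReal_add (hq0 x) hδ.le, ← ofReal_norm]
        refine ENNReal.ofReal_le_ofReal ?_
        have h1 : ‖gradient u x‖ ^ 2 = s x ^ 2 - δ ^ 2 := by rw [hsq]; ring
        have h2 : (s x)⁻¹ * ‖gradient u x‖ ^ 2 = s x - δ * (δ / s x) := by
          rw [h1]
          have := (hs0 x).ne'
          field_simp
        have h3 : δ / s x ≤ 1 := (div_le_one (hs0 x)).2 (hsδ x)
        have h4 := hsG x
        rw [h2]
        nlinarith
      · simp [hGs x hx]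
    calc ∫⁻ x, ‖gradient u x‖ₑ ≤ ∫⁻ x, (ENNReal.ofReal ((s x)⁻¹ * ‖gradient u x‖ ^ 2) +
          (tsupport u).indicator (fun _ => ENNReal.ofReal δ) x) := lintegral_mono hle
      _ = ENNReal.ofReal (∫ x, u x * divergence φ x) + ENNReal.ofReal δ * volume (tsupport u) := by
          rw [lintegral_add_left hq.measurable.ennreal_ofReal, hint,
            ofReal_integral_eq_lintegral_ofReal (hq.integrable_of_hasCompactSupport hqc)
              (Eventually.of_forall hq0),
            lintegral_indicator_const (isClosed_tsupport u).measurableSet]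
      _ ≤ T + ENNReal.ofReal δ * volume (tsupport u) := by
          gcongr
          exact hT φ hφC hφs hφ1
  have hlim : Tendsto (fun k : ℕ => T + ENNReal.ofReal (1 / ((k : ℝ) + 1)) * volume (tsupport u))
      atTop (𝓝 (T + ENNReal.ofReal 0 * volume (tsupport u))) :=
    (ENNReal.Tendsto.mul_const (ENNReal.tendsto_ofReal tendsto_one_div_add_atTop_nhds_zero_nat)
      (Or.inr hvol)).const_add T
  rw [ENNReal.ofReal_zero, zero_mul, add_zero] at hlim
  exact ge_of_tendsto' hlim fun k => key _ Nat.one_div_pos_of_nat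

lemma isW110_of_isTestFunction {Ω : Set (Space N)} (hu : IsTestFunction Ω u) :
    IsW110 Ω u (gradient u) := by
  obtain ⟨hu, huc, huΩ⟩ := hu
  have hu2 : ContDiff ℝ 2 u := by exact_mod_cast contDiff_infty.1 hu 2
  have hG := (contDiff_gradient hu2).continuous
  have hGc : HasCompactSupport (gradient u) :=
    huc.of_isClosed_subset isClosed_closure (tsupport_gradient_subset u)
  refine ⟨⟨(hu.continuous.integrable_of_hasCompactSupport huc).integrableOn,
    (hG.integrable_of_hasCompactSupport hGc).integrableOn, fun ψ hψ => ?_⟩,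
    fun _ => u, fun _ => ⟨hu, huc, huΩ⟩, by simp, by simp⟩
  have hψ2 : ContDiff ℝ 2 ψ := by exact_mod_cast contDiff_infty.1 hψ.1 2
  have hG' := (contDiff_gradient hψ2).continuous
  have h1 : Integrable fun x => u x • gradient ψ x :=
    (hu.continuous.smul hG').integrable_of_hasCompactSupport (HasCompactSupport.smul_right huc)
  have h2 : Integrable fun x => ψ x • gradient u x :=
    (hψ.1.continuous.smul hG).integrable_of_hasCompactSupport (HasCompactSupport.smul_right hψ.2.1)
  rw [setIntegral_eq_integral_of_forall_compl_eq_zero fun x hx => by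
      rw [image_eq_zero_of_notMem_tsupport fun h => hx (huΩ h), zero_smul],
    setIntegral_eq_integral_of_forall_compl_eq_zero fun x hx => by
      rw [image_eq_zero_of_notMem_tsupport fun h => hx (hψ.2.2 h), zero_smul]]
  refine ext_inner_left ℝ fun v => ?_
  rw [inner_neg_right, ← integral_inner h1, ← integral_inner h2]
  have h3 : ∀ (f : Space N → ℝ) x, ⟪v, gradient f x⟫ = fderiv ℝ f x v := fun f x => by
    rw [real_inner_comm, inner_gradient_left]
  simp only [inner_smul_right, h3]
  rw [integral_mul_fderiv_apply (hu2.of_le one_le_two) huc (hψ2.of_le one_le_two)]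
  simp only [mul_comm]

end

/-! ### Mollification and the comparison with `λ_{1,n}` -/

section

open scoped Convolution Pointwise

variable {N : ℕ} {Ω E : Set (Space N)}

lemma divergence_comp_add_right (φ : Space N → Space N) (z x : Space N) :
    divergence (fun y => φ (y + z)) x = divergence φ (x + z) := by
  simp only [divergence, fderiv_comp_add_right]

lemma mem_cthickening_of_add_mem {K : Set (Space N)} {δ : ℝ} (hδ : 0 ≤ δ) {y z : Space N}
    (hz : ‖z‖ ≤ δ) (h : y + z ∈ Metric.cthickening δ K) : y ∈ Metric.cthickening (δ + δ) K := by
  rw [Metric.mem_cthickening_iff] at h ⊢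
  calc Metric.infEDist y K ≤ Metric.infEDist (y + z) K + edist y (y + z) :=
        Metric.infEDist_le_infEDist_add_edist
    _ ≤ ENNReal.ofReal δ + ENNReal.ofReal δ := by
        refine add_le_add h ?_
        rw [edist_dist, dist_self_add_right]
        exact ENNReal.ofReal_le_ofReal hz
    _ = ENNReal.ofReal (δ + δ) := (ENNReal.ofReal_add hδ hδ).symm

/-- A mollification is an average of translates of `χ_E`. Each translation by `z` can be moved onto
the test field, which becomes `φ(· + z)` and is still admissible in `Ω`, so averaging does not
increase the variation. -/
lemma exists_mollification (hΩ : IsOpen Ω) (hE : IsCaccioppoli Ω E)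
    (hc : CompactlyIncluded E Ω) :
    ∃ u : Space N → ℝ, IsTestFunction Ω u ∧ (∀ x, 0 ≤ u x) ∧ ∫ x, u x = ∫ x, chi E x ∧
      ∫⁻ x, ‖gradient u x‖ₑ ≤ totalVariation Ω (chi E) := by
  set K := closure E with hK
  obtain ⟨δ₀, hδ₀, hKδ⟩ := hc.1.exists_cthickening_subset_open hΩ hc.2
  -- The support of `u` takes up one `δ` and the translation of the test field, supported in that of
  -- `u`, another.
  set δ := δ₀ / 2 with hδdef
  have hδ : 0 < δ := half_pos hδ₀
  have hKδ2 : Metric.cthickening (δ + δ) K ⊆ Ω := by rwa [hδdef, add_halves]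
  have hKδ1 : Metric.cthickening δ K ⊆ Ω :=
    (Metric.cthickening_mono (by linarith) K).trans hKδ2
  let b : ContDiffBump (0 : Space N) := ⟨δ / 2, δ, half_pos hδ, half_lt_self hδ⟩
  set η : Space N → ℝ := b.normed volume with hη
  have hη0 : ∀ z, 0 ≤ η z := b.nonneg_normed
  have hη1 : ∫ z, η z = 1 := b.integral_normed
  have hηs : Function.support η = Metric.ball 0 δ := b.support_normed_eq
  have hηC : ContDiff ℝ ∞ η := b.contDiff_normed
  have hηc : HasCompactSupport η := b.hasCompactSupport_normed
  have hηi : Integrable η := hηC.continuous.integrable_of_hasCompactSupport hηc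
  have hEs : Function.support (chi E) ⊆ E := support_indicator_subset
  have hχ0 : ∀ x, 0 ≤ chi E x := indicator_nonneg fun _ _ => zero_le_one
  have hχi : Integrable (chi E) :=
    (integrableOn_iff_integrable_of_support_subset (hEs.trans (subset_closure.trans hc.2))).1 hE.1
  set L := ContinuousLinearMap.mul ℝ ℝ with hL
  set u : Space N → ℝ := η ⋆[L, volume] chi E with hu
  have huval : ∀ x, u x = ∫ z, η z * chi E (x - z) := fun x => rfl
  have husK : tsupport u ⊆ Metric.cthickening δ K := by
    refine closure_minimal (fun x hx => ?_) Metric.isClosed_cthickening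
    obtain ⟨z, hz, y, hy, rfl⟩ := support_convolution_subset L hx
    rw [hηs, mem_ball_zero_iff] at hz
    refine Metric.mem_cthickening_of_dist_le _ y _ _ (subset_closure (hEs hy)) ?_
    simpa using hz.le
  have huC : ContDiff ℝ ∞ u := hηc.contDiff_convolution_left L hηC hχi.locallyIntegrable
  have huc : HasCompactSupport u := (hc.1.cthickening).of_isClosed_subset isClosed_closure husK
  refine ⟨u, ⟨huC, huc, husK.trans hKδ1⟩, fun x => ?_, ?_, ?_⟩
  · exact integral_nonneg fun z => mul_nonneg (hη0 z) (hχ0 _)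
  · rw [hu, integral_convolution L hηi hχi, hη1]
    simp [hL]
  refine lintegral_enorm_gradient_le (by exact_mod_cast contDiff_infty.1 huC 2) huc
    fun φ hφ hφs hφ1 => ENNReal.ofReal_le_of_le_toReal ?_
  set P := (totalVariation Ω (chi E)).toReal with hP
  have hg := continuous_divergence hφ
  have hφc : HasCompactSupport φ := huc.of_isClosed_subset isClosed_closure hφs
  obtain ⟨C, hC⟩ := (hasCompactSupport_divergence hφc).exists_bound_of_continuous hg
  have hint : Integrable (fun p : Space N × Space N => η p.2 * chi E (p.1 - p.2) *
      divergence φ p.1) (volume.prod volume) :=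
    (hηi.convolution_integrand L hχi).mul_bdd
      (hg.comp continuous_fst).aestronglyMeasurable (Eventually.of_forall fun p => hC p.1)
  have hslice : ∀ z ∈ Metric.ball (0 : Space N) δ,
      ∫ x, chi E (x - z) * divergence φ x ≤ P := fun z hz => by
    rw [mem_ball_zero_iff] at hz
    have htest : IsTestField Ω fun y => φ (y + z) := by
      have hsub : tsupport (fun y => φ (y + z)) ⊆ Metric.cthickening (δ + δ) K := by
        refine closure_minimal (fun y hy => ?_) Metric.isClosed_cthickening
        exact mem_cthickening_of_add_mem hδ.le hz.le (husK (hφs (subset_closure hy)))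
      exact ⟨hφ.comp (contDiff_id.add contDiff_const),
        hc.1.cthickening.of_isClosed_subset isClosed_closure hsub, hsub.trans hKδ2,
        fun y => hφ1 _⟩
    have h1 : ∫ x, chi E (x - z) * divergence φ x =
        ∫ x in Ω, chi E x * divergence (fun y => φ (y + z)) x := by
      rw [setIntegral_eq_integral_of_forall_compl_eq_zero, ← integral_add_right_eq_self _ z]
      · simp only [add_sub_cancel_right, divergence_comp_add_right]
      · intro x hx
        have : x ∉ E := fun h => hx (hc.2 (subset_closure h))
        simp [chi, this]
    rw [h1]
    exact (ENNReal.ofReal_le_iff_le_toReal hE.2.ne).1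
      (le_iSup₂_of_le (fun y => φ (y + z)) htest le_rfl)
  calc ∫ x, u x * divergence φ x
      = ∫ x, ∫ z, η z * chi E (x - z) * divergence φ x := by
        simp only [huval, integral_mul_const]
    _ = ∫ z, ∫ x, η z * chi E (x - z) * divergence φ x := integral_integral_swap hint
    _ ≤ ∫ z, η z * P := by
        refine integral_mono hint.integral_prod_right (hηi.mul_const _) fun z => ?_
        simp only [mul_assoc, integral_const_mul]
        by_cases hz : z ∈ Metric.ball (0 : Space N) δ
        · exact mul_le_mul_of_nonneg_left (hslice z hz) (hη0 z)
        · rw [← hηs, Function.notMem_support] at hz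
          simp [hz]
    _ = P := by rw [integral_mul_const, hη1, one_mul]

lemma lambdaOne_le_lambdaZero {n : ℕ} (hΩ : IsOpen Ω) : lambdaOne n Ω ≤ lambdaZero n Ω := by
  refine le_iInf₂ fun E hE => ?_
  obtain ⟨u, hu, hu0, huE, huP⟩ := exists_mollification hΩ hE.1 hE.2
  refine (iInf_le_of_le u (iInf₂_le (gradient u) (isW110_of_isTestFunction hu))).trans ?_
  refine add_le_add ((setLIntegral_le_lintegral _ _).trans huP) (le_of_eq ?_)
  simp only [abs_of_nonneg (hu0 _)]
  rw [setIntegral_eq_integral_of_forall_compl_eq_zero fun x hx =>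
      image_eq_zero_of_notMem_tsupport fun h => hx (hu.2.2 h), huE,
    setIntegral_eq_integral_of_forall_compl_eq_zero (f := chi E) fun x hx =>
      indicator_of_notMem (fun h => hx (hE.2.2 (subset_closure h))) _]

end

end PenalizedOneLaplacian

end

theorem theorem5p1 (N : ℕ) (hN : 1 < N) (n : ℕ) (hn : 1 ≤ n)
    (Ω : Set (EuclideanSpace ℝ (Fin N))) (hΩ_open : IsOpen Ω) (hΩ_conn : IsConnected Ω)
    (hΩ_bdd : Bornology.IsBounded Ω)
    (hΩ_bdry : PenalizedOneLaplacian.HasPiecewiseC1Boundary Ω) :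
    (PenalizedOneLaplacian.lambdaZero n Ω =
      ⨅ (E : Set (EuclideanSpace ℝ (Fin N))) (_ : PenalizedOneLaplacian.IsCaccioppoli Ω E),
        PenalizedOneLaplacian.totalVariation Ω (PenalizedOneLaplacian.chi E)
          + PenalizedOneLaplacian.boundaryIntegral Ω (PenalizedOneLaplacian.chi E)
          + PenalizedOneLaplacian.penalty n (∫ x in Ω, PenalizedOneLaplacian.chi E x)) ∧
    (PenalizedOneLaplacian.lambdaZero n Ω =
      ⨅ (E : Set (EuclideanSpace ℝ (Fin N))) (_ : PenalizedOneLaplacian.IsCaccioppoli Ω E),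
        PenalizedOneLaplacian.perimeter E Ω
          + PenalizedOneLaplacian.surfaceMeasure Ω (PenalizedOneLaplacian.boundaryPart E Ω)
          + PenalizedOneLaplacian.penalty n (volume.real (E ∩ Ω))) ∧
    PenalizedOneLaplacian.lambdaOne n Ω ≤ PenalizedOneLaplacian.lambdaZero n Ω ∧
    PenalizedOneLaplacian.lambdaOneRelaxed n Ω ≤ PenalizedOneLaplacian.lambdaZero n Ω := by
  -- The base of the charts is `ℝ^m`. The condition `m ≠ 0` serves only to cut off the singular set.
  obtain ⟨m, rfl⟩ : ∃ m, N = m + 1 := ⟨N - 1, by omega⟩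
  have hm : m ≠ 0 := by omega
  exact ⟨PenalizedOneLaplacian.lambdaZero_eq_boundaryIntegral hm hΩ_open hΩ_bdd hΩ_bdry,
    PenalizedOneLaplacian.lambdaZero_eq_perimeter hm hΩ_open hΩ_bdd hΩ_bdry,
    PenalizedOneLaplacian.lambdaOne_le_lambdaZero hΩ_open,
    PenalizedOneLaplacian.lambdaOneRelaxed_le_lambdaZero hΩ_open⟩
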